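/- **Theorem 4.1.** Let $B^k=\{x\in\mathbb R^k:\|x\|\le 1\}$, with the Euclidean norm, and let $\log$ be the natural logarithm. Algorithms run on a unit-cost RAM whose memory cells hold either words of $O(\log n)$ bits (arithmetic on words, and reading a block of at most one word from a bit string, cost one step) or exact real numbers (the four arithmetic operations and comparisons, no rounding to integers). A randomized sketching algorithm consists of two fixed programs, the same for all $n,k,\varepsilon$. The *sketching* program receives $n,k,\varepsilon$, one point of $B^k$, a sequence of independent fair random bits shared by all points, and a further such sequence private to that point (all these sequences being independent), and outputs a bit string, the sketch of the point. The *recovery* program receives $n,k,\varepsilon$ and two sketches produced with the same shared bits, and outputs a real number. There are a randomized sketching algorithm, a function $g(n,k,\varepsilon)$ with values in $\mathbb N$, and absolute constants behind all $O$ and $\Theta$ below, such that the following holds for all $n\ge 1$ and all $\frac{1}{n^{0.49}}\le\varepsilon\le 0.1$, in each of the three ranges of $k$ listed below. For every point of $B^k$ and all values of the random bits, the sketch has exactly $g(n,k,\varepsilon)$ bits. For any $n$ points of $B^k$, with probability at least $1-\frac1n$, for every two of these points (with distinct indices) the recovery program computes from their two sketches the square of their distance up to an additive error of $\varepsilon$.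 Given any two sketches of points of $B^k$ (with the same shared bits), the recovery program runs in time $O(\frac{\log n}{\varepsilon^2})$ if $\frac{\log n}{\varepsilon^2}\le k\le n$ and in time $O(k)$ in the other two ranges. Moreover: * For $\frac{\log n}{\varepsilon^2}\le k\le n$, $g(n,k,\varepsilon)=\Theta\left(\frac{\log n}{\varepsilon^2}\right)$, and the sketch of a given point is computed in time $O\left(k\log k+\frac{\log^3 n}{\varepsilon^2}\right)$. * For $\log n\le k\le\frac{\log n}{\varepsilon^2}$, $g(n,k,\varepsilon)=\Theta\left(k\log\left(2+\frac{\log n}{\varepsilon^2k}\right)\right)$, and the sketch of a given point is computed in time linear in its length. * For $1\le k\le\log n$, $g(n,k,\varepsilon)=\Theta\left(k\log(1/\varepsilon)\right)$, and the sketch of a given point is computed in time linear in its length. All time bounds hold for all values of the random bits. In all three ranges the length of the sketch is optimal up to a constant factor: there is an absolute constant $c>0$ such that if, by any means whatsoever, every $n$ distinct points of $B^k$ can be given $n$ bit strings of length at most $L$ each, from which a fixed recovery function of the $n$ strings and of two distinct indices computes the square of the distance between the two corresponding points up to an additive error of $\varepsilon$, then $L\ge c\,g(n,k,\varepsilon)$.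 -/

import Mathlib

namespace DistanceSketch

/-! ## The machine

A unit-cost random access machine with two kinds of memory cells: words of `wordBits` bits, and
exact real numbers (a real RAM: the four arithmetic operations and comparisons, with no rounding
to integers and no roots).  Programs are written in a structured language.  A program is one fixed
finite object, used for all inputs, so that evaluating one of its expressions takes a constant
number of elementary operations; each assignment, each test and each emitted bit costs one step. -/

/-- What a program can only read: the word length, and two bit streams
(random bits while sketching, the two sketches while recovering). -/
structure Machine where
  wordBits : ℕ
  stream : Bool → ℕ → Bool

/-- The contents of the memory: arrays of words, arrays of reals (the first argument is the
name of the array, the second one the index), and the bits emitted so far. -/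
structure Store where
  word : ℕ → ℕ → ℕ
  real : ℕ → ℕ → ℝ
  out : List Bool

/-- Word expressions. `bits b p l` reads, as a binary number, the `l` bits of stream `b` that
start at position `p`. -/
inductive WExp where
  | lit (c : ℕ)
  | get (a : ℕ) (i : WExp)
  | add (x y : WExp)
  | sub (x y : WExp)
  | mul (x y : WExp)
  | div (x y : WExp)
  | mod (x y : WExp)
  | bits (b : Bool) (p l : WExp)

/-- The value of a word expression. Every intermediate value is reduced to `wordBits` bits
(subtraction is truncated at `0`); in particular `bits` never returns more than one word. -/
def WExp.eval (M : Machine) (s : Store) : WExp → ℕ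
  | .lit c => c % 2 ^ M.wordBits
  | .get a i => s.word a (i.eval M s) % 2 ^ M.wordBits
  | .add x y => (x.eval M s + y.eval M s) % 2 ^ M.wordBits
  | .sub x y => x.eval M s - y.eval M s
  | .mul x y => (x.eval M s * y.eval M s) % 2 ^ M.wordBits
  | .div x y => x.eval M s / y.eval M s
  | .mod x y => x.eval M s % y.eval M s
  | .bits b p l =>
      (∑ t ∈ Finset.range (l.eval M s),
        if M.stream b (p.eval M s + t) then 2 ^ t else 0) % 2 ^ M.wordBits

/-- Real expressions; words can be converted to reals, not conversely. -/
inductive RExp where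
  | ofWord (x : WExp)
  | get (a : ℕ) (i : WExp)
  | add (x y : RExp)
  | sub (x y : RExp)
  | mul (x y : RExp)
  | div (x y : RExp)

noncomputable def RExp.eval (M : Machine) (s : Store) : RExp → ℝ
  | .ofWord x => (x.eval M s : ℝ)
  | .get a i => s.real a (i.eval M s)
  | .add x y => x.eval M s + y.eval M s
  | .sub x y => x.eval M s - y.eval M s
  | .mul x y => x.eval M s * y.eval M s
  | .div x y => x.eval M s / y.eval M s

/-- Tests. -/
inductive BExp where
  | wordLt (x y : WExp)
  | realLt (x y : RExp)
  | not (b : BExp)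
  | and (b c : BExp)

def BExp.Holds (M : Machine) (s : Store) : BExp → Prop
  | .wordLt x y => x.eval M s < y.eval M s
  | .realLt x y => x.eval M s < y.eval M s
  | .not b => ¬ b.Holds M s
  | .and b c => b.Holds M s ∧ c.Holds M s

/-- Programs. -/
inductive Prog where
  | skip
  | setWord (a : ℕ) (i e : WExp)
  | setReal (a : ℕ) (i : WExp) (e : RExp)
  | emit (b : BExp)
  | seq (p q : Prog)
  | ite (b : BExp) (p q : Prog)
  | loop (b : BExp) (p : Prog)

def Store.putWord (s : Store) (a i v : ℕ) : Store :=
  { s with word := Function.update s.word a (Function.update (s.word a) i v) }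

noncomputable def Store.putReal (s : Store) (a i : ℕ) (v : ℝ) : Store :=
  { s with real := Function.update s.real a (Function.update (s.real a) i v) }

open Classical in
noncomputable def Store.emit (s : Store) (P : Prop) : Store :=
  { s with out := s.out ++ [decide P] }

/-- `Run M p s s' t`: started in `s`, the program `p` halts in `s'` after exactly `t` steps. -/
inductive Run (M : Machine) : Prog → Store → Store → ℕ → Prop where
  | skip (s : Store) : Run M .skip s s 1
  | setWord (s : Store) (a : ℕ) (i e : WExp) :
      Run M (.setWord a i e) s (s.putWord a (i.eval M s) (e.eval M s)) 1
  | setReal (s : Store) (a : ℕ) (i : WExp) (e : RExp) :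
      Run M (.setReal a i e) s (s.putReal a (i.eval M s) (e.eval M s)) 1
  | emit (s : Store) (b : BExp) : Run M (.emit b) s (s.emit (b.Holds M s)) 1
  | seq {p q : Prog} {s s' s'' : Store} {t t' : ℕ} :
      Run M p s s' t → Run M q s' s'' t' → Run M (.seq p q) s s'' (t + t')
  | iteTrue {b : BExp} {p q : Prog} {s s' : Store} {t : ℕ} :
      b.Holds M s → Run M p s s' t → Run M (.ite b p q) s s' (t + 1)
  | iteFalse {b : BExp} {p q : Prog} {s s' : Store} {t : ℕ} :
      ¬ b.Holds M s → Run M q s s' t → Run M (.ite b p q) s s' (t + 1)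
  | loopTrue {b : BExp} {p : Prog} {s s' s'' : Store} {t t' : ℕ} :
      b.Holds M s → Run M p s s' t → Run M (.loop b p) s' s'' t' →
        Run M (.loop b p) s s'' (t + t' + 1)
  | loopFalse {b : BExp} {p : Prog} {s : Store} :
      ¬ b.Holds M s → Run M (.loop b p) s s 1

/-! ## Sketching and recovering -/

/-- Words of `κ * (⌊log₂ n⌋ + 1)` bits, that is, of `O(log n)` bits. -/
def wordLength (κ n : ℕ) : ℕ := κ * (Nat.log 2 n + 1)

/-- The initial memory: the word array `0` holds `n`, `k`, the word length and `l`, the real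
array `0` holds `ε`, the real array `1` holds the vector `x`, and all else is `0`. -/
noncomputable def initStore (W n k l : ℕ) (ε : ℝ) (x : ℕ → ℝ) : Store where
  word a i := if a = 0 then [n, k, W, l].getD i 0 % 2 ^ W else 0
  real a i := if a = 0 then (if i = 0 then ε else 0) else if a = 1 then x i else 0
  out := []

/-- The coordinates of a point of `ℝᵏ`, followed by zeros. -/
noncomputable def coords {k : ℕ} (x : EuclideanSpace ℝ (Fin k)) (i : ℕ) : ℝ :=
  if h : i < k then x ⟨i, h⟩ else 0

/-- On the point `x`, the random bits `shared` (common to all points) and the random bits `priv`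
(belonging to this point alone), the program `enc` emits the sketch `a` in exactly `t` steps. -/
def Sketches (κ : ℕ) (enc : Prog) (n k : ℕ) (ε : ℝ) (shared priv : ℕ → Bool)
    (x : EuclideanSpace ℝ (Fin k)) (a : List Bool) (t : ℕ) : Prop :=
  ∃ s : Store, s.out = a ∧
    Run ⟨wordLength κ n, fun b => if b then priv else shared⟩ enc
      (initStore (wordLength κ n) n k 0 ε (coords x)) s t

/-- From the sketches `a` and `b` (and `n`, `k`, `ε`, and the length of the sketches) the program
`dec` computes the number `v` in exactly `t` steps; `v` is left in cell `0` of the real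
array `0`. -/
def Recovers (κ : ℕ) (dec : Prog) (n k : ℕ) (ε : ℝ) (a b : List Bool) (v : ℝ) (t : ℕ) : Prop :=
  ∃ s : Store, s.real 0 0 = v ∧
    Run ⟨wordLength κ n, fun c i => (if c then b else a).getD i false⟩ dec
      (initStore (wordLength κ n) n k a.length ε (fun _ => 0)) s t

/-- The law of the random bits: independent fair coins, one infinite sequence `none` shared by
all points and one infinite sequence `some i` for every point. -/
noncomputable def coins (n : ℕ) : MeasureTheory.Measure (Option (Fin n) × ℕ → Bool) :=
  MeasureTheory.Measure.infinitePi fun _ => (PMF.uniformOfFintype Bool).toMeasure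

/-- For the parameters `n`, `k`, `ε` the pair `enc`, `dec` is a randomized sketching algorithm with
sketches of `l` bits, sketching time at most `S` per point and recovery time at most `R` per pair:

* whatever the random bits, `enc` turns every point of the unit ball into a sketch of exactly
  `l` bits in at most `S` steps;
* on any two such sketches (with common shared bits) `dec` halts in at most `R` steps;
* for any `n` points of the unit ball, all the squared distances between two of them are recovered
  from their sketches up to `ε`, except with probability at most `1 / n`. -/
def IsSketchAlgorithm (κ : ℕ) (enc dec : Prog) (n k : ℕ) (ε : ℝ) (l : ℕ) (S R : ℝ) : Prop :=
  (∀ (shared priv : ℕ → Bool) (x : EuclideanSpace ℝ (Fin k)), ‖x‖ ≤ 1 →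
    ∃ (a : List Bool) (t : ℕ), Sketches κ enc n k ε shared priv x a t ∧
      a.length = l ∧ (t : ℝ) ≤ S) ∧
  (∀ (shared priv priv' : ℕ → Bool) (x y : EuclideanSpace ℝ (Fin k)), ‖x‖ ≤ 1 → ‖y‖ ≤ 1 →
    ∀ (a b : List Bool) (t t' : ℕ), Sketches κ enc n k ε shared priv x a t →
      Sketches κ enc n k ε shared priv' y b t' →
      ∃ (v : ℝ) (r : ℕ), Recovers κ dec n k ε a b v r ∧ (r : ℝ) ≤ R) ∧
  (∀ x : Fin n → EuclideanSpace ℝ (Fin k), (∀ i, ‖x i‖ ≤ 1) →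
    coins n {ω | ∃ i j : Fin n, i ≠ j ∧
      ∃ (a b : List Bool) (t t' r : ℕ) (v : ℝ),
        Sketches κ enc n k ε (fun m => ω (none, m)) (fun m => ω (some i, m)) (x i) a t ∧
        Sketches κ enc n k ε (fun m => ω (none, m)) (fun m => ω (some j, m)) (x j) b t' ∧
        Recovers κ dec n k ε a b v r ∧
        ε < |v - ‖x i - x j‖ ^ 2|} ≤ ENNReal.ofReal (1 / n))

/-- It is possible at all (by any means, efficient or not) to give sketches of at most `L` bits
each to every set of `n` points of the unit ball of `ℝᵏ`, so that the squared distances can be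
recovered up to `ε`. Recovery may even use the indices of the two points and all `n` sketches. -/
def SketchesExist (n k : ℕ) (ε : ℝ) (L : ℕ) : Prop :=
  ∃ rec : (Fin n → List Bool) → Fin n → Fin n → ℝ,
    ∀ x : Fin n → EuclideanSpace ℝ (Fin k), Function.Injective x → (∀ i, ‖x i‖ ≤ 1) →
      ∃ a : Fin n → List Bool, (∀ i, (a i).length ≤ L) ∧
        ∀ i j, i ≠ j → |rec a i j - ‖x i - x j‖ ^ 2| ≤ ε

end DistanceSketch

set_option linter.unusedSimpArgs false

namespace DistanceSketch

/-! ## Reasoning about programs -/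

/-! The square of a distance is ‖x‖² + ‖y‖² - 2⟨x, y⟩. A sketch therefore stores a rounded copy of
the point, or of a projection of it, together with its rounded squared norm, and recovery evaluates
this formula on the rounded data. Write l for the number of bits of n.

Projection. If k exceeds a large multiple of l/ε², the dimension is lowered to D = Θ(l/ε²). Random
signs and a fast Walsh-Hadamard transform flatten the point: all squared entries are at most 16l.
Each new coordinate is a signed sum of (16l)² random entries. Flatness makes the samples
representative (`chernoff`, `hoeffding`). Given the samples, the products of the new coordinates of
two points are independent and have sub-exponential tails (`prob_chaos_le`), so their sum preserves
the inner product up to 3ε/16 (`prob_projOf_le`). The transform costs O(k log k), the sampling O(D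
l²), which is O(log³ n/ε²).

Rounding. A coordinate of a vector of norm O(1) has typical size 1/√D. Its multiple of T ≈ 1/√D is
written in unary; all these multiples together are O(D) (`Admissible.sum_floor_le`), so a few large
coordinates cost little. The remainder is written in binary with spacing s ≈ ε/√min(D, l), after
adding a private random dither. Dithering makes the errors nearly centered and independent, so
against a fixed vector of norm O(1) they add up to about s√l. If D ≤ l, Cauchy-Schwarz suffices
instead (`prob_rounding_le`). The number of bits per coordinate is about log(T/s), where T/s is
O(1), √(log n/(ε²k)) or 1/ε in the three ranges.

A pair fails with probability at most 34·2^l·exp(-8l) (`prob_fails_le`), which survives the union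
bound over n² pairs with a factor 1/n to spare. Both parts of the code are cut off by caps, so the
length is fixed for all random bits; the caps are inactive unless the projection has distorted a
norm.

The machine takes no roots, so the square roots in T and s are replaced by least integers found by
search, and the projected dimension is a perfect square. Correctness and running time are proved
together in a calculus of total correctness (`Wp`) with syntactic frame conditions. Determinism
turns the constructed run into a statement about every run.

Lower bound. At least half of the n points carry arbitrary words over a grid with q levels; the
others are reference points, namely the sign vectors supported in one of B blocks of m coordinates,
with m of order log n when k permits and B of order at most 1/ε². The inner products with all sign
vectors of a block determine the ℓ¹ norm of a difference there. Hence families of words with equal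
sketches agree in most letters, and counting gives B m log q = O(L) (`SketchesExist.card_le`,
`hammingDist_le_of_inner`, `SketchesExist.le`). -/

theorem Run.det {M : Machine} {p : Prog} {s s₁ s₂ : Store} {t₁ t₂ : ℕ}
    (h₁ : Run M p s s₁ t₁) (h₂ : Run M p s s₂ t₂) : s₁ = s₂ ∧ t₁ = t₂ := by
  induction h₁ generalizing s₂ t₂ with
  | skip => cases h₂; exact ⟨rfl, rfl⟩
  | setWord => cases h₂; exact ⟨rfl, rfl⟩
  | setReal => cases h₂; exact ⟨rfl, rfl⟩
  | emit => cases h₂; exact ⟨rfl, rfl⟩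
  | seq _ _ ih ih' =>
    cases h₂ with
    | seq a b =>
      obtain ⟨rfl, rfl⟩ := ih a
      obtain ⟨rfl, rfl⟩ := ih' b
      exact ⟨rfl, rfl⟩
  | iteTrue hb _ ih =>
    cases h₂ with
    | iteTrue _ a => obtain ⟨rfl, rfl⟩ := ih a; exact ⟨rfl, rfl⟩
    | iteFalse hn _ => exact absurd hb hn
  | iteFalse hb _ ih =>
    cases h₂ with
    | iteTrue hn _ => exact absurd hn hb
    | iteFalse _ a => obtain ⟨rfl, rfl⟩ := ih a; exact ⟨rfl, rfl⟩
  | loopTrue hb _ _ ih ih' =>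
    cases h₂ with
    | loopTrue _ a b =>
      obtain ⟨rfl, rfl⟩ := ih a
      obtain ⟨rfl, rfl⟩ := ih' b
      exact ⟨rfl, rfl⟩
    | loopFalse hn => exact absurd hb hn
  | loopFalse hb =>
    cases h₂ with
    | loopTrue hn _ _ => exact absurd hn hb
    | loopFalse _ => exact ⟨rfl, rfl⟩

/-- The word arrays a program may write to. -/
def Prog.wordTargets : Prog → List ℕ
  | .setWord a _ _ => [a]
  | .seq p q => p.wordTargets ++ q.wordTargets
  | .ite _ p q => p.wordTargets ++ q.wordTargets
  | .loop _ p => p.wordTargets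
  | _ => []

/-- The real arrays a program may write to. -/
def Prog.realTargets : Prog → List ℕ
  | .setReal a _ _ => [a]
  | .seq p q => p.realTargets ++ q.realTargets
  | .ite _ p q => p.realTargets ++ q.realTargets
  | .loop _ p => p.realTargets
  | _ => []

/-- Whether a program contains an `emit`. -/
def Prog.emits : Prog → Bool
  | .emit _ => true
  | .seq p q => p.emits || q.emits
  | .ite _ p q => p.emits || q.emits
  | .loop _ p => p.emits
  | _ => false

/-- `s'` differs from `s` at most in what `p` may write. -/
structure Frame (p : Prog) (s s' : Store) : Prop where
  word : ∀ a, a ∉ p.wordTargets → s'.word a = s.word a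
  real : ∀ a, a ∉ p.realTargets → s'.real a = s.real a
  out : p.emits = false → s'.out = s.out

theorem Frame.refl (p : Prog) (s : Store) : Frame p s s := ⟨by simp, by simp, by simp⟩

theorem Frame.trans {p : Prog} {s s' s'' : Store} (h : Frame p s s') (h' : Frame p s' s'') :
    Frame p s s'' :=
  ⟨fun a ha => (h'.word a ha).trans (h.word a ha), fun a ha => (h'.real a ha).trans (h.real a ha),
    fun ha => (h'.out ha).trans (h.out ha)⟩

theorem Frame.mono {p q : Prog} {s s' : Store} (h : Frame p s s')
    (hw : p.wordTargets ⊆ q.wordTargets) (hr : p.realTargets ⊆ q.realTargets)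
    (he : q.emits = false → p.emits = false) : Frame q s s' :=
  ⟨fun a ha => h.word a fun h => ha (hw h), fun a ha => h.real a fun h => ha (hr h),
    fun ha => h.out (he ha)⟩

/-- Reduces the claim that a subprogram leaves a variable alone to a syntactic check, which `decide`
settles for concrete programs. -/
theorem Run.frame {M : Machine} {p : Prog} {s s' : Store} {t : ℕ} (h : Run M p s s' t) :
    Frame p s s' := by
  induction h with
  | skip => exact Frame.refl _ _
  | setWord =>
    refine ⟨fun a ha => ?_, fun a _ => rfl, fun _ => rfl⟩
    simp only [Prog.wordTargets, List.mem_singleton] at ha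
    simp [Store.putWord, ha]
  | setReal =>
    refine ⟨fun a _ => rfl, fun a ha => ?_, fun _ => rfl⟩
    simp only [Prog.realTargets, List.mem_singleton] at ha
    simp [Store.putReal, ha]
  | emit => exact ⟨fun a _ => rfl, fun a _ => rfl, by simp [Prog.emits]⟩
  | seq _ _ ih ih' =>
    exact (ih.mono (by simp [Prog.wordTargets]) (by simp [Prog.realTargets])
      (by simp +contextual [Prog.emits])).trans
      (ih'.mono (by simp [Prog.wordTargets]) (by simp [Prog.realTargets])
      (by simp +contextual [Prog.emits]))
  | iteTrue _ _ ih =>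
    exact ih.mono (by simp [Prog.wordTargets]) (by simp [Prog.realTargets])
      (by simp +contextual [Prog.emits])
  | iteFalse _ _ ih =>
    exact ih.mono (by simp [Prog.wordTargets]) (by simp [Prog.realTargets])
      (by simp +contextual [Prog.emits])
  | loopTrue _ _ _ ih ih' =>
    exact (ih.mono (by simp [Prog.wordTargets]) (by simp [Prog.realTargets])
      (by simp [Prog.emits])).trans ih'
  | loopFalse => exact Frame.refl _ _

/-- Started in `s`, the program `p` halts, in a state and after a time that satisfy `Q`. -/
def Wp (M : Machine) (p : Prog) (s : Store) (Q : Store → ℕ → Prop) : Prop :=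
  ∃ s' t, Run M p s s' t ∧ Q s' t

section Wp

variable {M : Machine} {p q : Prog} {s : Store} {Q R : Store → ℕ → Prop}

theorem Wp.mono (h : Wp M p s Q) (hQ : ∀ s' t, Q s' t → R s' t) : Wp M p s R := by
  obtain ⟨s', t, hr, hq⟩ := h
  exact ⟨s', t, hr, hQ _ _ hq⟩

theorem Wp.frame (h : Wp M p s Q) : Wp M p s fun s' t => Q s' t ∧ Frame p s s' := by
  obtain ⟨s', t, hr, hq⟩ := h
  exact ⟨s', t, hr, hq, hr.frame⟩

theorem Wp.skip (h : Q s 1) : Wp M .skip s Q := ⟨_, _, .skip s, h⟩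

theorem Wp.setWord {a : ℕ} {i e : WExp} (h : Q (s.putWord a (i.eval M s) (e.eval M s)) 1) :
    Wp M (.setWord a i e) s Q := ⟨_, _, .setWord s a i e, h⟩

theorem Wp.setReal {a : ℕ} {i : WExp} {e : RExp}
    (h : Q (s.putReal a (i.eval M s) (e.eval M s)) 1) :
    Wp M (.setReal a i e) s Q := ⟨_, _, .setReal s a i e, h⟩

theorem Wp.emit {b : BExp} (h : Q (s.emit (b.Holds M s)) 1) : Wp M (.emit b) s Q :=
  ⟨_, _, .emit s b, h⟩

theorem Wp.seq (h : Wp M p s fun s' t => Wp M q s' fun s'' t' => Q s'' (t + t')) :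
    Wp M (.seq p q) s Q := by
  obtain ⟨s', t, hr, s'', t', hr', hq⟩ := h
  exact ⟨s'', t + t', .seq hr hr', hq⟩

theorem Wp.ite {b : BExp} (ht : b.Holds M s → Wp M p s fun s' t => Q s' (t + 1))
    (hf : ¬ b.Holds M s → Wp M q s fun s' t => Q s' (t + 1)) : Wp M (.ite b p q) s Q := by
  by_cases hb : b.Holds M s
  · obtain ⟨s', t, hr, hq⟩ := ht hb
    exact ⟨s', t + 1, .iteTrue hb hr, hq⟩
  · obtain ⟨s', t, hr, hq⟩ := hf hb
    exact ⟨s', t + 1, .iteFalse hb hr, hq⟩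

/-- The rule for loops: `I i s t` is what holds after `i` of the `N` rounds, in which `t` steps
have been made. -/
theorem Wp.loop {b : BExp} (N : ℕ) (I : ℕ → Store → ℕ → Prop) (h0 : I 0 s 0)
    (hstep : ∀ i, i < N → ∀ s' t, I i s' t → Frame p s s' →
      b.Holds M s' ∧ Wp M p s' fun s'' t' => I (i + 1) s'' (t + t' + 1))
    (hend : ∀ s' t, I N s' t → Frame p s s' → ¬ b.Holds M s')
    (hQ : ∀ s' t, I N s' t → Frame p s s' → Q s' (t + 1)) : Wp M (.loop b p) s Q := by
  have key : ∀ j i, i + j = N → ∀ s' t, I i s' t → Frame p s s' →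
      Wp M (.loop b p) s' fun s'' t' => Q s'' (t + t') := by
    intro j
    induction j with
    | zero =>
      intro i hi s' t hI hF
      obtain rfl : i = N := by omega
      exact ⟨s', 1, .loopFalse (hend _ _ hI hF), hQ _ _ hI hF⟩
    | succ j ih =>
      intro i hi s' t hI hF
      obtain ⟨hb, s'', t', hr, hI'⟩ := hstep i (by omega) s' t hI hF
      obtain ⟨s₃, t₃, hr₃, hq⟩ := ih (i + 1) (by omega) s'' _ hI' (hF.trans hr.frame)
      refine ⟨s₃, t' + t₃ + 1, .loopTrue hb hr hr₃, ?_⟩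
      have : t + (t' + t₃ + 1) = t + t' + 1 + t₃ := by omega
      show Q s₃ (t + (t' + t₃ + 1))
      rw [this]
      exact hq
  refine (key N 0 (by omega) s 0 h0 (Frame.refl _ _)).mono fun s' t h => ?_
  simpa using h

/-- The rule for loops whose rounds take at most `c` steps. -/
theorem Wp.loopConst {b : BExp} (N c : ℕ) (I : ℕ → Store → Prop) (h0 : I 0 s)
    (hstep : ∀ i, i < N → ∀ s', I i s' → Frame p s s' →
      b.Holds M s' ∧ Wp M p s' fun s'' t' => I (i + 1) s'' ∧ t' ≤ c)
    (hend : ∀ s', I N s' → Frame p s s' → ¬ b.Holds M s')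
    (hQ : ∀ s' t, I N s' → Frame p s s' → t ≤ N * (c + 1) + 1 → Q s' t) :
    Wp M (.loop b p) s Q := by
  refine Wp.loop N (fun i s' t => I i s' ∧ t ≤ i * (c + 1)) ⟨h0, by simp⟩ ?_ ?_ ?_
  · rintro i hi s' t ⟨hI, ht⟩ hF
    obtain ⟨hb, hw⟩ := hstep i hi s' hI hF
    refine ⟨hb, hw.mono fun s'' t' h => ⟨h.1, ?_⟩⟩
    have := h.2
    rw [Nat.succ_mul]
    omega
  · rintro s' t ⟨hI, ht⟩ hF
    exact hend s' hI hF
  · rintro s' t ⟨hI, ht⟩ hF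
    exact hQ _ _ hI hF (by omega)

/-- The rule for loops that search for the least element of a set. -/
theorem Wp.find {b : BExp} (S : Set ℕ) (hS : S.Nonempty) (c : ℕ) (I : ℕ → Store → Prop)
    (h0 : I 0 s)
    (hb : ∀ i, i ≤ sInf S → ∀ s', I i s' → Frame p s s' → (b.Holds M s' ↔ i ∉ S))
    (hstep : ∀ i, i < sInf S → ∀ s', I i s' → Frame p s s' →
      Wp M p s' fun s'' t' => I (i + 1) s'' ∧ t' ≤ c)
    (hQ : ∀ s' t, I (sInf S) s' → Frame p s s' → t ≤ sInf S * (c + 1) + 1 → Q s' t) :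
    Wp M (.loop b p) s Q :=
  Wp.loopConst (sInf S) c I h0
    (fun i hi s' hI hF =>
      ⟨(hb i hi.le s' hI hF).2 fun h => absurd (Nat.sInf_le h) (by omega), hstep i hi s' hI hF⟩)
    (fun s' hI hF h => (hb _ le_rfl s' hI hF).1 h (Nat.sInf_mem hS)) hQ

end Wp

@[simp] theorem Store.putWord_word (s : Store) (a i v a' : ℕ) (i' : ℕ) :
    (s.putWord a i v).word a' i' =
      if a' = a then if i' = i then v else s.word a i' else s.word a' i' := by
  by_cases h : a' = a
  · subst h
    by_cases h' : i' = i <;> simp [Store.putWord, h']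
  · simp [Store.putWord, h]

@[simp] theorem Store.putWord_real (s : Store) (a i v : ℕ) : (s.putWord a i v).real = s.real := rfl
@[simp] theorem Store.putWord_out (s : Store) (a i v : ℕ) : (s.putWord a i v).out = s.out := rfl

@[simp] theorem Store.putReal_real (s : Store) (a i : ℕ) (v : ℝ) (a' : ℕ) (i' : ℕ) :
    (s.putReal a i v).real a' i' =
      if a' = a then if i' = i then v else s.real a i' else s.real a' i' := by
  by_cases h : a' = a
  · subst h
    by_cases h' : i' = i <;> simp [Store.putReal, h']
  · simp [Store.putReal, h]

@[simp] theorem Store.putReal_word (s : Store) (a i : ℕ) (v : ℝ) :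
    (s.putReal a i v).word = s.word := rfl
@[simp] theorem Store.putReal_out (s : Store) (a i : ℕ) (v : ℝ) : (s.putReal a i v).out = s.out :=
  rfl

@[simp] theorem Store.emit_word (s : Store) (P : Prop) : (s.emit P).word = s.word := rfl
@[simp] theorem Store.emit_real (s : Store) (P : Prop) : (s.emit P).real = s.real := rfl
open Classical in
@[simp] theorem Store.emit_out (s : Store) (P : Prop) : (s.emit P).out = s.out ++ [decide P] := rfl

end DistanceSketch

namespace DistanceSketch

/-! ## The programs -/

/-- The scalar word variable `a`. -/
abbrev wv (a : ℕ) : WExp := .get a (.lit 0)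
/-- The scalar real variable `a`. -/
abbrev rv (a : ℕ) : RExp := .get a (.lit 0)
abbrev wl (c : ℕ) : WExp := .lit c
abbrev setW (a : ℕ) (e : WExp) : Prog := .setWord a (.lit 0) e
abbrev setR (a : ℕ) (e : RExp) : Prog := .setReal a (.lit 0) e
abbrev incr (a : ℕ) : Prog := setW a (.add (wv a) (wl 1))
abbrev rzero : RExp := .ofWord (wl 0)
abbrev emitTrue : Prog := .emit (.wordLt (wl 0) (wl 1))
abbrev emitFalse : Prog := .emit (.wordLt (wl 0) (wl 0))

infixr:55 " ;; " => Prog.seq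

abbrev kExp : WExp := .get 0 (wl 1)

/-! ### Proof rules for scalar assignments. -/

section ScalarRules

variable {M : Machine} {p q : Prog} {s : Store} {P Q : Store → ℕ → Prop}

theorem Wp.seq' (hp : Wp M p s P)
    (h : ∀ s₁ t₁, P s₁ t₁ → Frame p s s₁ → Wp M q s₁ fun s' t => Q s' (t₁ + t)) :
    Wp M (p ;; q) s Q :=
  .seq (hp.frame.mono fun s₁ t₁ hs => h s₁ t₁ hs.1 hs.2)

theorem Wp.setW {a v : ℕ} {e : WExp} (he : e.eval M s = v)
    (h : ∀ s₁, s₁.word a 0 = v → Frame (setW a e) s s₁ → Q s₁ 1) : Wp M (setW a e) s Q :=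
  (Wp.setWord (Q := fun s' t => s'.word a 0 = v ∧ t = 1) (by simp [WExp.eval, he])).frame.mono
    fun s₁ t₁ hs => by rw [hs.1.2]; exact h s₁ hs.1.1 hs.2

theorem Wp.setR {a : ℕ} {v : ℝ} {e : RExp} (he : e.eval M s = v)
    (h : ∀ s₁, s₁.real a 0 = v → Frame (setR a e) s s₁ → Q s₁ 1) : Wp M (setR a e) s Q :=
  (Wp.setReal (Q := fun s' t => s'.real a 0 = v ∧ t = 1) (by simp [WExp.eval, he])).frame.mono
    fun s₁ t₁ hs => by rw [hs.1.2]; exact h s₁ hs.1.1 hs.2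

theorem Wp.seqW {a v : ℕ} {e : WExp} (he : e.eval M s = v)
    (h : ∀ s₁, s₁.word a 0 = v → Frame (DistanceSketch.setW a e) s s₁ →
      Wp M q s₁ fun s' t => Q s' (1 + t)) : Wp M (DistanceSketch.setW a e ;; q) s Q :=
  .seq (.setW he h)

theorem Wp.seqR {a : ℕ} {v : ℝ} {e : RExp} (he : e.eval M s = v)
    (h : ∀ s₁, s₁.real a 0 = v → Frame (DistanceSketch.setR a e) s s₁ →
      Wp M q s₁ fun s' t => Q s' (1 + t)) : Wp M (DistanceSketch.setR a e ;; q) s Q :=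
  .seq (.setR he h)

end ScalarRules

/-- Computes the parameters that sketching and recovering have in common. -/
def paramProg : Prog :=
  setW 10 (.div (.get 0 (wl 2)) (wl 16)) ;;
  -- Square roots are not available, so the root of the new dimension is searched for; variable 13
  -- below is found in the same way.
  setW 11 (wl 0) ;;
  .loop (.and (.wordLt (.mul (wv 11) (wv 11)) kExp)
      (.realLt (.mul (.mul (rv 0) (rv 0)) (.ofWord (.mul (wv 11) (wv 11))))
        (.ofWord (.mul (wl (2 ^ 24)) (wv 10))))) (incr 11) ;;
  .ite (.wordLt (.mul (wv 11) (wv 11)) kExp) (setW 12 (.mul (wv 11) (wv 11))) (setW 12 kExp) ;;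
  setW 13 (wl 0) ;;
  .loop (.and (.wordLt (.mul (wv 13) (wv 13)) (wv 12)) (.wordLt (.mul (wv 13) (wv 13)) (wv 10)))
    (incr 13) ;;
  setR 10 (.div (.ofWord (wl 1)) (.ofWord (wv 11))) ;;
  setR 11 (.div (rv 0) (.ofWord (.mul (wl (2 ^ 13)) (wv 13))))

/-- Computes the number of bits for the fine position of a coordinate. -/
def fineBitsProg : Prog :=
  setW 14 (wl 0) ;;
  setR 12 (rv 11) ;;
  .loop (.realLt (rv 12) (.add (rv 10) (rv 11))) (setR 12 (.add (rv 12) (rv 12)) ;; incr 14)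

/-- Computes the number of bits for the dithering of a coordinate. -/
def ditherBitsProg : Prog :=
  setW 15 (wl 0) ;;
  setW 16 (wl 1) ;;
  .loop (.wordLt (wv 16) (wv 11)) (setW 16 (.add (wv 16) (wv 16)) ;; incr 15)

/-- The norm is that of the original point and not of its projection, so that the projection affects
only the inner product in the estimate. -/
def normProg : Prog :=
  setW 17 (wl 0) ;;
  setR 15 rzero ;;
  .loop (.wordLt (wv 17) kExp)
    (setR 15 (.add (rv 15) (.mul (.get 1 (wv 17)) (.get 1 (wv 17)))) ;; incr 17)

def copyProg : Prog :=
  setW 17 (wl 0) ;;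
  .loop (.wordLt (wv 17) kExp) (.setReal 2 (wv 17) (.get 1 (wv 17)) ;; incr 17)

/-- Computes the least power `K = 2 ^ p` of two that is at least `k`. -/
def padProg : Prog :=
  setW 21 (wl 1) ;;
  setW 22 (wl 0) ;;
  .loop (.wordLt (wv 21) kExp) (setW 21 (.add (wv 21) (wv 21)) ;; incr 22)

def signProg : Prog :=
  setW 17 (wl 0) ;;
  .loop (.wordLt (wv 17) (wv 21))
    (.ite (.wordLt (wl 0) (.bits false (wv 17) (wl 1)))
      (.setReal 3 (wv 17) (.get 1 (wv 17)))
      (.setReal 3 (wv 17) (.sub rzero (.get 1 (wv 17)))) ;;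
    incr 17)

abbrev halfExp : WExp := .div (wv 21) (wl 2)

/-- One round of the fast Walsh-Hadamard transform. -/
def butterflyProg : Prog :=
  setW 17 (wl 0) ;;
  .loop (.wordLt (wv 17) halfExp)
    (.setReal 4 (wv 17)
      (.add (.get 3 (.add (wv 17) (wv 17))) (.get 3 (.add (.add (wv 17) (wv 17)) (wl 1)))) ;;
    .setReal 4 (.add halfExp (wv 17))
      (.sub (.get 3 (.add (wv 17) (wv 17))) (.get 3 (.add (.add (wv 17) (wv 17)) (wl 1)))) ;;
    incr 17) ;;
  setW 17 (wl 0) ;;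
  .loop (.wordLt (wv 17) (wv 21)) (.setReal 3 (wv 17) (.get 4 (wv 17)) ;; incr 17)

def hadamardProg : Prog :=
  setW 20 (wl 0) ;;
  .loop (.wordLt (wv 20) (wv 22)) (butterflyProg ;; incr 20)

abbrev tauExp : WExp := .mul (wl 16) (wv 10)
abbrev sampleExp : WExp := .mul tauExp tauExp

/-- Computes every coordinate of the projection as a signed sum of random entries. -/
def sampleProg : Prog :=
  setW 23 (wv 21) ;;
  setW 24 (.add (wv 21) (.mul (.mul (wv 12) sampleExp) (wv 22))) ;;
  setW 17 (wl 0) ;;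
  .loop (.wordLt (wv 17) (wv 12))
    (setR 16 rzero ;;
    setW 20 (wl 0) ;;
    .loop (.wordLt (wv 20) sampleExp)
      (.ite (.wordLt (wl 0) (.bits false (wv 24) (wl 1)))
        (setR 16 (.add (rv 16) (.get 3 (.bits false (wv 23) (wv 22)))))
        (setR 16 (.sub (rv 16) (.get 3 (.bits false (wv 23) (wv 22))))) ;;
      setW 23 (.add (wv 23) (wv 22)) ;;
      incr 24 ;;
      incr 20) ;;
    .setReal 2 (wv 17) (.div (rv 16) (.ofWord (.mul tauExp (wv 11)))) ;;
    incr 17)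

def projectProg : Prog := padProg ;; signProg ;; hadamardProg ;; sampleProg

/-- Emits the sign of the coordinate and, in unary, its coarse position. -/
def coarseProg : Prog :=
  setR 13 (.get 2 (wv 17)) ;;
  .emit (.realLt (rv 13) rzero) ;;
  .ite (.realLt (rv 13) rzero) (setR 13 (.sub rzero (rv 13))) .skip ;;
  .loop (.and (.not (.realLt (rv 13) (rv 10))) (.wordLt (wl 0) (wv 18)))
    (emitTrue ;; setR 13 (.sub (rv 13) (rv 10)) ;; setW 18 (.sub (wv 18) (wl 1))) ;;
  emitFalse

/-- Computes the fine position of the coordinate by binary search. -/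
def fineProg : Prog :=
  setR 13 (.add (rv 13) (.mul (rv 11)
    (.div (.ofWord (.bits true (.mul (wv 17) (wv 15)) (wv 15))) (.ofWord (wv 16))))) ;;
  setR 14 (rv 12) ;;
  setW 19 (wl 0) ;;
  setW 20 (wl 0) ;;
  .loop (.wordLt (wv 20) (wv 14))
    (setR 14 (.div (rv 14) (.ofWord (wl 2))) ;;
    setW 19 (.add (wv 19) (wv 19)) ;;
    .ite (.realLt (rv 13) (rv 14)) .skip (setR 13 (.sub (rv 13) (rv 14)) ;; incr 19) ;;
    incr 20)

/-- Emits the fine position of the coordinate in binary. -/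
def emitFineProg : Prog :=
  setW 20 (wl 0) ;;
  .loop (.wordLt (wv 20) (wv 14))
    (.emit (.wordLt (wl 0) (.mod (wv 19) (wl 2))) ;;
    setW 19 (.div (wv 19) (wl 2)) ;;
    incr 20)

/-- Variable 18 is a budget of four unary digits per coordinate. What is left of it is emitted as
padding, which makes the length independent of the point and of the random bits. -/
def encodeProg : Prog :=
  setW 18 (.mul (wl 4) (.add (wv 12) (wl 1))) ;;
  setW 17 (wl 0) ;;
  .loop (.wordLt (wv 17) (.add (wv 12) (wl 1)))
    (coarseProg ;; fineProg ;; emitFineProg ;; incr 17) ;;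
  .loop (.wordLt (wl 0) (wv 18)) (emitFalse ;; setW 18 (.sub (wv 18) (wl 1)))

/-- The squared norm is put behind the coordinates and encoded as one more coordinate. -/
def sketchProg : Prog :=
  paramProg ;; fineBitsProg ;; ditherBitsProg ;; normProg ;;
  .ite (.wordLt (.mul (wv 11) (wv 11)) kExp) projectProg copyProg ;;
  .setReal 2 (wv 12) (rv 15) ;;
  encodeProg

/-- Reads one coordinate from the sketch `c`, from the position in the word variable `p` on, into
the real variable `v`. -/
def readProg (c : Bool) (p v : ℕ) : Prog :=
  setW 19 (.bits c (wv p) (wl 1)) ;;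
  incr p ;;
  setR v rzero ;;
  .loop (.wordLt (wl 0) (.bits c (wv p) (wl 1)))
    (setR v (.add (rv v) (rv 10)) ;; incr p) ;;
  incr p ;;
  setR v (.add (rv v) (.mul (rv 11) (.ofWord (.bits c (wv p) (wv 14))))) ;;
  setW p (.add (wv p) (wv 14)) ;;
  .ite (.wordLt (wl 0) (wv 19)) (setR v (.sub rzero (rv v))) .skip

def recoverProg : Prog :=
  paramProg ;;
  -- A sketch has (D + 1)(b + 6) bits: a sign, a terminator, b binary digits and on average four
  -- unary digits or padding bits per coordinate. So b can be read off from the length.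
  setW 14 (.sub (.div (.get 0 (wl 3)) (.add (wv 12) (wl 1))) (wl 6)) ;;
  setW 21 (wl 0) ;;
  setW 22 (wl 0) ;;
  setW 17 (wl 0) ;;
  setR 15 rzero ;;
  .loop (.wordLt (wv 17) (.add (wv 12) (wl 1)))
    (readProg false 21 13 ;; readProg true 22 14 ;;
    .ite (.wordLt (wv 17) (wv 12))
      (setR 15 (.sub (rv 15) (.mul (.ofWord (wl 2)) (.mul (rv 13) (rv 14)))))
      (setR 15 (.add (rv 15) (.add (rv 13) (rv 14)))) ;;
    incr 17) ;;
  setR 0 (rv 15)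

/-! ## The parameters -/

/-- The number of bits of `n`. -/
def lam (n : ℕ) : ℕ := Nat.log 2 n + 1

/-- The square root of the dimension after the projection. -/
noncomputable def rootDim (l k : ℕ) (ε : ℝ) : ℕ :=
  -- The constant 2^24 serves the exponents in `prob_projOf_le`; the tightest one is ε²D/(8²·20480),
  -- which becomes more than 12l.
  sInf {e : ℕ | k ≤ e * e ∨ 2 ^ 24 * (l : ℝ) ≤ ε * ε * (e * e)}

/-- The dimension in which the points are rounded. -/
noncomputable def dim (l k : ℕ) (ε : ℝ) : ℕ :=
  if rootDim l k ε * rootDim l k ε < k then rootDim l k ε * rootDim l k ε else k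

/-- About √min(D, l), the factor by which rounding errors accumulate in an inner product: √D in the
worst case, √l with high probability when they are independent and nearly centered. -/
noncomputable def rootMin (l D : ℕ) : ℕ := sInf {r : ℕ | D ≤ r * r ∨ l ≤ r * r}

/-- Of the order of a typical coordinate of a unit vector in dimension D, so that the unary parts
have bounded length on average. -/
noncomputable def coarse (l k : ℕ) (ε : ℝ) : ℝ := 1 / rootDim l k ε

noncomputable def fine (l k : ℕ) (ε : ℝ) : ℝ := ε / (2 ^ 13 * rootMin l (dim l k ε))

/-- Leaves room for a remainder below `T` plus a dither below `s`. -/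
noncomputable def fineBits (T s : ℝ) : ℕ := sInf {b : ℕ | T + s ≤ s * 2 ^ b}

noncomputable def log2ceil (e : ℕ) : ℕ := sInf {w : ℕ | e ≤ 2 ^ w}

/-- What the programs need to know about the parameters. -/
structure Admissible (l k : ℕ) (ε : ℝ) : Prop where
  hl : 7 ≤ l
  hk : 1 ≤ k
  hk' : k ≤ 2 ^ (3 * l)
  hε : 0 < ε
  hε' : ε ≤ 1 / 10
  hεl : 1 ≤ ε * 2 ^ l
  -- Needed only when the point is projected: it bounds the number of entries in a union bound and
  -- the positions of the shared random bits.
  hproj : rootDim l k ε * rootDim l k ε < k → k ≤ 2 ^ l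

end DistanceSketch

namespace DistanceSketch

/-! ### Elementary bounds for the parameters. -/

section Parameters

theorem rootDim_nonempty (l k : ℕ) (ε : ℝ) :
    {e : ℕ | k ≤ e * e ∨ 2 ^ 24 * (l : ℝ) ≤ ε * ε * (e * e)}.Nonempty :=
  ⟨k, Or.inl (Nat.le_mul_self k)⟩

theorem rootDim_spec (l k : ℕ) (ε : ℝ) : k ≤ rootDim l k ε * rootDim l k ε ∨
    2 ^ 24 * (l : ℝ) ≤ ε * ε * (rootDim l k ε * rootDim l k ε) :=
  Nat.sInf_mem (rootDim_nonempty l k ε)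

theorem of_lt_rootDim {l k : ℕ} {ε : ℝ} {i : ℕ} (h : i < rootDim l k ε) :
    i * i < k ∧ ε * ε * (i * i) < 2 ^ 24 * (l : ℝ) := by
  have := Nat.notMem_of_lt_sInf h
  simpa using this

theorem rootDim_le (l k : ℕ) (ε : ℝ) : rootDim l k ε ≤ k := Nat.sInf_le (Or.inl (Nat.le_mul_self k))

theorem rootMin_spec (l D : ℕ) : D ≤ rootMin l D * rootMin l D ∨ l ≤ rootMin l D * rootMin l D :=
  Nat.sInf_mem (s := {r : ℕ | D ≤ r * r ∨ l ≤ r * r}) ⟨D, Or.inl (Nat.le_mul_self D)⟩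

theorem of_lt_rootMin {l D i : ℕ} (h : i < rootMin l D) : i * i < D ∧ i * i < l := by
  have := Nat.notMem_of_lt_sInf h
  simpa using this

theorem rootMin_le {l D e : ℕ} (h : D ≤ e * e) : rootMin l D ≤ e := Nat.sInf_le (Or.inl h)

theorem rootMin_le' (l D : ℕ) : rootMin l D ≤ l := Nat.sInf_le (Or.inr (Nat.le_mul_self l))

theorem dim_le (l k : ℕ) (ε : ℝ) : dim l k ε ≤ k := by
  unfold dim; split_ifs <;> omega

theorem dim_le_sq (l k : ℕ) (ε : ℝ) : dim l k ε ≤ rootDim l k ε * rootDim l k ε := by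
  unfold dim; split_ifs <;> omega

theorem log2ceil_spec (e : ℕ) : e ≤ 2 ^ log2ceil e :=
  Nat.sInf_mem (s := {w : ℕ | e ≤ 2 ^ w}) ⟨e, Nat.lt_two_pow_self.le⟩

theorem of_lt_log2ceil {e i : ℕ} (h : i < log2ceil e) : 2 ^ i < e := by
  have := Nat.notMem_of_lt_sInf h
  simpa using this

theorem log2ceil_le {e i : ℕ} (h : e ≤ 2 ^ i) : log2ceil e ≤ i := Nat.sInf_le h

theorem two_pow_log2ceil_le {e : ℕ} (he : 1 ≤ e) : 2 ^ log2ceil e ≤ 2 * e := by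
  rcases Nat.eq_zero_or_pos (log2ceil e) with h | h
  · rw [h]; omega
  · have := of_lt_log2ceil (e := e) (i := log2ceil e - 1) (by omega)
    obtain ⟨m, hm⟩ : ∃ m, log2ceil e = m + 1 := ⟨log2ceil e - 1, by omega⟩
    rw [hm] at this ⊢
    rw [Nat.add_sub_cancel] at this
    rw [pow_succ]
    omega

theorem fineBits_nonempty {T s : ℝ} (hs : 0 < s) : {b : ℕ | T + s ≤ s * 2 ^ b}.Nonempty := by
  obtain ⟨b, hb⟩ := pow_unbounded_of_one_lt ((T + s) / s) (one_lt_two)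
  refine ⟨b, ?_⟩
  rw [div_lt_iff₀ hs] at hb
  change T + s ≤ s * 2 ^ b
  linarith

theorem fineBits_spec {T s : ℝ} (hs : 0 < s) : T + s ≤ s * 2 ^ fineBits T s :=
  Nat.sInf_mem (fineBits_nonempty hs)

theorem of_lt_fineBits {T s : ℝ} {i : ℕ} (h : i < fineBits T s) : s * 2 ^ i < T + s := by
  have := Nat.notMem_of_lt_sInf h
  simpa using this

variable {l k : ℕ} {ε : ℝ}

theorem Admissible.rootDim_pos (h : Admissible l k ε) : 1 ≤ rootDim l k ε := by
  by_contra hc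
  have h0 : rootDim l k ε = 0 := by omega
  have := rootDim_spec l k ε
  rw [h0] at this
  have h1 := h.hk
  have h2 : (0 : ℝ) < l := by exact_mod_cast (by have := h.hl; omega)
  rcases this with h3 | h3
  · omega
  · simp at h3; linarith

theorem Admissible.dim_pos (h : Admissible l k ε) : 1 ≤ dim l k ε := by
  have h1 := h.hk
  have h2 := Nat.mul_le_mul h.rootDim_pos h.rootDim_pos
  unfold dim; split_ifs <;> omega

theorem rootMin_pos {D : ℕ} (hl : 1 ≤ l) (hD : 1 ≤ D) : 1 ≤ rootMin l D := by
  by_contra hc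
  have h0 : rootMin l D = 0 := by omega
  have := rootMin_spec l D
  rw [h0] at this
  omega

theorem Admissible.rootMin_pos (h : Admissible l k ε) : 1 ≤ rootMin l (dim l k ε) :=
  DistanceSketch.rootMin_pos (by have := h.hl; omega) h.dim_pos

/-- By minimality the predecessor of the root has a square below k, and passing to the successor at
most doubles a positive integer. Replacing roots by integers thus costs only constant factors. -/
theorem Admissible.rootDim_sq_le (h : Admissible l k ε) :
    rootDim l k ε * rootDim l k ε ≤ 4 * k := by
  have h1 := h.rootDim_pos
  have h2 := (of_lt_rootDim (l := l) (k := k) (ε := ε) (i := rootDim l k ε - 1) (by omega)).1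
  obtain ⟨m, hm⟩ : ∃ m, rootDim l k ε = m + 1 := ⟨rootDim l k ε - 1, by omega⟩
  rw [hm, Nat.add_sub_cancel] at h2
  rw [hm]
  have h3 := h.hk
  nlinarith [sq_nonneg ((m : ℤ) - 1)]

theorem Admissible.coarse_pos (h : Admissible l k ε) : 0 < coarse l k ε := by
  have : (0 : ℝ) < rootDim l k ε := by exact_mod_cast h.rootDim_pos
  unfold coarse; positivity

theorem Admissible.fine_pos (h : Admissible l k ε) : 0 < fine l k ε := by
  have : (0 : ℝ) < rootMin l (dim l k ε) := by exact_mod_cast h.rootMin_pos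
  have := h.hε
  unfold fine; positivity

/-- The polynomial bounds behind all statements that no word overflows. -/
theorem Admissible.lt_of (h : Admissible l k ε) {a : ℕ} (ha : a < 2 ^ 16 * 2 ^ (4 * l)) :
    a < 2 ^ (16 * l) := by
  refine ha.trans_le ?_
  rw [← pow_add]
  exact Nat.pow_le_pow_right two_pos (by have := h.hl; omega)

theorem Admissible.four_k_le (h : Admissible l k ε) : 2 ^ 7 * k ≤ 2 ^ (4 * l) := by
  calc 2 ^ 7 * k ≤ 2 ^ l * 2 ^ (3 * l) :=
        Nat.mul_le_mul (Nat.pow_le_pow_right two_pos h.hl) h.hk'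
    _ = 2 ^ (4 * l) := by rw [← pow_add]; congr 1; omega

theorem Admissible.l_le (h : Admissible l k ε) : 2 ^ 20 * l ≤ 2 ^ (4 * l) := by
  have h1 : l ≤ 2 ^ l := Nat.lt_two_pow_self.le
  calc 2 ^ 20 * l ≤ 2 ^ (3 * l) * 2 ^ l :=
        Nat.mul_le_mul (Nat.pow_le_pow_right two_pos (by have := h.hl; omega)) h1
    _ = 2 ^ (4 * l) := by rw [← pow_add]; congr 1; omega

end Parameters

/-- The memory after `paramProg`. -/
structure HasParams (l k : ℕ) (ε : ℝ) (s : Store) : Prop where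
  ambient : s.word 0 1 = k
  lam : s.word 10 0 = l
  root : s.word 11 0 = rootDim l k ε
  dim : s.word 12 0 = dim l k ε
  coarseVal : s.real 10 0 = coarse l k ε
  fineVal : s.real 11 0 = fine l k ε

theorem HasParams.of_frame {l k : ℕ} {ε : ℝ} {p : Prog} {s s' : Store} (h : HasParams l k ε s)
    (hF : Frame p s s') (hw : ∀ a ∈ [0, 10, 11, 12], a ∉ p.wordTargets)
    (hr : ∀ a ∈ [10, 11], a ∉ p.realTargets) : HasParams l k ε s' := by
  obtain ⟨h1, h2, h3, h4, h5, h6⟩ := h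
  constructor
  · rw [hF.word 0 (hw 0 (by simp)), h1]
  · rw [hF.word 10 (hw 10 (by simp)), h2]
  · rw [hF.word 11 (hw 11 (by simp)), h3]
  · rw [hF.word 12 (hw 12 (by simp)), h4]
  · rw [hF.real 10 (hr 10 (by simp)), h5]
  · rw [hF.real 11 (hr 11 (by simp)), h6]

theorem paramProg_spec {M : Machine} {l k : ℕ} {ε : ℝ} {s : Store} {X : ℕ} (h : Admissible l k ε)
    (hM : M.wordBits = 16 * l) (hX : 2 ^ M.wordBits = X) (hk : s.word 0 1 = k)
    (hW : s.word 0 2 = 16 * l) (hε : s.real 0 0 = ε) :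
    Wp M paramProg s fun s' t => HasParams l k ε s' ∧ t ≤ 4 * rootDim l k ε + 12 := by
  have hb : ∀ {a : ℕ}, a < 2 ^ 16 * 2 ^ (4 * l) → a < X := fun ha => by
    rw [← hX, hM]; exact h.lt_of ha
  have h4k := h.four_k_le
  have hlp := h.l_le
  have he4 := h.rootDim_sq_le
  have h1k := h.hk
  have hlk := h.hl
  have hD := dim_le_sq l k ε
  have hlit : ∀ c, c < 2 ^ 25 → c < X := fun c hc => hb (by omega)
  have hkX : k < X := hb (by omega)
  have hlX : l < X := hb (by omega)
  have h16lX : 16 * l < X := hb (by omega)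
  have h24lX : 16777216 * l < X := hb (by omega)
  have hbase : ∀ i, i ≤ rootDim l k ε → i * i < X ∧ i < X ∧ i + 1 < X := fun i hi => by
    have h2 : i * i ≤ rootDim l k ε * rootDim l k ε := Nat.mul_le_mul hi hi
    have h3 : i ≤ i * i := Nat.le_mul_self i
    exact ⟨hb (by omega), hb (by omega), hb (by omega)⟩
  have hr := rootMin_le (l := l) (dim_le_sq l k ε)
  have hDX : dim l k ε < X := hb (by omega)
  have hrl := rootMin_le' l (dim l k ε)
  have h13r : 8192 * rootMin l (dim l k ε) < X := hb (by omega)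
  unfold paramProg
  refine .seqW (v := l) (by simp [WExp.eval, hX, hlit, Nat.mod_eq_of_lt, hW, h16lX]) fun s₁ h₁ F₁ => ?_
  refine .seqW (v := 0) (by simp [WExp.eval]) fun s₂ h₂ F₂ => ?_
  refine .seq' (P := fun s' t => s'.word 11 0 = rootDim l k ε ∧ t ≤ rootDim l k ε * 2 + 1) ?_ ?_
  · refine Wp.find _ (rootDim_nonempty l k ε) 1 (fun i s' => s'.word 11 0 = i) h₂ ?_ ?_ ?_
    · intro i hi s' hI hF
      obtain ⟨b1, b2, -⟩ := hbase i hi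
      simp (decide := true) [BExp.Holds, RExp.eval, WExp.eval, hX, hlit, Nat.mod_eq_of_lt, hI,
        hF.word, F₂.word, F₁.word, hF.real, F₂.real, F₁.real, hk, hε, h₁, b1, b2, hkX, hlX, h24lX]
      norm_num
    · intro i hi s' hI hF
      obtain ⟨-, b2, b3⟩ := hbase i hi.le
      refine .setW (v := i + 1) ?_ fun s₃ h₃ _ => ⟨h₃, le_rfl⟩
      simp [WExp.eval, hX, hlit, hI, Nat.mod_eq_of_lt, b2, b3]
    · exact fun s₃ t₃ hI _ ht => ⟨hI, ht⟩
  rintro s₃ t₃ ⟨h₃, ht₃⟩ F₃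
  obtain ⟨b1, b2, -⟩ := hbase _ le_rfl
  refine .seq' (P := fun s' t => s'.word 12 0 = dim l k ε ∧ t = 2) ?_ ?_
  · refine .ite (fun hb => .setW (v := dim l k ε) ?_ fun s' h _ => ⟨h, rfl⟩)
      (fun hb => .setW (v := dim l k ε) ?_ fun s' h _ => ⟨h, rfl⟩) <;>
      simp (decide := true) [BExp.Holds, WExp.eval, hX, hlit, Nat.mod_eq_of_lt, h₃,
        F₃.word, F₂.word, F₁.word, hk, hkX, b1, b2] at hb ⊢
    · simp [dim, hb]
    · simp [dim, hb]
  rintro s₄ t₄ ⟨h₄, rfl⟩ F₄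
  refine .seqW (v := 0) (by simp [WExp.eval]) fun s₅ h₅ F₅ => ?_
  have hne : {r : ℕ | dim l k ε ≤ r * r ∨ l ≤ r * r}.Nonempty :=
    ⟨l, Or.inr (Nat.le_mul_self l)⟩
  refine .seq' (P := fun s' t => s'.word 13 0 = rootMin l (dim l k ε) ∧
    t ≤ rootMin l (dim l k ε) * 2 + 1) ?_ ?_
  · refine Wp.find _ hne 1 (fun i s' => s'.word 13 0 = i) h₅ ?_ ?_ ?_
    · intro i hi s' hI hF
      obtain ⟨b1, b2, -⟩ := hbase i (hi.trans hr)
      simp (decide := true) [BExp.Holds, RExp.eval, WExp.eval, hX, hlit, Nat.mod_eq_of_lt, hI,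
        hF.word, F₅.word, F₄.word, F₃.word, F₂.word, h₄, h₁, b1, b2, hDX, hlX]
    · intro i hi s' hI hF
      obtain ⟨-, b2, b3⟩ := hbase i (hi.le.trans hr)
      refine .setW (v := i + 1) ?_ fun s₃ h₃ _ => ⟨h₃, le_rfl⟩
      simp [WExp.eval, hX, hlit, hI, Nat.mod_eq_of_lt, b2, b3]
    · exact fun s₃ t₃ hI _ ht => ⟨hI, ht⟩
  rintro s₆ t₆ ⟨h₆, ht₆⟩ F₆
  refine .seqR (v := coarse l k ε) ?_ fun s₇ h₇ F₇ => ?_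
  · simp (decide := true) [RExp.eval, WExp.eval, hX, hlit, Nat.mod_eq_of_lt, F₆.word, F₅.word, F₄.word,
      h₃, b2, coarse]
  refine .setR (v := fine l k ε) ?_ fun s₈ h₈ F₈ => ?_
  · have : rootMin l (dim l k ε) < X := hb (by omega)
    simp (decide := true) [RExp.eval, WExp.eval, hX, hlit, Nat.mod_eq_of_lt, F₇.word, h₆, F₇.real,
      F₆.real, F₅.real, F₄.real, F₃.real, F₂.real, F₁.real, h13r, this, hε, fine]
    norm_num
  refine ⟨⟨?_, ?_, ?_, ?_, ?_, h₈⟩, by omega⟩ <;>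
    simp (decide := true) [F₈.word, F₇.word, F₆.word, F₅.word, F₄.word, F₃.word, F₂.word, F₁.word,
      F₈.real, hk, h₁, h₃, h₄, h₇]

end DistanceSketch

namespace DistanceSketch

/-- A machine whose words are large enough for the parameters; `X` bounds the words. -/
structure Env (M : Machine) (l k : ℕ) (ε : ℝ) (X : ℕ) : Prop extends Admissible l k ε where
  bits : M.wordBits = 16 * l
  card : 2 ^ M.wordBits = X

/-! ### All quantities fit into words. -/

section Bounds

variable {M : Machine} {l k : ℕ} {ε : ℝ} {X : ℕ}

theorem Env.lt (E : Env M l k ε X) {a : ℕ} (ha : a < 2 ^ 16 * 2 ^ (4 * l)) : a < X := by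
  rw [← E.card, E.bits]; exact E.toAdmissible.lt_of ha

theorem Env.lit (E : Env M l k ε X) : ∀ c, c < 2 ^ 25 → c < X := fun c hc =>
  E.lt (by have := E.l_le; have := E.hl; omega)

theorem Env.k_lt (E : Env M l k ε X) : 2 ^ 15 * (k + 1) < X :=
  E.lt (by have := E.four_k_le; have := E.l_le; have := E.hl; omega)

theorem Env.rootDim_lt (E : Env M l k ε X) : 4 * rootDim l k ε < X := by
  have := E.k_lt
  have := rootDim_le l k ε
  omega

/-- The ratio is 2^13 (r/e)/ε with r ≤ e, where r is `rootMin` and e is `rootDim`. It follows that a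
fine position fits into one word. -/
theorem Admissible.coarse_div_fine_le (h : Admissible l k ε) :
    coarse l k ε / fine l k ε ≤ 2 ^ 13 * 2 ^ l := by
  have h1 : (1 : ℝ) ≤ rootDim l k ε := by exact_mod_cast h.rootDim_pos
  have h2 : (1 : ℝ) ≤ rootMin l (dim l k ε) := by exact_mod_cast h.rootMin_pos
  have h3 : (rootMin l (dim l k ε) : ℝ) ≤ rootDim l k ε := by
    exact_mod_cast rootMin_le (dim_le_sq l k ε)
  have h4 := h.hε
  have h5 := h.hεl
  have : coarse l k ε / fine l k ε =
      2 ^ 13 * (rootMin l (dim l k ε) / rootDim l k ε) * (1 / ε) := by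
    unfold coarse fine; field_simp
  rw [this]
  have h6 : (rootMin l (dim l k ε) : ℝ) / rootDim l k ε ≤ 1 := by
    rw [div_le_one (by linarith)]; exact h3
  have h7 : 1 / ε ≤ 2 ^ l := by rw [div_le_iff₀ h4]; linarith
  have h8 : 0 < 1 / ε := by positivity
  have h9 : 0 ≤ (rootMin l (dim l k ε) : ℝ) / rootDim l k ε := by positivity
  calc 2 ^ 13 * ((rootMin l (dim l k ε) : ℝ) / rootDim l k ε) * (1 / ε)
      ≤ 2 ^ 13 * 1 * 2 ^ l := by gcongr
    _ = _ := by ring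

theorem two_pow_fineBits_le {T s : ℝ} (hT : 0 < T) (hs : 0 < s) :
    (2 : ℝ) ^ fineBits T s ≤ 2 * (T / s + 1) := by
  rcases Nat.eq_zero_or_pos (fineBits T s) with h | h
  · rw [h]
    have : 0 < T / s := by positivity
    norm_num; linarith
  · have := of_lt_fineBits (T := T) (s := s) (i := fineBits T s - 1) (by omega)
    obtain ⟨m, hm⟩ : ∃ m, fineBits T s = m + 1 := ⟨fineBits T s - 1, by omega⟩
    rw [hm] at this ⊢
    rw [Nat.add_sub_cancel] at this
    rw [pow_succ, div_add_one hs.ne']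
    have : (2 : ℝ) ^ m ≤ (T + s) / s := by rw [le_div_iff₀ hs]; linarith
    linarith

theorem Admissible.two_pow_fineBits (h : Admissible l k ε) :
    2 ^ fineBits (coarse l k ε) (fine l k ε) ≤ 2 ^ 15 * 2 ^ l := by
  have h1 := two_pow_fineBits_le h.coarse_pos h.fine_pos
  have h2 := h.coarse_div_fine_le
  have h3 : (1 : ℝ) ≤ 2 ^ l := one_le_pow₀ (by norm_num)
  have : (2 : ℝ) ^ fineBits (coarse l k ε) (fine l k ε) ≤ 2 ^ 15 * 2 ^ l := by
    norm_num at *; linarith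
  exact_mod_cast this

theorem Admissible.fineBits_le (h : Admissible l k ε) :
    fineBits (coarse l k ε) (fine l k ε) ≤ 15 + l := by
  have := h.two_pow_fineBits
  rw [← pow_add] at this
  exact (Nat.pow_le_pow_iff_right (by norm_num)).1 this

theorem Env.fineBits_lt (E : Env M l k ε X) :
    2 * 2 ^ fineBits (coarse l k ε) (fine l k ε) < X := by
  have h1 := E.two_pow_fineBits
  refine (Nat.mul_le_mul_left 2 h1).trans_lt ?_
  rw [← E.card, E.bits, ← mul_assoc, ← pow_succ', ← pow_add]
  exact Nat.pow_lt_pow_right (by norm_num) (by have := E.hl; omega)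

theorem Admissible.log2ceil_rootDim_le (h : Admissible l k ε) :
    log2ceil (rootDim l k ε) ≤ 3 * l :=
  log2ceil_le ((rootDim_le _ _ _).trans h.hk')

theorem log2ceil_le_self (e : ℕ) : log2ceil e ≤ e := log2ceil_le Nat.lt_two_pow_self.le

theorem Env.mul_log2ceil_lt (E : Env M l k ε X) {i : ℕ} (hi : i ≤ k) :
    i * log2ceil (rootDim l k ε) < X := by
  have h1 := E.log2ceil_rootDim_le
  have h2 := E.hk'
  have h3 : l < 2 ^ l := Nat.lt_two_pow_self
  refine E.lt ?_
  calc i * log2ceil (rootDim l k ε) ≤ 2 ^ (3 * l) * (3 * 2 ^ l) :=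
        Nat.mul_le_mul (hi.trans h2) (by omega)
    _ = 3 * 2 ^ (4 * l) := by
        rw [show 4 * l = 3 * l + l by omega, pow_add]; ring
    _ < 2 ^ 16 * 2 ^ (4 * l) := by
        have : 0 < 2 ^ (4 * l) := by positivity
        omega

end Bounds

/-! ### The preparatory programs. -/

section Preparation

variable {M : Machine} {l k : ℕ} {ε : ℝ} {X : ℕ} {s : Store}

theorem fineBitsProg_spec (E : Env M l k ε X) (h : HasParams l k ε s) :
    Wp M fineBitsProg s fun s' t =>
      s'.word 14 0 = fineBits (coarse l k ε) (fine l k ε) ∧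
      s'.real 12 0 = fine l k ε * 2 ^ fineBits (coarse l k ε) (fine l k ε) ∧
      t ≤ 3 * fineBits (coarse l k ε) (fine l k ε) + 3 := by
  have hX := E.card
  have hlit := E.lit
  have hbX := E.fineBits_lt
  have hb := (Nat.lt_two_pow_self (n := fineBits (coarse l k ε) (fine l k ε)))
  unfold fineBitsProg
  refine .seqW (v := 0) (by simp [WExp.eval]) fun s₁ h₁ F₁ => ?_
  refine .seqR (v := fine l k ε) ?_ fun s₂ h₂ F₂ => ?_
  · simp (decide := true) [RExp.eval, WExp.eval, F₁.real, h.fineVal]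
  refine Wp.find _ (fineBits_nonempty (T := coarse l k ε) E.fine_pos) 2
    (fun i s' => s'.word 14 0 = i ∧ s'.real 12 0 = fine l k ε * 2 ^ i) ?_ ?_ ?_ ?_
  · refine ⟨?_, by simpa using h₂⟩
    rw [F₂.word 14 (by decide), h₁]
  · rintro i hi s' ⟨h₃, h₄⟩ F
    have hc : s'.real 10 0 = coarse l k ε := by
      rw [F.real 10 (by decide), F₂.real 10 (by decide), F₁.real 10 (by decide), h.coarseVal]
    have hf : s'.real 11 0 = fine l k ε := by
      rw [F.real 11 (by decide), F₂.real 11 (by decide), F₁.real 11 (by decide), h.fineVal]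
    simp [BExp.Holds, RExp.eval, WExp.eval, h₄, hc, hf]
  · rintro i hi s' ⟨h₃, h₄⟩ F
    change i < fineBits _ _ at hi
    refine .seqR (v := fine l k ε * 2 ^ (i + 1)) ?_ fun s₃ h₅ F₃ => ?_
    · simp [RExp.eval, WExp.eval, h₄, pow_succ]; ring
    refine .setW (v := i + 1) ?_ fun s₄ h₆ F₄ => ⟨⟨h₆, ?_⟩, le_rfl⟩
    · have : i + 1 < X := by omega
      have : i < X := by omega
      simp (decide := true) [WExp.eval, hX, hlit, Nat.mod_eq_of_lt, F₃.word, h₃, *]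
    · rw [F₄.real 12 (by decide), h₅]
  · rintro s' t ⟨h₃, h₄⟩ F ht
    change t ≤ fineBits (coarse l k ε) (fine l k ε) * 3 + 1 at ht
    exact ⟨h₃, h₄, by omega⟩

theorem ditherBitsProg_spec (E : Env M l k ε X) (h : HasParams l k ε s) :
    Wp M ditherBitsProg s fun s' t =>
      s'.word 15 0 = log2ceil (rootDim l k ε) ∧
      s'.word 16 0 = 2 ^ log2ceil (rootDim l k ε) ∧
      t ≤ 3 * rootDim l k ε + 3 := by
  have hX := E.card
  have hlit := E.lit
  have hb := two_pow_log2ceil_le E.rootDim_pos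
  have hw := log2ceil_le_self (rootDim l k ε)
  have hx := E.rootDim_lt
  unfold ditherBitsProg
  refine .seqW (v := 0) (by simp [WExp.eval]) fun s₁ h₁ F₁ => ?_
  refine .seqW (v := 1) ?_ fun s₂ h₂ F₂ => ?_
  · simp (decide := true) [WExp.eval, hX, hlit, Nat.mod_eq_of_lt]
  have hne : {w : ℕ | rootDim l k ε ≤ 2 ^ w}.Nonempty := ⟨_, log2ceil_spec _⟩
  refine Wp.find _ hne 2
    (fun i s' => s'.word 15 0 = i ∧ s'.word 16 0 = 2 ^ i) ?_ ?_ ?_ ?_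
  · refine ⟨?_, by simpa using h₂⟩
    rw [F₂.word 15 (by decide), h₁]
  · rintro i hi s' ⟨h₃, h₄⟩ F
    have he : s'.word 11 0 = rootDim l k ε := by
      rw [F.word 11 (by decide), F₂.word 11 (by decide), F₁.word 11 (by decide), h.root]
    have h5 : 2 ^ i ≤ 2 ^ log2ceil (rootDim l k ε) := Nat.pow_le_pow_right two_pos hi
    have h6 : 2 ^ i < X := by omega
    have h7 : rootDim l k ε < X := by omega
    simp [BExp.Holds, RExp.eval, WExp.eval, h₄, he, Nat.mod_eq_of_lt, hX, h6, h7]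
  · rintro i hi s' ⟨h₃, h₄⟩ F
    change i < log2ceil _ at hi
    have h5 := of_lt_log2ceil hi
    refine .seqW (v := 2 ^ (i + 1)) ?_ fun s₃ h₅ F₃ => ?_
    · have h6 : 2 ^ i < X := by omega
      have h7 : 2 ^ i + 2 ^ i < X := by omega
      simp [WExp.eval, hX, hlit, Nat.mod_eq_of_lt, h₄, h6, h7]
      ring
    refine .setW (v := i + 1) ?_ fun s₄ h₆ F₄ => ⟨⟨h₆, ?_⟩, le_rfl⟩
    · have : i + 1 < X := by omega
      have : i < X := by omega
      simp (decide := true) [WExp.eval, hX, hlit, Nat.mod_eq_of_lt, F₃.word, h₃, *]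
    · rw [F₄.word 16 (by decide), h₅]
  · rintro s' t ⟨h₃, h₄⟩ F ht
    change t ≤ log2ceil (rootDim l k ε) * 3 + 1 at ht
    exact ⟨h₃, h₄, by omega⟩

theorem normProg_spec (E : Env M l k ε X) (hk : s.word 0 1 = k) :
    Wp M normProg s fun s' t =>
      s'.real 15 0 = ∑ i ∈ Finset.range k, s.real 1 i ^ 2 ∧ t ≤ 3 * k + 3 := by
  have hX := E.card
  have hlit := E.lit
  have hkX := E.k_lt
  have hkX' : k < X := by omega
  unfold normProg
  refine .seqW (v := 0) (by simp [WExp.eval]) fun s₁ h₁ F₁ => ?_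
  refine .seqR (v := 0) (by simp [RExp.eval, WExp.eval]) fun s₂ h₂ F₂ => ?_
  refine Wp.loopConst k 2 (fun i s' => s'.word 17 0 = i ∧
    s'.real 15 0 = ∑ j ∈ Finset.range i, s.real 1 j ^ 2) ?_ ?_ ?_ ?_
  · exact ⟨by rw [F₂.word 17 (by decide), h₁], by simpa using h₂⟩
  · rintro i hi s' ⟨h₃, h₄⟩ F
    have hi' : i < X := by omega
    have hi'' : i + 1 < X := by omega
    have hr : s'.real 1 = s.real 1 := by
      rw [F.real 1 (by decide), F₂.real 1 (by decide), F₁.real 1 (by decide)]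
    refine ⟨?_, ?_⟩
    · simp (decide := true) [BExp.Holds, WExp.eval, hX, Nat.mod_eq_of_lt, hlit, h₃, hi', F.word,
        F₂.word, F₁.word, hk, hkX', hi]
    refine .seqR (v := ∑ j ∈ Finset.range (i + 1), s.real 1 j ^ 2) ?_ fun s₃ h₅ F₃ => ?_
    · simp [RExp.eval, WExp.eval, h₄, hr, h₃, hX, Nat.mod_eq_of_lt, hi', Finset.sum_range_succ, sq]
    refine .setW (v := i + 1) ?_ fun s₄ h₆ F₄ => ⟨⟨h₆, ?_⟩, le_rfl⟩
    · simp (decide := true) [WExp.eval, hX, hlit, Nat.mod_eq_of_lt, F₃.word, h₃, hi', hi'']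
    · rw [F₄.real 15 (by decide), h₅]
  · rintro s' ⟨h₃, h₄⟩ F
    simp (decide := true) [BExp.Holds, WExp.eval, hX, Nat.mod_eq_of_lt, hlit, h₃, F.word,
        F₂.word, F₁.word, hk, hkX']
  · rintro s' t ⟨h₃, h₄⟩ F ht
    exact ⟨h₄, by omega⟩

theorem copyProg_spec (E : Env M l k ε X) (hk : s.word 0 1 = k) :
    Wp M copyProg s fun s' t => (∀ i, i < k → s'.real 2 i = s.real 1 i) ∧ t ≤ 3 * k + 2 := by
  have hX := E.card
  have hlit := E.lit
  have hkX := E.k_lt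
  have hkX' : k < X := by omega
  unfold copyProg
  refine .seqW (v := 0) (by simp [WExp.eval]) fun s₁ h₁ F₁ => ?_
  refine Wp.loopConst k 2 (fun i s' => s'.word 17 0 = i ∧
    ∀ j, j < i → s'.real 2 j = s.real 1 j) ?_ ?_ ?_ ?_
  · exact ⟨h₁, by simp⟩
  · rintro i hi s' ⟨h₃, h₄⟩ F
    have hi' : i < X := by omega
    have hi'' : i + 1 < X := by omega
    have hr : s'.real 1 = s.real 1 := by
      rw [F.real 1 (by decide), F₁.real 1 (by decide)]
    refine ⟨?_, ?_⟩
    · simp (decide := true) [BExp.Holds, WExp.eval, hX, Nat.mod_eq_of_lt, hlit, h₃, hi', F.word,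
        F₁.word, hk, hkX', hi]
    refine .seq (.setReal (.setW (v := i + 1) ?_ fun s₄ h₆ F₄ => ⟨⟨h₆, ?_⟩, le_rfl⟩))
    · simp (decide := true) [WExp.eval, hX, hlit, Nat.mod_eq_of_lt, h₃, hi', hi'']
    · intro j hj
      rw [F₄.real 2 (by decide)]
      simp only [WExp.eval, RExp.eval, hX, Nat.mod_eq_of_lt, Nat.zero_mod, h₃, hi', hr,
        Store.putReal_real, if_true]
      split_ifs with hji
      · rw [hji]
      · exact h₄ j (by omega)
  · rintro s' ⟨h₃, h₄⟩ F
    simp (decide := true) [BExp.Holds, WExp.eval, hX, Nat.mod_eq_of_lt, hlit, h₃, F.word,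
        F₁.word, hk, hkX']
  · rintro s' t ⟨h₃, h₄⟩ F ht
    exact ⟨h₄, by omega⟩

end Preparation

end DistanceSketch

namespace DistanceSketch

/-! ## Encoding a vector -/

/-- The number that the `w` bits of `f` from position `p` on represent. -/
def bitsVal (f : ℕ → Bool) (p w : ℕ) : ℕ := ∑ t ∈ Finset.range w, if f (p + t) then 2 ^ t else 0

theorem bitsVal_succ (f : ℕ → Bool) (p w : ℕ) :
    bitsVal f p (w + 1) = bitsVal f p w + if f (p + w) then 2 ^ w else 0 :=
  Finset.sum_range_succ _ _

theorem bitsVal_lt (f : ℕ → Bool) (p w : ℕ) : bitsVal f p w < 2 ^ w := by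
  induction w with
  | zero => simp [bitsVal]
  | succ w ih =>
    rw [bitsVal_succ, pow_succ]
    split_ifs <;> omega

/-- The code of a coordinate: its sign, its coarse position `q` in unary and its fine position `r`
in binary. -/
def codeword (b : ℕ) (c : Bool × ℕ × ℕ) : List Bool :=
  c.1 :: (List.replicate c.2.1 true ++ false :: (List.range b).map c.2.2.testBit)

theorem length_codeword (b : ℕ) (c : Bool × ℕ × ℕ) : (codeword b c).length = c.2.1 + b + 2 := by
  simp [codeword]; omega

/-- The cap `R` bounds the unary parts for all values of the random bits. It is inactive as soon as
the floors sum to at most the budget, see `floor_le_budget`. -/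
noncomputable def coarsePos (T y : ℝ) (R : ℕ) : ℕ := min ⌊|y| / T⌋₊ R

/-- What is left of the budget `R` for the coarse positions after the first `i` coordinates. -/
noncomputable def budget (T : ℝ) (y : ℕ → ℝ) (R : ℕ) : ℕ → ℕ
  | 0 => R
  | i + 1 => budget T y R i - coarsePos T (y i) (budget T y R i)

/-- The cap matters only after the coarse position has itself been cut off; otherwise `fineBits`
leaves enough room. -/
noncomputable def finePos (s : ℝ) (b : ℕ) (ρ : ℝ) : ℕ := min ⌊ρ / s⌋₊ (2 ^ b - 1)

/-- The three parts of the code of the `i`-th coordinate of `y`, with dithering `u`. -/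
noncomputable def symbol (T s : ℝ) (b : ℕ) (y u : ℕ → ℝ) (R i : ℕ) : Bool × ℕ × ℕ :=
  let q := coarsePos T (y i) (budget T y R i)
  (decide (y i < 0), q, finePos s b (|y i| - q * T + s * u i))

/-- The code of the first `D` coordinates of `y`, without padding. -/
noncomputable def encoding (T s : ℝ) (b : ℕ) (y u : ℕ → ℝ) (R D : ℕ) : List Bool :=
  (List.range D).flatMap fun i => codeword b (symbol T s b y u R i)

theorem encoding_succ (T s : ℝ) (b : ℕ) (y u : ℕ → ℝ) (R D : ℕ) :
    encoding T s b y u R (D + 1) =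
      encoding T s b y u R D ++ codeword b (symbol T s b y u R D) := by
  simp [encoding, List.range_succ]

theorem coarsePos_le (T y : ℝ) (R : ℕ) : coarsePos T y R ≤ R := min_le_right _ _

theorem budget_le (T : ℝ) (y : ℕ → ℝ) (R i : ℕ) : budget T y R i ≤ R := by
  induction i with
  | zero => exact le_rfl
  | succ i ih => exact (Nat.sub_le _ _).trans ih

theorem finePos_lt (s : ℝ) (b : ℕ) (ρ : ℝ) : finePos s b ρ < 2 ^ b := by
  have := Nat.one_le_two_pow (n := b)
  have := min_le_right ⌊ρ / s⌋₊ (2 ^ b - 1)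
  unfold finePos
  omega

/-- Every unary digit is paid from the budget, so the sum of length and remaining budget grows by
exactly b + 2 per coordinate. -/
theorem length_encoding (T s : ℝ) (b : ℕ) (y u : ℕ → ℝ) (R D : ℕ) :
    (encoding T s b y u R D).length + budget T y R D = D * (b + 2) + R := by
  induction D with
  | zero => simp [encoding, budget]
  | succ D ih =>
    rw [encoding_succ, List.length_append, length_codeword, budget]
    have h1 : (symbol T s b y u R D).2.1 = coarsePos T (y D) (budget T y R D) := rfl
    have h2 := coarsePos_le T (y D) (budget T y R D)
    rw [h1, Nat.succ_mul]
    omega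

section Coordinate

variable {M : Machine} {l k : ℕ} {ε : ℝ} {X : ℕ} {s : Store}

theorem coarseProg_spec (E : Env M l k ε X) {i R : ℕ} {y T : ℝ} (hi : s.word 17 0 = i) (hiX : i < X)
    (hy : s.real 2 i = y) (hT : s.real 10 0 = T) (hT0 : 0 < T) (hR : s.word 18 0 = R)
    (hRX : R < X) :
    Wp M coarseProg s fun s' t =>
      s'.real 13 0 = |y| - coarsePos T y R * T ∧ s'.word 18 0 = R - coarsePos T y R ∧
      s'.out = s.out ++ (decide (y < 0) :: (List.replicate (coarsePos T y R) true ++ [false])) ∧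
      t ≤ 4 * coarsePos T y R + 6 := by
  have hX := E.card
  have hlit := E.lit
  unfold coarseProg
  refine .seqR (v := y) ?_ fun s₁ h₁ F₁ => ?_
  · simp [RExp.eval, WExp.eval, hi, hX, Nat.mod_eq_of_lt, hiX, hy]
  refine .seq (.emit ?_)
  refine .seq' (P := fun s' t => s'.real 13 0 = |y| ∧ t = 2) ?_ ?_
  · refine .ite (fun hb => .setR (v := |y|) ?_ fun s₂ h₂ _ => ⟨h₂, rfl⟩) (fun hb => .skip ⟨?_, rfl⟩) <;>
      simp [BExp.Holds, RExp.eval, WExp.eval, h₁] at hb ⊢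
    · rw [abs_of_neg hb]
    · rw [abs_of_nonneg hb]
  rintro s₂ t₂ ⟨h₂, rfl⟩ F₂
  have hout : s₂.out = s.out ++ [decide (y < 0)] := by
    rw [F₂.out (by decide), Store.emit_out, F₁.out (by decide)]
    simp [BExp.Holds, RExp.eval, WExp.eval, h₁]
  have hR₂ : s₂.word 18 0 = R := by
    rw [F₂.word 18 (by decide), Store.emit_word, F₁.word 18 (by decide), hR]
  have hT₂ : s₂.real 10 0 = T := by
    rw [F₂.real 10 (by decide), Store.emit_real, F₁.real 10 (by decide), hT]
  -- Repeated subtraction of T replaces the rounding of a real number, which the machine cannot do.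
  have hstep : ∀ j : ℕ, j < ⌊|y| / T⌋₊ ↔ T ≤ |y| - j * T := fun j => by
    rw [← Nat.succ_le_iff, Nat.le_floor_iff (by positivity), le_div_iff₀ hT0]
    push_cast
    constructor <;> intro h <;> linarith
  refine .seq (Wp.loopConst (coarsePos T y R) 3 (fun j s' => s'.real 13 0 = |y| - j * T ∧
    s'.word 18 0 = R - j ∧
    s'.out = s.out ++ decide (y < 0) :: List.replicate j true) ?_ ?_ ?_ ?_)
  · exact ⟨by simpa using h₂, by simpa using hR₂, by simpa using hout⟩
  · rintro j hj s' ⟨h₃, h₄, h₅⟩ F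
    rw [coarsePos, lt_min_iff] at hj
    have hT' : s'.real 10 0 = T := by rw [F.real 10 (by decide), hT₂]
    have hX' : R - j < X := by omega
    refine ⟨?_, ?_⟩
    · simp [BExp.Holds, RExp.eval, WExp.eval, h₃, h₄, hT', hX, Nat.mod_eq_of_lt, hX']
      have := (hstep j).1 hj.1
      exact ⟨by linarith, hj.2⟩
    refine .seq (.emit ?_)
    refine .seqR (v := |y| - (j + 1 : ℕ) * T) ?_ fun s₃ h₆ F₃ => ?_
    · simp [RExp.eval, WExp.eval, h₃, hT']; ring
    refine .setW (v := R - (j + 1)) ?_ fun s₄ h₇ F₄ => ⟨⟨?_, h₇, ?_⟩, le_rfl⟩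
    · simp (decide := true) [WExp.eval, hX, hlit, Nat.mod_eq_of_lt, F₃.word, h₄, hX']; omega
    · rw [F₄.real 13 (by decide), h₆]
    · rw [F₄.out (by decide), F₃.out (by decide), Store.emit_out, h₅]
      simp [BExp.Holds, WExp.eval, hX, hlit, Nat.mod_eq_of_lt, List.replicate_succ']
  · rintro s' ⟨h₃, h₄, h₅⟩ F
    have hT' : s'.real 10 0 = T := by rw [F.real 10 (by decide), hT₂]
    have hX' : R - coarsePos T y R < X := by omega
    simp only [BExp.Holds, RExp.eval, WExp.eval, h₃, h₄, hT', hX, Nat.mod_eq_of_lt, hX',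
      Nat.zero_mod]
    rintro ⟨h6, h7⟩
    have h8 := (hstep (coarsePos T y R)).2 (not_lt.1 h6)
    unfold coarsePos at h7 h8
    omega
  · rintro s' t ⟨h₃, h₄, h₅⟩ F ht
    refine .emit ⟨h₃, h₄, ?_, by omega⟩
    rw [Store.emit_out, h₅]
    simp [BExp.Holds, WExp.eval]

theorem fineProg_spec (E : Env M l k ε X) {i w b : ℕ} {ρ c : ℝ} (hi : s.word 17 0 = i) (hiX : i < X)
    (hw : s.word 15 0 = w) (hwX : w < X) (hiw : i * w < X) (hP : s.word 16 0 = 2 ^ w)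
    (hPX : 2 ^ w < X) (hb : s.word 14 0 = b) (hbX : 2 * 2 ^ b < X)
    (hρ : s.real 13 0 = ρ) (hρ0 : 0 ≤ ρ) (hc : s.real 11 0 = c) (hc0 : 0 < c)
    (hh : s.real 12 0 = c * 2 ^ b) :
    Wp M fineProg s fun s' t =>
      s'.word 19 0 = finePos c b (ρ + c * (bitsVal (M.stream true) (i * w) w / 2 ^ w)) ∧
      t ≤ 7 * b + 5 := by
  have hX := E.card
  have hlit := E.lit
  have hbX' : b < X := by have := Nat.lt_two_pow_self (n := b); omega
  have hUX : bitsVal (M.stream true) (i * w) w < X := (bitsVal_lt _ _ _).trans hPX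
  unfold fineProg
  generalize hσ : ρ + c * (bitsVal (M.stream true) (i * w) w / 2 ^ w) = σ
  have hσ0 : 0 ≤ σ := by rw [← hσ]; positivity
  refine .seqR (v := σ) ?_ fun s₁ h₁ F₁ => ?_
  · simp only [bitsVal] at hUX hσ
    simp [RExp.eval, WExp.eval, hi, hX, Nat.mod_eq_of_lt, hiX, hw, hwX, hiw, hP, hPX, hρ, hc, hUX,
      ← hσ]
  refine .seqR (v := c * 2 ^ b) ?_ fun s₂ h₂ F₂ => ?_
  · simp (decide := true) [RExp.eval, WExp.eval, F₁.real, hh]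
  refine .seqW (v := 0) (by simp [WExp.eval]) fun s₃ h₃ F₃ => ?_
  refine .seqW (v := 0) (by simp [WExp.eval]) fun s₄ h₄ F₄ => ?_
  -- After j rounds r holds the j leading binary digits, and the remainder lies below the current
  -- spacing. The second alternative is overflow: all digits are ones, in agreement with the cap in
  -- `finePos`.
  refine Wp.loopConst b 6 (fun j s' => s'.word 20 0 = j ∧ s'.real 14 0 = c * 2 ^ (b - j) ∧
    ∃ r : ℕ, s'.word 19 0 = r ∧ s'.real 13 0 = σ - r * (c * 2 ^ (b - j)) ∧ r < 2 ^ j ∧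
      0 ≤ σ - r * (c * 2 ^ (b - j)) ∧
      (σ - r * (c * 2 ^ (b - j)) < c * 2 ^ (b - j) ∨ c * 2 ^ b ≤ σ ∧ r = 2 ^ j - 1)) ?_ ?_ ?_ ?_
  · refine ⟨h₄, ?_, 0, ?_, ?_, by simp, by simpa using hσ0, ?_⟩
    · rw [F₄.real 14 (by decide), F₃.real 14 (by decide), h₂, Nat.sub_zero]
    · rw [F₄.word 19 (by decide), h₃]
    · rw [F₄.real 13 (by decide), F₃.real 13 (by decide), F₂.real 13 (by decide), h₁]; simp
    · rcases lt_or_ge σ (c * 2 ^ b) with h | h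
      · left; simpa using h
      · right; simpa using h
  · rintro j hj s' ⟨h₅, h₆, r, h₇, h₈, h₉, h₁₀, h₁₁⟩ F
    have hjX : j < X := by omega
    have hjX' : j + 1 < X := by omega
    have hpj : 2 ^ (j + 1) ≤ 2 ^ b := Nat.pow_le_pow_right two_pos hj
    rw [pow_succ] at hpj
    have hrX : r < X := by omega
    have hrX' : r + r < X := by omega
    have hrX'' : r + r + 1 < X := by omega
    set h := c * 2 ^ (b - (j + 1)) with hhdef
    have hh' : c * 2 ^ (b - j) = h + h := by
      rw [hhdef, show b - j = b - (j + 1) + 1 by omega, pow_succ]; ring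
    rw [hh'] at h₆ h₈ h₁₀ h₁₁
    have hhpos : 0 < h := by positivity
    refine ⟨?_, ?_⟩
    · simp (decide := true) [BExp.Holds, WExp.eval, hX, Nat.mod_eq_of_lt, h₅, hjX, F.word, F₄.word,
        F₃.word, F₂.word, F₁.word, hb, hbX', hj]
    refine .seqR (v := h) ?_ fun s₅ g₅ G₅ => ?_
    · simp [RExp.eval, WExp.eval, hX, Nat.mod_eq_of_lt, hlit, h₆]
    refine .seqW (v := r + r) ?_ fun s₆ g₆ G₆ => ?_
    · simp (decide := true) [WExp.eval, hX, Nat.mod_eq_of_lt, hlit, G₅.word, h₇, hrX, hrX']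
    have g13 : s₆.real 13 0 = σ - r * (h + h) := by
      rw [G₆.real 13 (by decide), G₅.real 13 (by decide), h₈]
    have g14 : s₆.real 14 0 = h := by rw [G₆.real 14 (by decide), g₅]
    have hpj' := Nat.one_le_two_pow (n := j)
    refine .seq' (P := fun s' t => t ≤ 3 ∧ ∃ r' : ℕ, s'.word 19 0 = r' ∧
      s'.real 13 0 = σ - r' * h ∧ r' < 2 ^ (j + 1) ∧ 0 ≤ σ - r' * h ∧
      (σ - r' * h < h ∨ c * 2 ^ b ≤ σ ∧ r' = 2 ^ (j + 1) - 1)) ?_ ?_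
    · refine .ite (fun hlt => .skip ⟨by norm_num, r + r, g₆, ?_⟩)
        (fun hge => .seqR (v := σ - (r + r + 1 : ℕ) * h) ?_ fun s₇ g₇ G₇ =>
          .setW (v := r + r + 1) ?_ fun s₈ g₈ G₈ => ⟨by norm_num, r + r + 1, g₈, ?_⟩)
      · simp only [BExp.Holds, RExp.eval, WExp.eval, g13, g14, Nat.zero_mod] at hlt
        have e : σ - ((r + r : ℕ) : ℝ) * h = σ - r * (h + h) := by push_cast; ring
        rw [e]
        exact ⟨g13, by rw [pow_succ]; omega, h₁₀, Or.inl hlt⟩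
      · simp [RExp.eval, WExp.eval, g13, g14]; ring
      · simp (decide := true) [WExp.eval, hX, Nat.mod_eq_of_lt, hlit, G₇.word, g₆, hrX', hrX'']
      · simp only [BExp.Holds, RExp.eval, WExp.eval, g13, g14, Nat.zero_mod, not_lt] at hge
        have e : σ - ((r + r + 1 : ℕ) : ℝ) * h = σ - r * (h + h) - h := by push_cast; ring
        refine ⟨?_, by rw [pow_succ]; omega, ?_, ?_⟩
        · rw [G₈.real 13 (by decide), g₇]
        · rw [e]; linarith
        · rcases h₁₁ with h | h
          · left; rw [e]; linarith
          · right
            refine ⟨h.1, ?_⟩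
            rw [pow_succ, h.2]; omega
    rintro s₇ t₇ ⟨ht₇, r', g₇, g₈, g₉, g₁₀, g₁₁⟩ G₇
    refine .setW (v := j + 1) ?_ fun s₈ k₈ K₈ => ⟨⟨k₈, ?_, r', ?_, ?_, g₉, g₁₀, ?_⟩, by omega⟩
    · simp (decide := true) [WExp.eval, hX, Nat.mod_eq_of_lt, hlit, G₇.word, G₆.word, G₅.word, h₅,
        hjX, hjX']
    · rw [K₈.real 14 (by decide), G₇.real 14 (by decide), g14]
    · rw [K₈.word 19 (by decide), g₇]
    · rw [K₈.real 13 (by decide), g₈]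
    · rcases g₁₁ with h | h
      · left; exact h
      · right
        exact h
  · rintro s' ⟨h₅, -⟩ F
    simp (decide := true) [BExp.Holds, WExp.eval, hX, Nat.mod_eq_of_lt, h₅, F.word, F₄.word,
        F₃.word, F₂.word, F₁.word, hb, hbX']
  · rintro s' t ⟨h₅, h₆, r, h₇, h₈, h₉, h₁₀, h₁₁⟩ F ht
    refine ⟨?_, by omega⟩
    rw [h₇, finePos]
    rw [Nat.sub_self, pow_zero, mul_one] at h₁₀ h₁₁
    have hle : r ≤ ⌊σ / c⌋₊ := by
      rw [Nat.le_floor_iff (by positivity), le_div_iff₀ hc0]; linarith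
    rcases h₁₁ with h | h
    · have : ⌊σ / c⌋₊ = r := by
        refine le_antisymm (Nat.lt_succ_iff.1 ?_) hle
        rw [Nat.floor_lt (by positivity), div_lt_iff₀ hc0]
        push_cast; linarith
      rw [this]; omega
    · rw [h.2] at hle ⊢
      omega

theorem emitFineProg_spec (E : Env M l k ε X) {b r : ℕ} (hb : s.word 14 0 = b)
    (hbX : 2 * 2 ^ b < X) (hr : s.word 19 0 = r) (hrb : r < 2 ^ b) :
    Wp M emitFineProg s fun s' t => s'.out = s.out ++ (List.range b).map r.testBit ∧
      t ≤ 4 * b + 2 := by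
  have hX := E.card
  have hlit := E.lit
  have hbX' : b < X := by have := Nat.lt_two_pow_self (n := b); omega
  unfold emitFineProg
  refine .seqW (v := 0) (by simp [WExp.eval]) fun s₁ h₁ F₁ => ?_
  refine Wp.loopConst b 3 (fun j s' => s'.word 20 0 = j ∧ s'.word 19 0 = r / 2 ^ j ∧
    s'.out = s.out ++ (List.range j).map r.testBit) ?_ ?_ ?_ ?_
  · refine ⟨h₁, ?_, ?_⟩
    · rw [F₁.word 19 (by decide), hr]; simp
    · rw [F₁.out (by decide)]; simp
  · rintro j hj s' ⟨h₂, h₃, h₄⟩ F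
    have hjX : j < X := by omega
    have hjX' : j + 1 < X := by omega
    have hrX : r / 2 ^ j < X := (Nat.div_le_self _ _).trans_lt (by omega)
    refine ⟨?_, ?_⟩
    · simp (decide := true) [BExp.Holds, WExp.eval, hX, Nat.mod_eq_of_lt, h₂, hjX, F.word, F₁.word,
        hb, hbX', hj]
    refine .seq (.emit ?_)
    refine .seqW (v := r / 2 ^ (j + 1)) ?_ fun s₂ g₂ G₂ => ?_
    · simp [WExp.eval, hX, Nat.mod_eq_of_lt, hlit, h₃, hrX, Nat.div_div_eq_div_mul, pow_succ]
    refine .setW (v := j + 1) ?_ fun s₃ g₃ G₃ => ⟨⟨g₃, ?_, ?_⟩, by omega⟩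
    · simp (decide := true) [WExp.eval, hX, Nat.mod_eq_of_lt, hlit, G₂.word, h₂, hjX, hjX']
    · rw [G₃.word 19 (by decide), g₂]
    · rw [G₃.out (by decide), G₂.out (by decide), Store.emit_out, h₄, List.range_succ]
      simp only [BExp.Holds, WExp.eval, hX, Nat.mod_eq_of_lt, hlit, h₃, hrX, List.map_append,
        List.map_cons, List.map_nil, List.append_assoc, Nat.zero_mod]
      congr 3
      rw [Nat.testBit_eq_decide_div_mod_eq]
      have h2 : (2 : ℕ) % X = 2 := Nat.mod_eq_of_lt (hlit 2 (by norm_num))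
      rw [h2]
      have := Nat.mod_two_eq_zero_or_one (r / 2 ^ j)
      rcases this with h | h <;> simp [h]
  · rintro s' ⟨h₂, -⟩ F
    simp (decide := true) [BExp.Holds, WExp.eval, hX, Nat.mod_eq_of_lt, h₂, F.word, F₁.word,
        hb, hbX']
  · rintro s' t ⟨h₂, h₃, h₄⟩ F ht
    exact ⟨h₄, by omega⟩

end Coordinate

/-- The memory before the encoding starts. -/
structure HasPrep (l k : ℕ) (ε : ℝ) (s : Store) : Prop extends HasParams l k ε s where
  bits : s.word 14 0 = fineBits (coarse l k ε) (fine l k ε)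
  top : s.real 12 0 = fine l k ε * 2 ^ fineBits (coarse l k ε) (fine l k ε)
  width : s.word 15 0 = log2ceil (rootDim l k ε)
  card : s.word 16 0 = 2 ^ log2ceil (rootDim l k ε)

theorem HasPrep.of_frame {l k : ℕ} {ε : ℝ} {p : Prog} {s s' : Store} (h : HasPrep l k ε s)
    (hF : Frame p s s') (hw : ∀ a ∈ [0, 10, 11, 12, 14, 15, 16], a ∉ p.wordTargets)
    (hr : ∀ a ∈ [10, 11, 12], a ∉ p.realTargets) : HasPrep l k ε s' where
  toHasParams := h.toHasParams.of_frame hF (fun a ha => hw a (by simp at ha ⊢; tauto))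
    (fun a ha => hr a (by simp at ha ⊢; tauto))
  bits := by rw [hF.word 14 (hw 14 (by simp)), h.bits]
  top := by rw [hF.real 12 (hr 12 (by simp)), h.top]
  width := by rw [hF.word 15 (hw 15 (by simp)), h.width]
  card := by rw [hF.word 16 (hw 16 (by simp)), h.card]

/-- The dithering of coordinate `i`. -/
noncomputable def dither (w : ℕ) (f : ℕ → Bool) (i : ℕ) : ℝ := bitsVal f (i * w) w / 2 ^ w

/-- The sketch of a point whose projection is `y`. -/
noncomputable def sketchOf (l k : ℕ) (ε : ℝ) (y : ℕ → ℝ) (f : ℕ → Bool) : List Bool :=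
  let T := coarse l k ε
  let s := fine l k ε
  let N := dim l k ε + 1
  encoding T s (fineBits T s) y (dither (log2ceil (rootDim l k ε)) f) (4 * N) N ++
    List.replicate (budget T y (4 * N) N) false

noncomputable def sketchLength (l k : ℕ) (ε : ℝ) : ℕ :=
  (dim l k ε + 1) * (fineBits (coarse l k ε) (fine l k ε) + 6)

theorem length_sketchOf (l k : ℕ) (ε : ℝ) (y : ℕ → ℝ) (f : ℕ → Bool) :
    (sketchOf l k ε y f).length = sketchLength l k ε := by
  unfold sketchOf sketchLength
  rw [List.length_append, List.length_replicate, length_encoding]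
  ring

theorem encodeProg_spec {M : Machine} {l k : ℕ} {ε : ℝ} {X : ℕ} {s : Store} (E : Env M l k ε X)
    (h : HasPrep l k ε s) (hout : s.out = []) :
    Wp M encodeProg s fun s' t => s'.out = sketchOf l k ε (s.real 2) (M.stream true) ∧
      t ≤ 40 * sketchLength l k ε := by
  have hX := E.card
  have hlit := E.lit
  have hk := E.k_lt
  have hDk := dim_le l k ε
  have hc := E.coarse_pos
  have hf := E.fine_pos
  have hbX := E.fineBits_lt
  have hwX := two_pow_log2ceil_le E.rootDim_pos
  have hrX := E.rootDim_lt
  have hww := Nat.lt_two_pow_self (n := log2ceil (rootDim l k ε))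
  have hmul := fun i (hi : i ≤ k) => E.mul_log2ceil_lt hi
  unfold encodeProg sketchOf sketchLength
  simp only
  set T := coarse l k ε
  set c := fine l k ε
  set b := fineBits T c
  set D := dim l k ε
  set w := log2ceil (rootDim l k ε)
  set u := dither w (M.stream true) with hu
  set y := s.real 2
  refine .seqW (v := 4 * (D + 1)) ?_ fun s₁ h₁ F₁ => ?_
  · have h1 : D < X := by omega
    have h2 : D + 1 < X := by omega
    have h3 : 4 * (D + 1) < X := by omega
    simp [WExp.eval, hX, Nat.mod_eq_of_lt, hlit, h.dim, h1, h2, h3, D]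
  refine .seqW (v := 0) (by simp [WExp.eval]) fun s₂ h₂ F₂ => ?_
  have H₂ : HasPrep l k ε s₂ :=
    (h.of_frame F₁ (by decide) (by decide)).of_frame F₂ (by decide) (by decide)
  have hRX : 4 * (D + 1) < X := by omega
  refine .seq' (P := fun s' t => s'.word 18 0 = budget T y (4 * (D + 1)) (D + 1) ∧
    s'.out = encoding T c b y u (4 * (D + 1)) (D + 1) ∧
    t ≤ (D + 1) * (11 * b + 20) + 4 * (4 * (D + 1) - budget T y (4 * (D + 1)) (D + 1)) + 1) ?_ ?_
  -- Amortised time: a round takes at most 11b + 20 steps and four more for each unary digit, and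
  -- the unary digits are charged to the budget.
  · refine Wp.loop (D + 1) (fun i s' t => s'.word 17 0 = i ∧
      s'.word 18 0 = budget T y (4 * (D + 1)) i ∧
      s'.out = encoding T c b y u (4 * (D + 1)) i ∧
      t ≤ i * (11 * b + 20) + 4 * (4 * (D + 1) - budget T y (4 * (D + 1)) i)) ?_ ?_ ?_ ?_
    · refine ⟨h₂, ?_, ?_, by simp⟩
      · rw [F₂.word 18 (by decide), h₁]; rfl
      · rw [F₂.out (by decide), F₁.out (by decide), hout]; rfl
    · rintro i hi s' t ⟨g₁, g₂, g₃, g₄⟩ F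
      have H' := H₂.of_frame F (by decide) (by decide)
      have hi1 : i < X := by omega
      have hi2 : i + 1 < X := by omega
      have hD1 : D < X := by omega
      have hD2 : D + 1 < X := by omega
      have hy' : s'.real 2 i = y i := by
        rw [F.real 2 (by decide), F₂.real 2 (by decide), F₁.real 2 (by decide)]
      set R := budget T y (4 * (D + 1)) i with hR
      have hRle : R ≤ 4 * (D + 1) := budget_le _ _ _ _
      set q := coarsePos T (y i) R with hq
      have hqR : q ≤ R := coarsePos_le _ _ _
      have hsucc : budget T y (4 * (D + 1)) (i + 1) = R - q := rfl
      refine ⟨?_, ?_⟩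
      · simp [BExp.Holds, WExp.eval, hX, Nat.mod_eq_of_lt, hlit, g₁, H'.dim, D, hi1, hD1, hD2, hi]
      refine .seq' (coarseProg_spec E g₁ hi1 hy' H'.coarseVal hc g₂ (by omega)) ?_
      rintro s₃ t₃ ⟨a₁, a₂, a₃, a₄⟩ F₃
      change s₃.real 13 0 = |y i| - q * T at a₁
      change s₃.word 18 0 = R - q at a₂
      change s₃.out = s'.out ++ (decide (y i < 0) :: (List.replicate q true ++ [false])) at a₃
      change t₃ ≤ 4 * q + 6 at a₄
      have H₃ := H'.of_frame F₃ (by decide) (by decide)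
      have hpos : 0 ≤ |y i| - q * T := by
        have : (q : ℝ) ≤ |y i| / T := by
          refine le_trans ?_ (Nat.floor_le (by positivity))
          exact_mod_cast min_le_left _ _
        rw [le_div_iff₀ hc] at this
        linarith
      refine .seq' (fineProg_spec E (i := i) (w := w) (b := b) (c := c)
        (by rw [F₃.word 17 (by decide), g₁]) hi1 H₃.width (by omega) ?_ H₃.card (by omega) H₃.bits
        hbX a₁ hpos H₃.fineVal hf H₃.top) ?_
      · exact hmul i (by omega)
      rintro s₄ t₄ ⟨b₁, b₂⟩ F₄
      have H₄ := H₃.of_frame F₄ (by decide) (by decide)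
      refine .seq' (emitFineProg_spec E H₄.bits hbX b₁ (finePos_lt _ _ _)) ?_
      rintro s₅ t₅ ⟨c₁, c₂⟩ F₅
      change t₅ ≤ 4 * b + 2 at c₂
      refine .setW (v := i + 1) ?_ fun s₆ d₁ F₆ => ⟨d₁, ?_, ?_, ?_⟩
      · simp (decide := true) [WExp.eval, hX, Nat.mod_eq_of_lt, hlit, F₅.word, F₄.word, F₃.word,
          g₁, hi1, hi2]
      · rw [F₆.word 18 (by decide), F₅.word 18 (by decide), F₄.word 18 (by decide), a₂, hsucc]
      · rw [F₆.out (by decide), c₁, F₄.out (by decide), a₃, g₃, encoding_succ]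
        change _ ++ List.map _ (List.range b) = _
        simp [codeword, symbol, ← hR, ← hq, hu, dither]
      · rw [hsucc, Nat.succ_mul]
        omega
    · rintro s' t ⟨g₁, g₂, g₃, g₄⟩ F
      have H' := H₂.of_frame F (by decide) (by decide)
      have hD1 : D < X := by omega
      have hD2 : D + 1 < X := by omega
      simp [BExp.Holds, WExp.eval, hX, Nat.mod_eq_of_lt, hlit, g₁, H'.dim, D, hD1, hD2]
    · rintro s' t ⟨g₁, g₂, g₃, g₄⟩ F
      exact ⟨g₂, g₃, by omega⟩
  rintro s₃ t₃ ⟨a₁, a₂, a₃⟩ F₃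
  set B := budget T y (4 * (D + 1)) (D + 1) with hB
  have hBle : B ≤ 4 * (D + 1) := budget_le _ _ _ _
  refine Wp.loopConst B 2 (fun i s' => s'.word 18 0 = B - i ∧
    s'.out = encoding T c b y u (4 * (D + 1)) (D + 1) ++ List.replicate i false) ?_ ?_ ?_ ?_
  · exact ⟨by simpa using a₁, by simpa using a₂⟩
  · rintro i hi s' ⟨g₁, g₂⟩ F
    have hB1 : B - i < X := by omega
    refine ⟨?_, ?_⟩
    · simp [BExp.Holds, WExp.eval, hX, Nat.mod_eq_of_lt, g₁, hB1, hi]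
    refine .seq (.emit (.setW (v := B - (i + 1)) ?_ fun s₄ d₁ F₄ => ⟨⟨d₁, ?_⟩, le_rfl⟩))
    · simp [WExp.eval, hX, Nat.mod_eq_of_lt, hlit, g₁, hB1]; omega
    · rw [F₄.out (by decide), Store.emit_out, g₂]
      simp [BExp.Holds, WExp.eval, List.replicate_succ']
  · rintro s' ⟨g₁, g₂⟩ F
    simp [BExp.Holds, WExp.eval, hX, g₁]
  · rintro s' t ⟨g₁, g₂⟩ F ht
    refine ⟨g₂, ?_⟩
    have e1 : (D + 1) * (11 * b + 20) = 11 * ((D + 1) * b) + 20 * (D + 1) := by ring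
    have e2 : (D + 1) * (b + 6) = (D + 1) * b + 6 * (D + 1) := by ring
    rw [e2]
    rw [e1] at a₃
    omega

end DistanceSketch

namespace DistanceSketch

/-! ## The projection -/

/-- A random sign. -/
def sgn (b : Bool) : ℝ := if b then 1 else -1

/-- One round of the Walsh-Hadamard transform on vectors of length `2 * m`. -/
def butterfly (m : ℕ) (a : ℕ → ℝ) (i : ℕ) : ℝ :=
  if i < m then a (2 * i) + a (2 * i + 1) else a (2 * (i - m)) - a (2 * (i - m) + 1)

theorem butterfly_congr {m : ℕ} {a a' : ℕ → ℝ} (h : ∀ i, i < 2 * m → a i = a' i) {i : ℕ}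
    (hi : i < 2 * m) : butterfly m a i = butterfly m a' i := by
  unfold butterfly
  split_ifs with h1
  · rw [h _ (by omega), h _ (by omega)]
  · rw [h _ (by omega), h _ (by omega)]

/-- The Walsh-Hadamard transform (with a permutation of the rows) on vectors of length `2 ^ p`. -/
def hadamard (p : ℕ) (a : ℕ → ℝ) : ℕ → ℝ := (butterfly (2 ^ p / 2))^[p] a

/-- The Walsh-Hadamard transform of a vector with random signs. -/
def mixed (p : ℕ) (f : ℕ → Bool) (x : ℕ → ℝ) : ℕ → ℝ := hadamard p fun i => sgn (f i) * x i

/-- The random index number `i`. -/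
def sampleIndex (p : ℕ) (f : ℕ → Bool) (i : ℕ) : ℕ := bitsVal f (2 ^ p + i * p) p

/-- The random sign number `i`, when there are `N` random indices. -/
def sampleSign (p N : ℕ) (f : ℕ → Bool) (i : ℕ) : ℝ := sgn (f (2 ^ p + N * p + i))

/-- The projection from dimension `2 ^ p` to dimension `D = e ^ 2`, where every coordinate is made of
`τ ^ 2` samples. -/
noncomputable def projection (p D τ e : ℕ) (f : ℕ → Bool) (x : ℕ → ℝ) (j : ℕ) : ℝ :=
  (∑ i ∈ Finset.range (τ * τ), sampleSign p (D * (τ * τ)) f (j * (τ * τ) + i) *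
    mixed p f x (sampleIndex p f (j * (τ * τ) + i))) / (τ * e : ℕ)

section

variable {M : Machine} {l k : ℕ} {ε : ℝ} {X : ℕ} {s : Store}

theorem two_pow_log2ceil_lt (E : Env M l k ε X) : 2 ^ 14 * 2 ^ log2ceil k < X := by
  have := two_pow_log2ceil_le E.hk
  have := E.k_lt
  omega

theorem padProg_spec (E : Env M l k ε X) (hk : s.word 0 1 = k) :
    Wp M padProg s fun s' t => s'.word 22 0 = log2ceil k ∧ s'.word 21 0 = 2 ^ log2ceil k ∧
      t ≤ 3 * log2ceil k + 3 := by
  have hX := E.card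
  have hlit := E.lit
  have hkX := E.k_lt
  have hb := two_pow_log2ceil_lt E
  have hw := Nat.lt_two_pow_self (n := log2ceil k)
  unfold padProg
  refine .seqW (v := 1) ?_ fun s₁ h₁ F₁ => ?_
  · simp [WExp.eval, hX, hlit, Nat.mod_eq_of_lt]
  refine .seqW (v := 0) (by simp [WExp.eval]) fun s₂ h₂ F₂ => ?_
  have hne : {w : ℕ | k ≤ 2 ^ w}.Nonempty := ⟨_, log2ceil_spec _⟩
  refine Wp.find _ hne 2
    (fun i s' => s'.word 22 0 = i ∧ s'.word 21 0 = 2 ^ i) ?_ ?_ ?_ ?_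
  · refine ⟨h₂, ?_⟩
    rw [F₂.word 21 (by decide), h₁]; simp
  · rintro i hi s' ⟨h₃, h₄⟩ F
    have h5 : 2 ^ i ≤ 2 ^ log2ceil k := Nat.pow_le_pow_right two_pos hi
    have h6 : 2 ^ i < X := by omega
    have h7 : k < X := by omega
    simp (decide := true) [BExp.Holds, WExp.eval, h₄, Nat.mod_eq_of_lt, hX, h6, h7, hlit, F.word,
      F₂.word, F₁.word, hk]
  · rintro i hi s' ⟨h₃, h₄⟩ F
    change i < log2ceil _ at hi
    have h5 := of_lt_log2ceil hi
    refine .seqW (v := 2 ^ (i + 1)) ?_ fun s₃ h₅ F₃ => ?_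
    · have h6 : 2 ^ i < X := by omega
      have h7 : 2 ^ i + 2 ^ i < X := by omega
      simp [WExp.eval, hX, hlit, Nat.mod_eq_of_lt, h₄, h6, h7]
      ring
    refine .setW (v := i + 1) ?_ fun s₄ h₆ F₄ => ⟨⟨h₆, ?_⟩, le_rfl⟩
    · have : i + 1 < X := by omega
      have : i < X := by omega
      simp (decide := true) [WExp.eval, hX, hlit, Nat.mod_eq_of_lt, F₃.word, h₃, *]
    · rw [F₄.word 21 (by decide), h₅]
  · rintro s' t ⟨h₃, h₄⟩ F ht
    change t ≤ log2ceil k * 3 + 1 at ht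
    exact ⟨h₃, h₄, by omega⟩

theorem signProg_spec (E : Env M l k ε X) {K : ℕ} (hK : s.word 21 0 = K) (hKX : K < X) :
    Wp M signProg s fun s' t =>
      (∀ i, i < K → s'.real 3 i = sgn (M.stream false i) * s.real 1 i) ∧ t ≤ 4 * K + 2 := by
  have hX := E.card
  have hlit := E.lit
  unfold signProg
  refine .seqW (v := 0) (by simp [WExp.eval]) fun s₁ h₁ F₁ => ?_
  refine Wp.loopConst K 3 (fun i s' => s'.word 17 0 = i ∧
    ∀ j, j < i → s'.real 3 j = sgn (M.stream false j) * s.real 1 j) ?_ ?_ ?_ ?_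
  · exact ⟨h₁, by simp⟩
  · rintro i hi s' ⟨h₃, h₄⟩ F
    have hi' : i < X := by omega
    have hi'' : i + 1 < X := by omega
    have hr : s'.real 1 = s.real 1 := by
      rw [F.real 1 (by decide), F₁.real 1 (by decide)]
    refine ⟨?_, ?_⟩
    · simp (decide := true) [BExp.Holds, WExp.eval, hX, Nat.mod_eq_of_lt, hlit, h₃, hi', F.word,
        F₁.word, hK, hKX, hi]
    refine .seq' (P := fun s'' t => (∀ j, j < i + 1 →
      s''.real 3 j = sgn (M.stream false j) * s.real 1 j) ∧ t = 2) ?_ ?_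
    · refine .ite (fun hb => .setReal ⟨fun j hj => ?_, rfl⟩)
        (fun hb => .setReal ⟨fun j hj => ?_, rfl⟩)
      · have hb' : M.stream false i = true := by
          by_contra hne
          simp [BExp.Holds, WExp.eval, hX, Nat.mod_eq_of_lt, hlit, h₃, hi', hne] at hb
        simp only [WExp.eval, RExp.eval, hX, Nat.mod_eq_of_lt, Nat.zero_mod, h₃, hi', hr,
          Store.putReal_real, if_true]
        split_ifs with hji
        · rw [hji, hb']; simp [sgn]
        · exact h₄ j (by omega)
      · have hb' : M.stream false i = false := by
          by_contra hne
          rw [Bool.not_eq_false] at hne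
          simp [BExp.Holds, WExp.eval, hX, Nat.mod_eq_of_lt, hlit, h₃, hi', hne] at hb
        simp only [WExp.eval, RExp.eval, hX, Nat.mod_eq_of_lt, Nat.zero_mod, h₃, hi', hr,
          Store.putReal_real, if_true]
        split_ifs with hji
        · rw [hji, hb']; simp [sgn]
        · exact h₄ j (by omega)
    rintro s₂ t₂ ⟨h₅, rfl⟩ F₂
    refine .setW (v := i + 1) ?_ fun s₄ h₆ F₄ => ⟨⟨h₆, ?_⟩, le_rfl⟩
    · simp (decide := true) [WExp.eval, hX, hlit, Nat.mod_eq_of_lt, F₂.word, h₃, hi', hi'']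
    · rw [F₄.real 3 (by decide)]; exact h₅
  · rintro s' ⟨h₃, h₄⟩ F
    simp (decide := true) [BExp.Holds, WExp.eval, hX, Nat.mod_eq_of_lt, hlit, h₃, F.word,
        F₁.word, hK, hKX]
  · rintro s' t ⟨h₃, h₄⟩ F ht
    exact ⟨h₄, by omega⟩

theorem butterflyProg_spec (E : Env M l k ε X) {m : ℕ} (hK : s.word 21 0 = 2 * m)
    (hKX : 2 * m + 2 < X) :
    Wp M butterflyProg s fun s' t =>
      (∀ i, i < 2 * m → s'.real 3 i = butterfly m (s.real 3) i) ∧ t ≤ 10 * m + 4 := by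
  have hX := E.card
  have hlit := E.lit
  have hKX' : 2 * m < X := by omega
  have hmX' : m < X := by omega
  have hdiv : 2 * m / 2 = m := by omega
  unfold butterflyProg
  refine .seqW (v := 0) (by simp [WExp.eval]) fun s₁ h₁ F₁ => ?_
  refine .seq' (P := fun s' t => (∀ j, j < 2 * m → s'.real 4 j = butterfly m (s.real 3) j) ∧
    t ≤ 4 * m + 1) ?_ ?_
  · refine Wp.loopConst m 3 (fun i s' => s'.word 17 0 = i ∧
      ∀ j, j < i → s'.real 4 j = butterfly m (s.real 3) j ∧
        s'.real 4 (m + j) = butterfly m (s.real 3) (m + j)) ?_ ?_ ?_ ?_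
    · exact ⟨h₁, by simp⟩
    · rintro i hi s' ⟨h₃, h₄⟩ F
      have hi' : i < X := by omega
      have hi'' : i + 1 < X := by omega
      have hi3 : i + i < X := by omega
      have hi4 : i + i + 1 < X := by omega
      have hi5 : m + i < X := by omega
      have hr : s'.real 3 = s.real 3 := by
        rw [F.real 3 (by decide), F₁.real 3 (by decide)]
      have hw : s'.word 21 0 = 2 * m := by
        rw [F.word 21 (by decide), F₁.word 21 (by decide), hK]
      refine ⟨?_, ?_⟩
      · simp (decide := true) [BExp.Holds, WExp.eval, hX, Nat.mod_eq_of_lt, hlit, h₃, hi',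
          hw, hKX', hi, hdiv]
      refine .seq (.setReal (.seq (.setReal (.setW (v := i + 1) ?_
        fun s₄ h₆ F₄ => ⟨⟨h₆, fun j hj => ?_⟩, le_rfl⟩))))
      · simp (decide := true) [WExp.eval, hX, hlit, Nat.mod_eq_of_lt, h₃, hi', hi'']
      · rw [F₄.real 4 (by decide)]
        have h2 : (2 : ℕ) % X = 2 := Nat.mod_eq_of_lt (hlit _ (by norm_num))
        have h1 : (1 : ℕ) % X = 1 := Nat.mod_eq_of_lt (hlit _ (by norm_num))
        have e1 : m + i - m = i := by omega
        have e2 : i ≠ m + i := by omega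
        simp only [WExp.eval, RExp.eval, hX, Nat.mod_eq_of_lt, Nat.zero_mod, h₃, hi', hr,
          Store.putReal_real, Store.putReal_word, if_true, hw, hKX', h1, h2, hdiv, hi3, hi4, hi5,
          show ((3 : ℕ) = 4) = False by simp, if_false]
        rcases Nat.lt_or_ge j i with hji | hji
        · rw [if_neg (by omega), if_neg (by omega), if_neg (by omega), if_neg (by omega)]
          exact h₄ j hji
        · obtain rfl : j = i := by omega
          rw [if_neg (by omega), if_pos rfl, if_pos rfl]
          unfold butterfly
          rw [if_pos hi, if_neg (by omega), e1, two_mul]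
          exact ⟨rfl, rfl⟩
    · rintro s' ⟨h₃, h₄⟩ F
      simp (decide := true) [BExp.Holds, WExp.eval, hX, Nat.mod_eq_of_lt, hlit, h₃, F.word,
          F₁.word, hK, hKX', hdiv, hmX']
    · rintro s' t ⟨h₃, h₄⟩ F ht
      refine ⟨fun j hj => ?_, by omega⟩
      rcases Nat.lt_or_ge j m with h | h
      · exact (h₄ j h).1
      · have := (h₄ (j - m) (by omega)).2
        rwa [Nat.add_sub_cancel' h] at this
  rintro s₂ t₂ ⟨h₂, ht₂⟩ F₂
  refine .seqW (v := 0) (by simp [WExp.eval]) fun s₃ h₃ F₃ => ?_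
  refine Wp.loopConst (2 * m) 2 (fun i s' => s'.word 17 0 = i ∧
    ∀ j, j < i → s'.real 3 j = butterfly m (s.real 3) j) ?_ ?_ ?_ ?_
  · exact ⟨h₃, by simp⟩
  · rintro i hi s' ⟨g₃, g₄⟩ F
    have hi' : i < X := by omega
    have hi'' : i + 1 < X := by omega
    have hr : s'.real 4 i = butterfly m (s.real 3) i := by
      rw [F.real 4 (by decide), F₃.real 4 (by decide), h₂ i hi]
    refine ⟨?_, ?_⟩
    · simp (decide := true) [BExp.Holds, WExp.eval, hX, Nat.mod_eq_of_lt, hlit, g₃, hi', F.word,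
        F₃.word, F₂.word, F₁.word, hK, hKX', hi]
    refine .seq (.setReal (.setW (v := i + 1) ?_ fun s₄ h₆ F₄ => ⟨⟨h₆, fun j hj => ?_⟩, le_rfl⟩))
    · simp (decide := true) [WExp.eval, hX, hlit, Nat.mod_eq_of_lt, g₃, hi', hi'']
    · rw [F₄.real 3 (by decide)]
      simp only [WExp.eval, RExp.eval, hX, Nat.mod_eq_of_lt, Nat.zero_mod, g₃, hi', hr,
        Store.putReal_real, if_true]
      split_ifs with hji
      · rw [hji]
      · exact g₄ j (by omega)
  · rintro s' ⟨g₃, g₄⟩ F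
    simp (decide := true) [BExp.Holds, WExp.eval, hX, Nat.mod_eq_of_lt, hlit, g₃, F.word,
        F₃.word, F₂.word, F₁.word, hK, hKX']
  · rintro s' t ⟨g₃, g₄⟩ F ht
    exact ⟨g₄, by omega⟩

theorem hadamardProg_spec (E : Env M l k ε X) {p : ℕ} (hK : s.word 21 0 = 2 ^ p)
    (hp : s.word 22 0 = p) (hKX : 2 ^ p + 2 < X) :
    Wp M hadamardProg s fun s' t =>
      (∀ i, i < 2 ^ p → s'.real 3 i = hadamard p (s.real 3) i) ∧ t ≤ p * (5 * 2 ^ p + 6) + 2 := by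
  have hX := E.card
  have hlit := E.lit
  have hpX : p < X := by have := Nat.lt_two_pow_self (n := p); omega
  unfold hadamardProg
  refine .seqW (v := 0) (by simp [WExp.eval]) fun s₁ h₁ F₁ => ?_
  refine Wp.loopConst p (5 * 2 ^ p + 5) (fun i s' => s'.word 20 0 = i ∧
    ∀ j, j < 2 ^ p → s'.real 3 j = (butterfly (2 ^ p / 2))^[i] (s.real 3) j) ?_ ?_ ?_ ?_
  · refine ⟨h₁, fun j _ => ?_⟩
    rw [F₁.real 3 (by decide)]; rfl
  · rintro i hi s' ⟨h₂, h₃⟩ F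
    have hi' : i < X := by omega
    have hi'' : i + 1 < X := by omega
    obtain ⟨q, rfl⟩ : ∃ q, p = q + 1 := ⟨p - 1, by omega⟩
    have hm : 2 ^ (q + 1) = 2 * 2 ^ q := by rw [pow_succ]; ring
    have hm' : 2 ^ (q + 1) / 2 = 2 ^ q := by omega
    rw [hm'] at h₃
    rw [hm] at hK hKX h₃
    rw [hm', hm]
    refine ⟨?_, ?_⟩
    · simp (decide := true) [BExp.Holds, WExp.eval, hX, Nat.mod_eq_of_lt, hlit, h₂, hi',
        F.word, F₁.word, hp, hpX, hi]
    refine .seq' (butterflyProg_spec E (m := 2 ^ q) ?_ hKX) ?_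
    · rw [F.word 21 (by decide), F₁.word 21 (by decide), hK]
    rintro s₂ t₂ ⟨h₄, ht₂⟩ F₂
    refine .setW (v := i + 1) ?_ fun s₃ h₅ F₃ => ⟨⟨h₅, fun j hj => ?_⟩, by omega⟩
    · simp (decide := true) [WExp.eval, hX, hlit, Nat.mod_eq_of_lt, F₂.word, h₂, hi', hi'']
    · rw [F₃.real 3 (by decide), h₄ j hj, Function.iterate_succ_apply']
      exact butterfly_congr h₃ hj
  · rintro s' ⟨h₂, h₃⟩ F
    simp (decide := true) [BExp.Holds, WExp.eval, hX, Nat.mod_eq_of_lt, hlit, h₂,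
        F.word, F₁.word, hp, hpX]
  · rintro s' t ⟨h₂, h₃⟩ F ht
    rw [show 5 * 2 ^ p + 5 + 1 = 5 * 2 ^ p + 6 by omega] at ht
    exact ⟨h₃, by omega⟩

/-- The shared random bits end at position 2^p + Dt(p + 1) with t = (16l)², and every factor is at
most a constant times 2^l. -/
theorem Admissible.sample_bound (h : Admissible l k ε) (hk : k ≤ 2 ^ l) {D p : ℕ} (hD : D ≤ k)
    (hp : p ≤ l) :
    2 * (2 ^ p + D * (16 * l * (16 * l)) * p + D * (16 * l * (16 * l))) <
      2 ^ 16 * 2 ^ (4 * l) := by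
  have hl := (Nat.lt_two_pow_self (n := l)).le
  have hl1 : 1 ≤ l := by have := h.hl; omega
  have h1 : 2 ^ p ≤ 2 ^ l := Nat.pow_le_pow_right two_pos hp
  have h2 : 2 ^ (4 * l) = 2 ^ l * (2 ^ l * (2 ^ l * 2 ^ l)) := by
    rw [← pow_add, ← pow_add, ← pow_add]; congr 1; omega
  have h3 : D * (16 * l * (16 * l)) * p ≤ 2 ^ l * (16 * 2 ^ l * (16 * 2 ^ l)) * 2 ^ l := by
    have : D ≤ 2 ^ l := hD.trans hk
    have : p ≤ 2 ^ l := hp.trans hl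
    gcongr
  have h4 : D * (16 * l * (16 * l)) ≤ 2 ^ l * (16 * 2 ^ l * (16 * 2 ^ l)) * 2 ^ l := by
    have h5 : D ≤ 2 ^ l := hD.trans hk
    calc D * (16 * l * (16 * l)) = D * (16 * l * (16 * l)) * 1 := by ring
      _ ≤ _ := by
        have := Nat.one_le_two_pow (n := l)
        gcongr
  have h6 : 2 ^ l * (16 * 2 ^ l * (16 * 2 ^ l)) * 2 ^ l = 2 ^ 8 * 2 ^ (4 * l) := by rw [h2]; ring
  have h7 : 2 ^ l ≤ 2 ^ (4 * l) := Nat.pow_le_pow_right two_pos (by omega)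
  have h8 : 0 < 2 ^ (4 * l) := by positivity
  omega

theorem sampleProg_spec (E : Env M l k ε X) (h : HasParams l k ε s) (hk : k ≤ 2 ^ l) {p : ℕ}
    (hpl : p ≤ l) (hK : s.word 21 0 = 2 ^ p) (hp : s.word 22 0 = p) {a : ℕ → ℝ}
    (ha : ∀ i, i < 2 ^ p → s.real 3 i = a i) :
    Wp M sampleProg s fun s' t =>
      (∀ j, j < dim l k ε → s'.real 2 j =
        (∑ i ∈ Finset.range (16 * l * (16 * l)),
          sampleSign p (dim l k ε * (16 * l * (16 * l))) (M.stream false)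
            (j * (16 * l * (16 * l)) + i) *
          a (sampleIndex p (M.stream false) (j * (16 * l * (16 * l)) + i))) /
          (16 * l * rootDim l k ε : ℕ)) ∧
      t ≤ dim l k ε * (6 * (16 * l * (16 * l)) + 6) + 4 := by
  have hX := E.card
  have hlit := E.lit
  have hbd := E.lt (E.sample_bound hk (dim_le l k ε) hpl)
  have hroot := E.rootDim_lt
  have hD0 := E.dim_pos
  have hlp := E.l_le
  have hl7 := E.hl
  have hlX : l < X := E.lt (by omega)
  have h16X : 16 * l < X := E.lt (by omega)
  have hrX : rootDim l k ε < X := by omega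
  have hkX := E.k_lt
  have hDk := dim_le l k ε
  have hteX : 16 * l * rootDim l k ε < X := by
    have h1 : rootDim l k ε ≤ 2 ^ (3 * l) := (rootDim_le l k ε).trans E.hk'
    have h2 := (Nat.lt_two_pow_self (n := l)).le
    refine E.lt ?_
    calc 16 * l * rootDim l k ε ≤ 16 * 2 ^ l * 2 ^ (3 * l) := by gcongr
      _ = 16 * 2 ^ (4 * l) := by rw [show 4 * l = l + 3 * l by omega, pow_add]; ring
      _ < 2 ^ 16 * 2 ^ (4 * l) := by
        have : 0 < 2 ^ (4 * l) := by positivity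
        omega
  have hpX : 2 ^ p < X := by omega
  have hpp := Nat.lt_two_pow_self (n := p)
  have hppX : p < X := by omega
  set D := dim l k ε with hDdef
  set t := 16 * l * (16 * l) with ht
  have hDX : D < X := by omega
  have hDtp : D * t * p < X := by omega
  have hDt : D * t < X := by omega
  have htX : t < X := by
    have : 1 * t ≤ D * t := Nat.mul_le_mul_right _ hD0
    omega
  set f := M.stream false with hf
  unfold sampleProg
  refine .seqW (v := 2 ^ p) ?_ fun s₁ h₁ F₁ => ?_
  · simp [WExp.eval, hK, hX, Nat.mod_eq_of_lt, hpX]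
  have hsum : 2 ^ p + D * t * p < X := by omega
  refine .seqW (v := 2 ^ p + D * t * p) ?_ fun s₂ h₂ F₂ => ?_
  · simp (decide := true) [WExp.eval, hK, hX, Nat.mod_eq_of_lt, hpX, F₁.word, hlit, h.lam, hlX, h16X,
      ← ht, htX, h.dim, ← hDdef, hDX, hDt, hDtp, hp, hppX, hsum]
  refine .seqW (v := 0) (by simp [WExp.eval]) fun s₃ h₃ F₃ => ?_
  have H₃ : HasParams l k ε s₃ := ((h.of_frame F₁ (by decide) (by decide)).of_frame F₂ (by decide)
    (by decide)).of_frame F₃ (by decide) (by decide)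
  -- Variables 23 and 24 are two reading positions: the random indices take p bits each from
  -- position 2^p on, and the signs lie behind all D·t indices.
  refine Wp.loopConst D (6 * t + 5) (fun j s' => s'.word 17 0 = j ∧
    s'.word 23 0 = 2 ^ p + j * t * p ∧ s'.word 24 0 = 2 ^ p + D * t * p + j * t ∧
    ∀ j', j' < j → s'.real 2 j' = (∑ i ∈ Finset.range t,
          sampleSign p (D * t) f (j' * t + i) * a (sampleIndex p f (j' * t + i))) /
          (16 * l * rootDim l k ε : ℕ)) ?_ ?_ ?_ ?_
  · refine ⟨h₃, ?_, ?_, by simp⟩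
    · rw [F₃.word 23 (by decide), F₂.word 23 (by decide), h₁]; ring
    · rw [F₃.word 24 (by decide), h₂]; ring
  · rintro j hj s' ⟨g₁, g₂, g₃, g₄⟩ F
    have H' := H₃.of_frame F (by decide) (by decide)
    have hjX : j < X := by omega
    have hjX' : j + 1 < X := by omega
    have hp' : s'.word 22 0 = p := by
      rw [F.word 22 (by decide), F₃.word 22 (by decide), F₂.word 22 (by decide),
        F₁.word 22 (by decide), hp]
    have ha' : ∀ i, i < 2 ^ p → s'.real 3 i = a i := by
      rw [F.real 3 (by decide), F₃.real 3 (by decide), F₂.real 3 (by decide),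
        F₁.real 3 (by decide)]; exact ha
    have hjD : (j + 1) * t ≤ D * t := Nat.mul_le_mul_right _ hj
    rw [Nat.succ_mul] at hjD
    refine ⟨?_, ?_⟩
    · simp [BExp.Holds, WExp.eval, hX, Nat.mod_eq_of_lt, hlit, g₁, hjX, H'.dim, ← hDdef, hDX, hj]
    refine .seqR (v := 0) (by simp [RExp.eval, WExp.eval]) fun s₄ h₄ F₄ => ?_
    refine .seqW (v := 0) (by simp [WExp.eval]) fun s₅ h₅ F₅ => ?_
    have H₅ := (H'.of_frame F₄ (by decide) (by decide)).of_frame F₅ (by decide) (by decide)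
    refine .seq' (P := fun s' t' => s'.word 23 0 = 2 ^ p + (j * t + t) * p ∧
      s'.word 24 0 = 2 ^ p + D * t * p + (j * t + t) ∧
      s'.real 16 0 = ∑ i ∈ Finset.range t,
          sampleSign p (D * t) f (j * t + i) * a (sampleIndex p f (j * t + i)) ∧
      t' ≤ 6 * t + 1) ?_ ?_
    · refine Wp.loopConst t 5 (fun i s' => s'.word 20 0 = i ∧
        s'.word 23 0 = 2 ^ p + (j * t + i) * p ∧ s'.word 24 0 = 2 ^ p + D * t * p + (j * t + i) ∧
        s'.real 16 0 = ∑ i ∈ Finset.range i,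
          sampleSign p (D * t) f (j * t + i) * a (sampleIndex p f (j * t + i))) ?_ ?_ ?_ ?_
      · refine ⟨h₅, ?_, ?_, ?_⟩
        · rw [F₅.word 23 (by decide), F₄.word 23 (by decide), g₂]; rfl
        · rw [F₅.word 24 (by decide), F₄.word 24 (by decide), g₃]; rfl
        · rw [F₅.real 16 (by decide), h₄]; rfl
      · rintro i hi s'' ⟨k₁, k₂, k₃, k₄⟩ G
        have H'' := H₅.of_frame G (by decide) (by decide)
        have hiX : i < X := by omega
        have hiX' : i + 1 < X := by omega
        have hle : (j * t + i + 1) * p ≤ D * t * p := Nat.mul_le_mul_right _ (by omega)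
        have hle' : (j * t + i + 1) * p = (j * t + i) * p + p := by ring
        have hposX : 2 ^ p + (j * t + i) * p < X := by omega
        have hposX' : 2 ^ p + (j * t + i) * p + p < X := by omega
        have hpsX : 2 ^ p + D * t * p + (j * t + i) < X := by omega
        have hpsX' : 2 ^ p + D * t * p + (j * t + i) + 1 < X := by omega
        have hp'' : s''.word 22 0 = p := by
          rw [G.word 22 (by decide), F₅.word 22 (by decide), F₄.word 22 (by decide), hp']
        have ha'' : ∀ i, i < 2 ^ p → s''.real 3 i = a i := by
          rw [G.real 3 (by decide), F₅.real 3 (by decide), F₄.real 3 (by decide)]; exact ha'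
        have hidx : (WExp.bits false (wv 23) (wv 22)).eval M s'' = sampleIndex p f (j * t + i) := by
          have : bitsVal f (2 ^ p + (j * t + i) * p) p < X := (bitsVal_lt _ _ _).trans hpX
          rw [sampleIndex]
          simp only [bitsVal] at this ⊢
          simp [WExp.eval, hX, Nat.mod_eq_of_lt, k₂, hp'', hposX, hppX, ← hf, this]
        have hval : s''.real 3 (sampleIndex p f (j * t + i)) = a (sampleIndex p f (j * t + i)) :=
          ha'' _ (bitsVal_lt _ _ _)
        refine ⟨?_, ?_⟩
        · simp [BExp.Holds, WExp.eval, hX, Nat.mod_eq_of_lt, hlit, k₁, hiX, H''.lam, hlX, h16X, ← ht,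
            htX, hi]
        refine .seq' (P := fun s' t' => s'.real 16 0 = ∑ i ∈ Finset.range (i + 1),
          sampleSign p (D * t) f (j * t + i) * a (sampleIndex p f (j * t + i)) ∧ t' = 2) ?_ ?_
        · rw [Finset.sum_range_succ]
          refine .ite (fun hb => .setR rfl fun s₆ h₆ F₆ => ⟨?_, rfl⟩)
            (fun hb => .setR rfl fun s₆ h₆ F₆ => ⟨?_, rfl⟩)
          · have hb' : f (2 ^ p + D * t * p + (j * t + i)) = true := by
              by_contra hne
              simp [BExp.Holds, WExp.eval, hX, Nat.mod_eq_of_lt, hlit, k₃, hpsX, ← hf, hne] at hb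
            rw [h₆, RExp.eval, RExp.eval, RExp.eval, hidx, hval, sampleSign, hb']
            simp [WExp.eval, k₄, sgn]
          · have hb' : f (2 ^ p + D * t * p + (j * t + i)) = false := by
              by_contra hne
              rw [Bool.not_eq_false] at hne
              simp [BExp.Holds, WExp.eval, hX, Nat.mod_eq_of_lt, hlit, k₃, hpsX, ← hf, hne] at hb
            rw [h₆, RExp.eval, RExp.eval, RExp.eval, hidx, hval, sampleSign, hb']
            simp [WExp.eval, k₄, sgn]
            ring
        rintro s₆ t₆ ⟨h₆, rfl⟩ F₆
        refine .seqW (v := 2 ^ p + (j * t + (i + 1)) * p) ?_ fun s₇ h₇ F₇ => ?_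
        · simp (decide := true) [WExp.eval, hX, Nat.mod_eq_of_lt, F₆.word, k₂, hp'', hppX, hposX,
            hposX']
          ring
        refine .seqW (v := 2 ^ p + D * t * p + (j * t + (i + 1))) ?_ fun s₈ h₈ F₈ => ?_
        · simp (decide := true) [WExp.eval, hX, Nat.mod_eq_of_lt, hlit, F₇.word, F₆.word, k₃, hpsX,
            hpsX']
          ring
        refine .setW (v := i + 1) ?_ fun s₉ h₉ F₉ => ⟨⟨h₉, ?_, ?_, ?_⟩, by omega⟩
        · simp (decide := true) [WExp.eval, hX, Nat.mod_eq_of_lt, hlit, F₈.word, F₇.word, F₆.word,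
            k₁, hiX, hiX']
        · rw [F₉.word 23 (by decide), F₈.word 23 (by decide), h₇]
        · rw [F₉.word 24 (by decide), h₈]
        · rw [F₉.real 16 (by decide), F₈.real 16 (by decide), F₇.real 16 (by decide), h₆]
      · rintro s'' ⟨k₁, -⟩ G
        have H'' := H₅.of_frame G (by decide) (by decide)
        simp [BExp.Holds, WExp.eval, hX, Nat.mod_eq_of_lt, hlit, k₁, H''.lam, hlX, h16X, ← ht, htX]
      · rintro s'' t' ⟨k₁, k₂, k₃, k₄⟩ G ht'
        exact ⟨k₂, k₃, k₄, by omega⟩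
    rintro s₆ t₆ ⟨k₂, k₃, k₄, ht₆⟩ F₆
    have H₆ := H₅.of_frame F₆ (by decide) (by decide)
    have hj₆ : s₆.word 17 0 = j := by
      rw [F₆.word 17 (by decide), F₅.word 17 (by decide), F₄.word 17 (by decide), g₁]
    have hold : s₆.real 2 = s'.real 2 := by
      rw [F₆.real 2 (by decide), F₅.real 2 (by decide), F₄.real 2 (by decide)]
    refine .seq (.setReal (.setW (v := j + 1) ?_ fun s₇ h₇ F₇ =>
      ⟨⟨h₇, ?_, ?_, fun j' hj' => ?_⟩, by omega⟩))
    · simp (decide := true) [WExp.eval, hX, hlit, Nat.mod_eq_of_lt, hj₆, hjX, hjX']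
    · rw [F₇.word 23 (by decide), Store.putReal_word, k₂]; ring
    · rw [F₇.word 24 (by decide), Store.putReal_word, k₃]; ring
    · rw [F₇.real 2 (by decide)]
      have h16 : 16 % X = 16 := Nat.mod_eq_of_lt (hlit 16 (by norm_num))
      simp only [WExp.eval, RExp.eval, hX, Nat.mod_eq_of_lt, Nat.zero_mod, hj₆, hjX, k₄, H₆.lam,
        H₆.root, h16, hlX, hrX, h16X, hteX, Store.putReal_real, if_true]
      split_ifs with hji
      · rw [hji]
      · rw [hold]; exact g₄ j' (by omega)
  · rintro s' ⟨g₁, -⟩ F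
    have H' := H₃.of_frame F (by decide) (by decide)
    simp [BExp.Holds, WExp.eval, hX, Nat.mod_eq_of_lt, hlit, g₁, H'.dim, ← hDdef, hDX]
  · rintro s' t' ⟨g₁, g₂, g₃, g₄⟩ F ht'
    rw [show 6 * t + 5 + 1 = 6 * t + 6 by omega] at ht'
    exact ⟨g₄, by omega⟩

end

/-- The vector that is encoded: the projection of the point if the dimension is high and the point
itself otherwise, followed by the square of the norm. -/
noncomputable def embedded (l k : ℕ) (ε : ℝ) (f : ℕ → Bool) (x : ℕ → ℝ) (i : ℕ) : ℝ :=
  if i < dim l k ε then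
    if rootDim l k ε * rootDim l k ε < k then
      projection (log2ceil k) (dim l k ε) (16 * l) (rootDim l k ε) f x i
    else x i
  else ∑ j ∈ Finset.range k, x j ^ 2

theorem budget_congr {T : ℝ} {y y' : ℕ → ℝ} {R N : ℕ} (h : ∀ i, i < N → y i = y' i) :
    budget T y R N = budget T y' R N := by
  induction N with
  | zero => rfl
  | succ N ih =>
    rw [budget, budget, ih fun i hi => h i (by omega), h N (by omega)]

theorem encoding_congr {T s : ℝ} {b : ℕ} {y y' u : ℕ → ℝ} {R N : ℕ}
    (h : ∀ i, i < N → y i = y' i) : encoding T s b y u R N = encoding T s b y' u R N := by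
  induction N with
  | zero => rfl
  | succ N ih =>
    rw [encoding_succ, encoding_succ, ih fun i hi => h i (by omega), symbol, symbol,
      budget_congr fun i hi => h i (by omega), h N (by omega)]

theorem sketchOf_congr {l k : ℕ} {ε : ℝ} {y y' : ℕ → ℝ} {f : ℕ → Bool}
    (h : ∀ i, i < dim l k ε + 1 → y i = y' i) : sketchOf l k ε y f = sketchOf l k ε y' f := by
  unfold sketchOf
  simp only
  rw [budget_congr h, encoding_congr h]

/-- A bound for the time to sketch a point. -/
noncomputable def sketchTime (l k : ℕ) (ε : ℝ) : ℕ :=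
  43 * sketchLength l k ε + 20 * k + 60 +
    if rootDim l k ε * rootDim l k ε < k then
      2 ^ log2ceil k * (12 * log2ceil k + 8) + dim l k ε * (12 * (16 * l * (16 * l)))
    else 0

theorem hadamard_congr {p : ℕ} {a a' : ℕ → ℝ} (h : ∀ i, i < 2 ^ p → a i = a' i) {i : ℕ}
    (hi : i < 2 ^ p) : hadamard p a i = hadamard p a' i := by
  unfold hadamard
  rcases Nat.eq_zero_or_pos p with rfl | hp
  · exact h i hi
  obtain ⟨q, rfl⟩ : ∃ q, p = q + 1 := ⟨p - 1, by omega⟩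
  have hm : 2 ^ (q + 1) = 2 * 2 ^ q := by rw [pow_succ]; ring
  have hm' : 2 ^ (q + 1) / 2 = 2 ^ q := by omega
  rw [hm'] 
  rw [hm] at h hi
  suffices ∀ n i, i < 2 * 2 ^ q → (butterfly (2 ^ q))^[n] a i = (butterfly (2 ^ q))^[n] a' i from
    this _ _ hi
  intro n
  induction n with
  | zero => exact h
  | succ n ih =>
    intro i hi
    rw [Function.iterate_succ_apply', Function.iterate_succ_apply']
    exact butterfly_congr ih hi

theorem projectProg_spec {M : Machine} {l k : ℕ} {ε : ℝ} {X : ℕ} {s : Store} (E : Env M l k ε X)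
    (h : HasParams l k ε s) (hk : k ≤ 2 ^ l) :
    Wp M projectProg s fun s' t =>
      (∀ j, j < dim l k ε → s'.real 2 j =
        projection (log2ceil k) (dim l k ε) (16 * l) (rootDim l k ε) (M.stream false)
          (s.real 1) j) ∧
      t ≤ 2 ^ log2ceil k * (12 * log2ceil k + 8) + dim l k ε * (12 * (16 * l * (16 * l))) + 20 := by
  have hpX := two_pow_log2ceil_lt E
  have hpl : log2ceil k ≤ l := log2ceil_le hk
  have hl7 := E.hl
  have h2p := Nat.one_le_two_pow (n := log2ceil k)
  unfold projectProg
  refine .seq' (padProg_spec E h.ambient) ?_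
  rintro s₁ t₁ ⟨h₁, h₂, ht₁⟩ F₁
  refine .seq' (signProg_spec E h₂ (by omega)) ?_
  rintro s₂ t₂ ⟨h₃, ht₂⟩ F₂
  refine .seq' (hadamardProg_spec E (p := log2ceil k) (by rw [F₂.word 21 (by decide), h₂])
    (by rw [F₂.word 22 (by decide), h₁]) (by omega)) ?_
  rintro s₃ t₃ ⟨h₄, ht₃⟩ F₃
  have H₃ := ((h.of_frame F₁ (by decide) (by decide)).of_frame F₂ (by decide)
    (by decide)).of_frame F₃ (by decide) (by decide)
  refine (sampleProg_spec E H₃ hk hpl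
    (by rw [F₃.word 21 (by decide), F₂.word 21 (by decide), h₂])
    (by rw [F₃.word 22 (by decide), F₂.word 22 (by decide), h₁])
    (a := mixed (log2ceil k) (M.stream false) (s.real 1)) fun i hi => ?_).mono ?_
  · rw [h₄ i hi]
    refine hadamard_congr (fun i hi => ?_) hi
    rw [h₃ i hi, F₁.real 1 (by decide)]
  · rintro s₄ t₄ ⟨h₅, ht₄⟩
    refine ⟨h₅, ?_⟩
    set P := 2 ^ log2ceil k
    set p := log2ceil k
    set τ := 16 * l * (16 * l) with hτ
    have hτ1 : 1 ≤ τ := Nat.one_le_iff_ne_zero.2 (by positivity)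
    have e1 : p * (5 * P + 6) = 5 * (P * p) + 6 * p := by ring
    have e2 : P * (12 * p + 8) = 12 * (P * p) + 8 * P := by ring
    have e3 : dim l k ε * (6 * τ + 6) = 6 * (dim l k ε * τ) + 6 * dim l k ε := by ring
    have e4 : dim l k ε * (12 * τ) = 12 * (dim l k ε * τ) := by ring
    have e5 : dim l k ε * 1 ≤ dim l k ε * τ := Nat.mul_le_mul_left _ hτ1
    have e6 : p ≤ P := Nat.lt_two_pow_self.le
    have e7 : 1 * p ≤ P * p := Nat.mul_le_mul_right _ h2p
    rw [e2, e4]; rw [e1] at ht₃; rw [e3] at ht₄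
    omega

theorem sketchProg_spec {M : Machine} {l k : ℕ} {ε : ℝ} {X : ℕ} {s : Store} (E : Env M l k ε X)
    (hk : s.word 0 1 = k) (hW : s.word 0 2 = 16 * l) (hε : s.real 0 0 = ε) (hout : s.out = []) :
    Wp M sketchProg s fun s' t =>
      s'.out = sketchOf l k ε (embedded l k ε (M.stream false) (s.real 1)) (M.stream true) ∧
      t ≤ sketchTime l k ε := by
  have hX := E.card
  have hlit := E.lit
  have hkX := E.k_lt
  have hsq := E.rootDim_sq_le
  have hdim := dim_le l k ε
  have hroot := rootDim_le l k ε
  unfold sketchProg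
  refine .seq' (paramProg_spec E.toAdmissible E.bits E.card hk hW hε) ?_
  rintro s₁ t₁ ⟨H₁, ht₁⟩ F₁
  refine .seq' (fineBitsProg_spec E H₁) ?_
  rintro s₂ t₂ ⟨h₂, h₂', ht₂⟩ F₂
  have H₂ := H₁.of_frame F₂ (by decide) (by decide)
  refine .seq' (ditherBitsProg_spec E H₂) ?_
  rintro s₃ t₃ ⟨h₃, h₃', ht₃⟩ F₃
  have H₃ : HasPrep l k ε s₃ := 
    { toHasParams := H₂.of_frame F₃ (by decide) (by decide)
      bits := by rw [F₃.word 14 (by decide), h₂]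
      top := by rw [F₃.real 12 (by decide), h₂']
      width := h₃
      card := h₃' }
  refine .seq' (normProg_spec E H₃.ambient) ?_
  rintro s₄ t₄ ⟨h₄, ht₄⟩ F₄
  have H₄ := H₃.of_frame F₄ (by decide) (by decide)
  have hx₄ : s₄.real 1 = s.real 1 := by
    rw [F₄.real 1 (by decide), F₃.real 1 (by decide), F₂.real 1 (by decide), F₁.real 1 (by decide)]
  have hout₄ : s₄.out = [] := by
    rw [F₄.out (by decide), F₃.out (by decide), F₂.out (by decide), F₁.out (by decide), hout]
  refine .seq' (P := fun s' t => (∀ j, j < dim l k ε → s'.real 2 j =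
      embedded l k ε (M.stream false) (s.real 1) j) ∧ t ≤ 3 * k + 25 +
        if rootDim l k ε * rootDim l k ε < k then
          2 ^ log2ceil k * (12 * log2ceil k + 8) + dim l k ε * (12 * (16 * l * (16 * l)))
        else 0) ?_ ?_
  · have hroot' : rootDim l k ε < X := by omega
    have hsq' : rootDim l k ε * rootDim l k ε < X := by omega
    have hkX' : k < X := by omega
    refine .ite (fun hb => ?_) (fun hb => ?_)
    · simp [BExp.Holds, WExp.eval, hX, hlit, Nat.mod_eq_of_lt, H₄.root, H₄.ambient, hroot', hsq',
        hkX'] at hb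
      refine (projectProg_spec E H₄.toHasParams (E.hproj hb)).mono ?_
      rintro s' t ⟨h₅, ht⟩
      refine ⟨fun j hj => ?_, ?_⟩
      · rw [h₅ j hj, hx₄, embedded, if_pos hj, if_pos hb]
      · rw [if_pos hb]; omega
    · simp [BExp.Holds, WExp.eval, hX, hlit, Nat.mod_eq_of_lt, H₄.root, H₄.ambient, hroot', hsq',
        hkX'] at hb
      refine (copyProg_spec E H₄.ambient).mono ?_
      rintro s' t ⟨h₅, ht⟩
      refine ⟨fun j hj => ?_, ?_⟩
      · rw [h₅ j (by omega), hx₄, embedded, if_pos hj, if_neg (by omega)]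
      · omega
  rintro s₅ t₅ ⟨h₅, ht₅⟩ F₅
  have H₅ := H₄.of_frame F₅ (by decide) (by decide)
  refine .seq (.setReal ?_)
  have hD' : dim l k ε < X := by omega
  have e1 : (wv 12).eval M s₅ = dim l k ε := by
    simp [WExp.eval, hX, hlit, Nat.mod_eq_of_lt, H₅.dim, hD']
  have e2 : (rv 15).eval M s₅ = ∑ i ∈ Finset.range k, s.real 1 i ^ 2 := by
    simp only [RExp.eval, WExp.eval, Nat.zero_mod]
    rw [F₅.real 15 (by decide), h₄, F₃.real 1 (by decide), F₂.real 1 (by decide),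
      F₁.real 1 (by decide)]
  rw [e1, e2]
  refine (encodeProg_spec E (s := s₅.putReal 2 (dim l k ε) _) ?_ ?_).mono ?_
  · obtain ⟨⟨a1, a2, a3, a4, a5, a6⟩, a7, a8, a9, a10⟩ := H₅
    exact ⟨⟨a1, a2, a3, a4, by simpa using a5, by simpa using a6⟩, a7, by simpa using a8, a9, a10⟩
  · rw [Store.putReal_out, F₅.out (by decide), hout₄]
  · rintro s₆ t₆ ⟨h₆, ht₆⟩
    refine ⟨?_, ?_⟩
    · rw [h₆]
      refine sketchOf_congr fun i hi => ?_
      rw [Store.putReal_real, if_pos rfl]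
      split_ifs with hiD
      · rw [embedded, if_neg (by omega)]
      · exact h₅ i (by omega)
    · have hb : fineBits (coarse l k ε) (fine l k ε) ≤ sketchLength l k ε := by
        unfold sketchLength
        nlinarith [Nat.zero_le (dim l k ε)]
      unfold sketchTime
      omega

end DistanceSketch

namespace DistanceSketch

/-! ## Decoding -/

theorem bitsVal_eq_of_testBit {f : ℕ → Bool} {p b r : ℕ} (hr : r < 2 ^ b)
    (h : ∀ t, t < b → f (p + t) = r.testBit t) : bitsVal f p b = r := by
  have key : ∀ c, c ≤ b → bitsVal f p c = r % 2 ^ c := by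
    intro c
    induction c with
    | zero => simp [bitsVal, Nat.mod_one]
    | succ c ih =>
      intro hc
      rw [bitsVal_succ, ih (by omega), h c (by omega), Nat.mod_pow_succ,
        Nat.testBit_eq_decide_div_mod_eq]
      rcases Nat.mod_two_eq_zero_or_one (r / 2 ^ c) with h | h <;> simp [h]
  rw [key b le_rfl, Nat.mod_eq_of_lt hr]

/-- From position `p` on, the stream `f` contains the code of the symbol `σ`. -/
structure ReadsAt (f : ℕ → Bool) (p b : ℕ) (σ : Bool × ℕ × ℕ) : Prop where
  sign : f p = σ.1
  ones : ∀ j, j < σ.2.1 → f (p + 1 + j) = true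
  terminator : f (p + 1 + σ.2.1) = false
  bits : ∀ t, t < b → f (p + 1 + σ.2.1 + 1 + t) = σ.2.2.testBit t

theorem readsAt_append (pre suf : List Bool) (b : ℕ) (σ : Bool × ℕ × ℕ) :
    ReadsAt (fun i => (pre ++ codeword b σ ++ suf).getD i false) pre.length b σ := by
  have h : ∀ j, (pre ++ codeword b σ ++ suf).getD (pre.length + j) false =
      (σ.1 :: (List.replicate σ.2.1 true ++
        (false :: ((List.range b).map σ.2.2.testBit ++ suf)))).getD j false := fun j => by
    rw [List.append_assoc, List.getD_append_right _ _ _ _ (by omega), Nat.add_sub_cancel_left]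
    simp [codeword]
  refine ⟨?_, fun j hj => ?_, ?_, fun t ht => ?_⟩
  · simpa using h 0
  · rw [show pre.length + 1 + j = pre.length + (j + 1) by omega, h, List.getD_cons_succ,
      List.getD_append _ _ _ _ (by simpa using hj)]
    simp [hj]
  · rw [show pre.length + 1 + σ.2.1 = pre.length + (σ.2.1 + 1) by omega, h, List.getD_cons_succ,
      List.getD_append_right _ _ _ _ (by simp)]
    simp
  · rw [show pre.length + 1 + σ.2.1 + 1 + t = pre.length + (σ.2.1 + 1 + t + 1) by omega, h,
      List.getD_cons_succ, List.getD_append_right _ _ _ _ (by simp; omega),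
      List.length_replicate, show σ.2.1 + 1 + t - σ.2.1 = t + 1 by omega, List.getD_cons_succ,
      List.getD_append _ _ _ _ (by simpa using ht)]
    simp [ht]

theorem flatMap_range_split (σ : ℕ → Bool × ℕ × ℕ) (b : ℕ) {i N : ℕ} (hi : i < N) :
    ∃ suf, (List.range N).flatMap (fun i => codeword b (σ i)) =
      (List.range i).flatMap (fun i => codeword b (σ i)) ++ codeword b (σ i) ++ suf := by
  induction N with
  | zero => omega
  | succ N ih =>
    rw [List.range_succ, List.flatMap_append]
    rcases Nat.lt_or_ge i N with h | h
    · obtain ⟨suf, hs⟩ := ih h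
      rw [hs]
      exact ⟨_, List.append_assoc _ _ _⟩
    · obtain rfl : i = N := by omega
      exact ⟨[], by simp⟩

/-- The real number that a symbol stands for. -/
noncomputable def symbolVal (T s : ℝ) (σ : Bool × ℕ × ℕ) : ℝ :=
  if σ.1 then -(σ.2.1 * T + s * σ.2.2) else σ.2.1 * T + s * σ.2.2

/-- The conditions on `p` and `v` keep the position and the result apart from the word variables 14
and 19 and the real variables 10 and 11, which the program uses as well. -/
theorem readProg_spec {M : Machine} {l k : ℕ} {ε : ℝ} {X : ℕ} {s : Store} (E : Env M l k ε X)
    {c : Bool} {p v pos b : ℕ} {T d : ℝ} {σ : Bool × ℕ × ℕ} (hp : 20 < p) (hv : 12 < v)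
    (hpos : s.word p 0 = pos) (hb : s.word 14 0 = b) (hbX : 2 * 2 ^ b < X)
    (hT : s.real 10 0 = T) (hd : s.real 11 0 = d) (hR : ReadsAt (M.stream c) pos b σ)
    (hσ : σ.2.2 < 2 ^ b) (hX' : pos + (codeword b σ).length + 1 < X) :
    Wp M (readProg c p v) s fun s' t => s'.word p 0 = pos + (codeword b σ).length ∧
      s'.real v 0 = symbolVal T d σ ∧ t ≤ 3 * σ.2.1 + 10 := by
  have hX := E.card
  have hlit := E.lit
  rw [length_codeword] at hX' ⊢
  have hbX' : b < X := by omega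
  have hpX : pos < X := by omega
  have hp14 : 14 ≠ p := by omega
  have hp19 : p ≠ 19 := by omega
  have hv10 : 10 ≠ v := by omega
  have hv11 : 11 ≠ v := by omega
  unfold readProg
  refine .seqW (v := if σ.1 then 1 else 0) ?_ fun s₁ h₁ F₁ => ?_
  · simp [WExp.eval, hX, hlit, Nat.mod_eq_of_lt, hpos, hpX, hR.sign]
    cases σ.1
    · simp
    · exact Nat.mod_eq_of_lt (hlit 1 (by norm_num))
  have f1 : s₁.word p 0 = pos := by
    rw [F₁.word p (by simpa [Prog.wordTargets] using hp19), hpos]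
  refine .seqW (v := pos + 1) ?_ fun s₂ h₂ F₂ => ?_
  · have : pos + 1 < X := by omega
    simp [WExp.eval, hX, hlit, Nat.mod_eq_of_lt, f1, hpX, this]
  refine .seqR (v := 0) (by simp [RExp.eval, WExp.eval]) fun s₃ h₃ F₃ => ?_
  refine .seq' (P := fun s' t => s'.word p 0 = pos + 1 + σ.2.1 ∧ s'.real v 0 = σ.2.1 * T ∧
    t ≤ 3 * σ.2.1 + 1) ?_ ?_
  · refine Wp.loopConst σ.2.1 2 (fun j s' => s'.word p 0 = pos + 1 + j ∧ s'.real v 0 = j * T)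
      ?_ ?_ ?_ ?_
    · refine ⟨?_, by simpa using h₃⟩
      rw [F₃.word p (by simp [Prog.wordTargets]), h₂]
    · rintro j hj s' ⟨g₁, g₂⟩ F
      have hjX : pos + 1 + j < X := by omega
      have hjX' : pos + 1 + j + 1 < X := by omega
      refine ⟨?_, ?_⟩
      · simp [BExp.Holds, WExp.eval, hX, hlit, Nat.mod_eq_of_lt, g₁, hjX, hR.ones j hj]
      refine .seqR (v := (j + 1 : ℕ) * T) ?_ fun s₄ h₄ F₄ => ?_
      · have : s'.real 10 0 = T := by
          rw [F.real 10 (by simpa [Prog.realTargets] using hv10),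
            F₃.real 10 (by simpa [Prog.realTargets] using hv10),
            F₂.real 10 (by simp [Prog.realTargets]), F₁.real 10 (by simp [Prog.realTargets]), hT]
        simp [RExp.eval, WExp.eval, g₂, this]; ring
      refine .setW (v := pos + 1 + (j + 1)) ?_ fun s₅ h₅ F₅ => ⟨⟨h₅, ?_⟩, le_rfl⟩
      · have : s₄.word p 0 = pos + 1 + j := by
          rw [F₄.word p (by simp [Prog.wordTargets]), g₁]
        simp [WExp.eval, hX, hlit, Nat.mod_eq_of_lt, this, hjX, hjX']
        omega
      · rw [F₅.real v (by simp [Prog.realTargets]), h₄]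
    · rintro s' ⟨g₁, g₂⟩ F
      have hjX : pos + 1 + σ.2.1 < X := by omega
      simp [BExp.Holds, WExp.eval, hX, hlit, Nat.mod_eq_of_lt, g₁, hjX, hR.terminator]
    · rintro s' t ⟨g₁, g₂⟩ F ht
      exact ⟨g₁, g₂, by omega⟩
  rintro s₄ t₄ ⟨h₄, h₄', ht₄⟩ F₄
  have hX1 : pos + 1 + σ.2.1 < X := by omega
  have hX2 : pos + 1 + σ.2.1 + 1 < X := by omega
  have hX3 : pos + 1 + σ.2.1 + 1 + b < X := by omega
  refine .seqW (v := pos + 1 + σ.2.1 + 1) ?_ fun s₅ h₅ F₅ => ?_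
  · simp [WExp.eval, hX, hlit, Nat.mod_eq_of_lt, h₄, hX1, hX2]
  have hb₅ : s₅.word 14 0 = b := by
    rw [F₅.word 14 (by simpa [Prog.wordTargets] using hp14),
      F₄.word 14 (by simpa [Prog.wordTargets] using hp14), F₃.word 14 (by simp [Prog.wordTargets]),
      F₂.word 14 (by simpa [Prog.wordTargets] using hp14), F₁.word 14 (by simp [Prog.wordTargets]),
      hb]
  have hd₅ : s₅.real 11 0 = d := by
    rw [F₅.real 11 (by simp [Prog.realTargets]),
      F₄.real 11 (by simpa [Prog.realTargets] using hv11),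
      F₃.real 11 (by simpa [Prog.realTargets] using hv11), F₂.real 11 (by simp [Prog.realTargets]),
      F₁.real 11 (by simp [Prog.realTargets]), hd]
  have hbv : bitsVal (M.stream c) (pos + 1 + σ.2.1 + 1) b = σ.2.2 :=
    bitsVal_eq_of_testBit hσ hR.bits
  refine .seqR (v := σ.2.1 * T + d * σ.2.2) ?_ fun s₆ h₆ F₆ => ?_
  · have h1 : s₅.real v 0 = σ.2.1 * T := by rw [F₅.real v (by simp [Prog.realTargets]), h₄']
    have h2 : σ.2.2 < X := by omega
    simp only [bitsVal] at hbv
    simp [RExp.eval, WExp.eval, hX, hlit, Nat.mod_eq_of_lt, h1, hd₅, h₅, hX2, hb₅, hbX', hbv, h2]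
  refine .seqW (v := pos + 1 + σ.2.1 + 1 + b) ?_ fun s₇ h₇ F₇ => ?_
  · have h1 : s₆.word p 0 = pos + 1 + σ.2.1 + 1 := by
      rw [F₆.word p (by simp [Prog.wordTargets]), h₅]
    have h2 : s₆.word 14 0 = b := by rw [F₆.word 14 (by simp [Prog.wordTargets]), hb₅]
    simp [WExp.eval, hX, hlit, Nat.mod_eq_of_lt, h1, h2, hX2, hX3, hbX']
  have h19 : s₇.word 19 0 = if σ.1 then 1 else 0 := by
    have h' : 19 ≠ p := by omega
    rw [F₇.word 19 (by simpa [Prog.wordTargets] using h'), F₆.word 19 (by simp [Prog.wordTargets]),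
      F₅.word 19 (by simpa [Prog.wordTargets] using h'),
      F₄.word 19 (by simpa [Prog.wordTargets] using h'), F₃.word 19 (by simp [Prog.wordTargets]),
      F₂.word 19 (by simpa [Prog.wordTargets] using h'), h₁]
  have hv₇ : s₇.real v 0 = σ.2.1 * T + d * σ.2.2 := by
    rw [F₇.real v (by simp [Prog.realTargets]), h₆]
  refine .ite (fun hb => .setR (v := symbolVal T d σ) ?_ fun s₈ h₈ F₈ => ⟨?_, h₈, by omega⟩)
    (fun hb => .skip ⟨?_, ?_, by omega⟩)
  · have : σ.1 = true := by
      by_contra hne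
      simp [BExp.Holds, WExp.eval, h19, hne] at hb
    simp [RExp.eval, WExp.eval, hv₇, symbolVal, this]
  · rw [F₈.word p (by simp [Prog.wordTargets]), h₇]; omega
  · rw [h₇]; omega
  · have : σ.1 = false := by
      by_contra hne
      rw [Bool.not_eq_false] at hne
      simp [BExp.Holds, WExp.eval, h19, hne, hX, hlit, Nat.mod_eq_of_lt] at hb
    rw [hv₇]
    simp [symbolVal, this]

/-- The list `L` consists of the codes of `N` symbols and some padding. -/
structure IsCode (b N : ℕ) (σ : ℕ → Bool × ℕ × ℕ) (L : List Bool) : Prop where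
  lt : ∀ i, (σ i).2.2 < 2 ^ b
  eq : ∃ pad, L = (List.range N).flatMap (fun i => codeword b (σ i)) ++ pad
  length : L.length = N * (b + 6)

/-- The position of the code of the `i`-th symbol. -/
def codePos (b : ℕ) (σ : ℕ → Bool × ℕ × ℕ) (i : ℕ) : ℕ :=
  ((List.range i).flatMap fun i => codeword b (σ i)).length

theorem codePos_succ (b : ℕ) (σ : ℕ → Bool × ℕ × ℕ) (i : ℕ) :
    codePos b σ (i + 1) = codePos b σ i + (codeword b (σ i)).length := by
  simp [codePos, List.range_succ]

theorem codePos_eq (b : ℕ) (σ : ℕ → Bool × ℕ × ℕ) (i : ℕ) :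
    codePos b σ i = ∑ j ∈ Finset.range i, (σ j).2.1 + i * (b + 2) := by
  induction i with
  | zero => simp [codePos]
  | succ i ih =>
    rw [codePos_succ, ih, Finset.sum_range_succ, length_codeword]; ring

theorem IsCode.readsAt {b N : ℕ} {σ : ℕ → Bool × ℕ × ℕ} {L : List Bool} (h : IsCode b N σ L) {i : ℕ}
    (hi : i < N) : ReadsAt (fun j => L.getD j false) (codePos b σ i) b (σ i) := by
  obtain ⟨pad, hL⟩ := h.eq
  obtain ⟨suf, hs⟩ := flatMap_range_split σ b hi
  rw [hs, List.append_assoc] at hL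
  rw [hL]
  exact readsAt_append _ _ _ _

theorem IsCode.codePos_le {b N : ℕ} {σ : ℕ → Bool × ℕ × ℕ} {L : List Bool} (h : IsCode b N σ L)
    {i : ℕ} (hi : i ≤ N) : codePos b σ i ≤ N * (b + 6) := by
  have hmono : Monotone (codePos b σ) :=
    monotone_nat_of_le_succ fun i => by rw [codePos_succ]; omega
  obtain ⟨pad, hL⟩ := h.eq
  have h1 : codePos b σ N ≤ L.length := by rw [hL, codePos, List.length_append]; omega
  rw [h.length] at h1
  exact (hmono hi).trans h1

/-- Bounds the unary digits that recovery reads. As a fine position is read in a single step,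
recovery takes time linear in the dimension, whatever b is. -/
theorem IsCode.sum_le {b N : ℕ} {σ : ℕ → Bool × ℕ × ℕ} {L : List Bool} (h : IsCode b N σ L) :
    ∑ j ∈ Finset.range N, (σ j).2.1 ≤ 4 * N := by
  have h1 := h.codePos_le le_rfl
  rw [codePos_eq] at h1
  have e1 : N * (b + 6) = N * (b + 2) + 4 * N := by ring
  omega

/-- The estimate for the square of the distance that results from two sequences of symbols. -/
noncomputable def estimate (T s : ℝ) (D : ℕ) (σ σ' : ℕ → Bool × ℕ × ℕ) : ℝ :=
  symbolVal T s (σ D) + symbolVal T s (σ' D) -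
    2 * ∑ i ∈ Finset.range D, symbolVal T s (σ i) * symbolVal T s (σ' i)

theorem rootDim_le_dim (l k : ℕ) (ε : ℝ) : rootDim l k ε ≤ dim l k ε := by
  unfold dim
  split_ifs
  · exact Nat.le_mul_self _
  · exact rootDim_le l k ε

theorem Env.sketchLength_lt {M : Machine} {l k : ℕ} {ε : ℝ} {X : ℕ} (E : Env M l k ε X) :
    2 * sketchLength l k ε + 2 < X := by
  have h1 := E.fineBits_le
  have h2 := dim_le l k ε
  have h3 := E.hk'
  have h4 := Nat.lt_two_pow_self (n := l)
  have h5 : 2 ^ 7 ≤ 2 ^ l := Nat.pow_le_pow_right two_pos E.hl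
  have h6 : 2 ^ (4 * l) = 2 ^ (3 * l) * 2 ^ l := by rw [← pow_add]; congr 1; omega
  have h7 := Nat.one_le_two_pow (n := 3 * l)
  have h8 := Nat.one_le_two_pow (n := 4 * l)
  have : sketchLength l k ε ≤ 4 * 2 ^ (4 * l) := by
    calc sketchLength l k ε ≤ (2 * 2 ^ (3 * l)) * (2 * 2 ^ l) := by
          unfold sketchLength
          exact Nat.mul_le_mul (by omega) (by omega)
      _ = 4 * 2 ^ (4 * l) := by rw [h6]; ring
  exact E.lt (by omega)

theorem recoverProg_spec {M : Machine} {l k : ℕ} {ε : ℝ} {X : ℕ} {s : Store} (E : Env M l k ε X)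
    (hk : s.word 0 1 = k) (hW : s.word 0 2 = 16 * l) (hL : s.word 0 3 = sketchLength l k ε)
    (hε : s.real 0 0 = ε) {a a' : List Bool} {σ σ' : ℕ → Bool × ℕ × ℕ}
    (ha : IsCode (fineBits (coarse l k ε) (fine l k ε)) (dim l k ε + 1) σ a)
    (ha' : IsCode (fineBits (coarse l k ε) (fine l k ε)) (dim l k ε + 1) σ' a')
    (hM : M.stream = fun c i => (if c then a' else a).getD i false) :
    Wp M recoverProg s fun s' t =>
      s'.real 0 0 = estimate (coarse l k ε) (fine l k ε) (dim l k ε) σ σ' ∧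
      t ≤ 130 * dim l k ε := by
  have hX := E.card
  have hlit := E.lit
  have hkX := E.k_lt
  have hDk := dim_le l k ε
  have hD1 := E.dim_pos
  have hLX := E.sketchLength_lt
  have hbX := E.fineBits_lt
  have hbb := Nat.lt_two_pow_self (n := fineBits (coarse l k ε) (fine l k ε))
  have hroot := rootDim_le_dim l k ε
  have hsum := ha.sum_le
  have hsum' := ha'.sum_le
  have hLdef : sketchLength l k ε = (dim l k ε + 1) * (fineBits (coarse l k ε) (fine l k ε) + 6) :=
    rfl
  unfold recoverProg
  refine .seq' (paramProg_spec E.toAdmissible E.bits E.card hk hW hε) ?_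
  rintro s₁ t₁ ⟨H₁, ht₁⟩ F₁
  set T := coarse l k ε with hT
  set c := fine l k ε with hc
  set b := fineBits T c with hb
  set D := dim l k ε with hD
  have hDX : D < X := by omega
  have hDX' : D + 1 < X := by omega
  refine .seqW (v := b) ?_ fun s₂ h₂ F₂ => ?_
  · have h1 : s₁.word 0 3 = sketchLength l k ε := by rw [F₁.word 0 (by decide), hL]
    have h2 : sketchLength l k ε < X := by omega
    have h3 : sketchLength l k ε / (D + 1) = b + 6 := by
      rw [hLdef]; exact Nat.mul_div_cancel_left _ (by omega)
    simp [WExp.eval, hX, hlit, Nat.mod_eq_of_lt, h1, h2, H₁.dim, ← hD, hDX, hDX', h3]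
  refine .seqW (v := 0) (by simp [WExp.eval]) fun s₃ h₃ F₃ => ?_
  refine .seqW (v := 0) (by simp [WExp.eval]) fun s₄ h₄ F₄ => ?_
  refine .seqW (v := 0) (by simp [WExp.eval]) fun s₅ h₅ F₅ => ?_
  refine .seqR (v := 0) (by simp [RExp.eval, WExp.eval]) fun s₆ h₆ F₆ => ?_
  have H₆ : HasParams l k ε s₆ := ((((H₁.of_frame F₂ (by decide) (by decide)).of_frame F₃
    (by decide) (by decide)).of_frame F₄ (by decide) (by decide)).of_frame F₅ (by decide)
    (by decide)).of_frame F₆ (by decide) (by decide)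
  have hb₆ : s₆.word 14 0 = b := by
    rw [F₆.word 14 (by decide), F₅.word 14 (by decide), F₄.word 14 (by decide),
      F₃.word 14 (by decide), h₂]
  -- The partial result after i rounds. The two norms enter only in the last round, hence the
  -- special case i = D + 1 and the minimum with D.
  set A : ℕ → ℝ := fun i => (if i = D + 1 then symbolVal T c (σ D) + symbolVal T c (σ' D) else 0) -
    2 * ∑ j ∈ Finset.range (min i D), symbolVal T c (σ j) * symbolVal T c (σ' j) with hA
  have hAend : A (D + 1) = estimate T c D σ σ' := by
    simp only [hA, if_true, estimate]
    rw [min_eq_right (by omega)]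
  refine .seq' (P := fun s' t => s'.real 15 0 = A (D + 1) ∧ t ≤ 26 * (D + 1) +
    3 * (∑ j ∈ Finset.range (D + 1), (σ j).2.1) + 3 * (∑ j ∈ Finset.range (D + 1), (σ' j).2.1) + 1)
    ?_ ?_
  · refine Wp.loop (D + 1) (fun i s' t => s'.word 17 0 = i ∧ s'.word 21 0 = codePos b σ i ∧
      s'.word 22 0 = codePos b σ' i ∧ s'.real 15 0 = A i ∧
      t ≤ 26 * i + 3 * (∑ j ∈ Finset.range i, (σ j).2.1) +
        3 * (∑ j ∈ Finset.range i, (σ' j).2.1)) ?_ ?_ ?_ ?_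
    · refine ⟨?_, ?_, ?_, ?_, by simp⟩
      · rw [F₆.word 17 (by decide), h₅]
      · rw [F₆.word 21 (by decide), F₅.word 21 (by decide), F₄.word 21 (by decide), h₃]; rfl
      · rw [F₆.word 22 (by decide), F₅.word 22 (by decide), h₄]; rfl
      · simp [hA, h₆]
    · rintro i hi s' t ⟨g₁, g₂, g₃, g₄, g₅⟩ F
      have H' := H₆.of_frame F (by decide) (by decide)
      have hiX : i < X := by omega
      have hiX' : i + 1 < X := by omega
      have hp1 := ha.codePos_le (i := i + 1) hi
      have hp1' := ha'.codePos_le (i := i + 1) hi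
      rw [codePos_succ, ← hLdef] at hp1 hp1'
      refine ⟨?_, ?_⟩
      · simp [BExp.Holds, WExp.eval, hX, hlit, Nat.mod_eq_of_lt, g₁, hiX, H'.dim, ← hD, hDX, hDX',
          hi]
      have hb' : s'.word 14 0 = b := by rw [F.word 14 (by decide), hb₆]
      refine .seq' (readProg_spec E (c := false) (p := 21) (v := 13) (T := T) (d := c) (b := b)
        (σ := σ i) (by norm_num) (by norm_num)
        g₂ hb' hbX H'.coarseVal H'.fineVal ?_ (ha.lt i) (by omega)) ?_
      · rw [hM]; exact ha.readsAt hi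
      rintro s₇ t₇ ⟨a₁, a₂, a₃⟩ F₇
      have H₇ := H'.of_frame F₇ (by decide) (by decide)
      refine .seq' (readProg_spec E (c := true) (p := 22) (v := 14) (T := T) (d := c) (b := b)
        (σ := σ' i) (by norm_num) (by norm_num)
        (by rw [F₇.word 22 (by decide), g₃]) (by rw [F₇.word 14 (by decide), hb']) hbX
        H₇.coarseVal H₇.fineVal ?_ (ha'.lt i) (by omega)) ?_
      · rw [hM]; exact ha'.readsAt hi
      rintro s₈ t₈ ⟨b₁, b₂, b₃⟩ F₈
      have H₈ := H₇.of_frame F₈ (by decide) (by decide)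
      have hi₈ : s₈.word 17 0 = i := by
        rw [F₈.word 17 (by decide), F₇.word 17 (by decide), g₁]
      have h15 : s₈.real 15 0 = A i := by
        rw [F₈.real 15 (by decide), F₇.real 15 (by decide), g₄]
      have h13 : s₈.real 13 0 = symbolVal T c (σ i) := by rw [F₈.real 13 (by decide), a₂]
      refine .seq' (P := fun s' t => s'.real 15 0 = A (i + 1) ∧ t = 2) ?_ ?_
      · refine .ite (fun hb => .setR rfl fun s₉ h₉ _ => ⟨?_, rfl⟩)
          (fun hb => .setR rfl fun s₉ h₉ _ => ⟨?_, rfl⟩)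
        · have hiD : i < D := by
            simpa [BExp.Holds, WExp.eval, hX, hlit, Nat.mod_eq_of_lt, hi₈, hiX, H₈.dim, ← hD,
              hDX] using hb
          rw [h₉]
          have h2 : (2 : ℕ) % X = 2 := Nat.mod_eq_of_lt (hlit _ (by norm_num))
          simp only [RExp.eval, WExp.eval, Nat.zero_mod, h15, h13, b₂, hA, hX, h2]
          rw [if_neg (by omega), if_neg (by omega), min_eq_left (by omega), min_eq_left (by omega),
            Finset.sum_range_succ]
          push_cast
          ring
        · have hiD : i = D := by
            have : D ≤ i := by
              simpa [BExp.Holds, WExp.eval, hX, hlit, Nat.mod_eq_of_lt, hi₈, hiX, H₈.dim, ← hD,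
                hDX] using hb
            omega
          rw [h₉]
          simp only [RExp.eval, WExp.eval, Nat.zero_mod, h15, h13, b₂, hA, hX]
          rw [if_neg (by omega), if_pos (by omega), min_eq_right (by omega),
            min_eq_right (by omega), hiD]
          ring
      rintro s₉ t₉ ⟨h₉, rfl⟩ F₉
      refine .setW (v := i + 1) ?_ fun s' h F' => ⟨h, ?_, ?_, ?_, ?_⟩
      · simp (decide := true) [WExp.eval, hX, hlit, Nat.mod_eq_of_lt, F₉.word, hi₈, hiX, hiX']
      · rw [F'.word 21 (by decide), F₉.word 21 (by decide), F₈.word 21 (by decide), a₁,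
          codePos_succ]
      · rw [F'.word 22 (by decide), F₉.word 22 (by decide), b₁, codePos_succ]
      · rw [F'.real 15 (by decide), h₉]
      · rw [Finset.sum_range_succ, Finset.sum_range_succ]
        omega
    · rintro s' t ⟨g₁, -⟩ F
      have H' := H₆.of_frame F (by decide) (by decide)
      simp [BExp.Holds, WExp.eval, hX, hlit, Nat.mod_eq_of_lt, g₁, H'.dim, ← hD, hDX, hDX']
    · rintro s' t ⟨g₁, g₂, g₃, g₄, g₅⟩ F
      exact ⟨g₄, by omega⟩
  rintro s₇ t₇ ⟨h₇, ht₇⟩ F₇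
  refine .setR (v := A (D + 1)) ?_ fun s₈ h₈ F₈ => ⟨h₈.trans hAend, ?_⟩
  · simp [RExp.eval, WExp.eval, h₇]
  · omega

end DistanceSketch

namespace DistanceSketch

/-! ## The algorithm as a function -/

/-- The symbols of the sketch of `x`. -/
noncomputable def symbols (l k : ℕ) (ε : ℝ) (shared priv : ℕ → Bool) (x : ℕ → ℝ) (i : ℕ) :
    Bool × ℕ × ℕ :=
  symbol (coarse l k ε) (fine l k ε) (fineBits (coarse l k ε) (fine l k ε))
    (embedded l k ε shared x) (dither (log2ceil (rootDim l k ε)) priv) (4 * (dim l k ε + 1)) i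

/-- The sketch of `x`. -/
noncomputable def sketch (l k : ℕ) (ε : ℝ) (shared priv : ℕ → Bool) (x : ℕ → ℝ) : List Bool :=
  sketchOf l k ε (embedded l k ε shared x) priv

/-- The number that is computed from the sketches of `x` and `y`. -/
noncomputable def recovered (l k : ℕ) (ε : ℝ) (shared priv priv' : ℕ → Bool) (x y : ℕ → ℝ) : ℝ :=
  estimate (coarse l k ε) (fine l k ε) (dim l k ε) (symbols l k ε shared priv x)
    (symbols l k ε shared priv' y)

theorem isCode_sketch (l k : ℕ) (ε : ℝ) (shared priv : ℕ → Bool) (x : ℕ → ℝ) :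
    IsCode (fineBits (coarse l k ε) (fine l k ε)) (dim l k ε + 1) (symbols l k ε shared priv x)
      (sketch l k ε shared priv x) where
  lt _ := finePos_lt _ _ _
  eq := ⟨_, rfl⟩
  length := length_sketchOf _ _ _ _ _

section

variable {n k : ℕ} {ε : ℝ}

theorem env_of (h : Admissible (lam n) k ε) (stream : Bool → ℕ → Bool) :
    Env ⟨wordLength 16 n, stream⟩ (lam n) k ε (2 ^ (16 * lam n)) where
  toAdmissible := h
  bits := rfl
  card := rfl

theorem initStore_k (h : Admissible (lam n) k ε) (L : ℕ) (x : ℕ → ℝ) :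
    (initStore (wordLength 16 n) n k L ε x).word 0 1 = k := by
  have E := env_of h fun _ _ => false
  have := E.k_lt
  exact Nat.mod_eq_of_lt (a := k) (b := 2 ^ wordLength 16 n)
    (show k < 2 ^ (16 * lam n) by omega)

theorem initStore_bits (L : ℕ) (x : ℕ → ℝ) :
    (initStore (wordLength 16 n) n k L ε x).word 0 2 = 16 * lam n :=
  Nat.mod_eq_of_lt (a := wordLength 16 n) (b := 2 ^ wordLength 16 n) Nat.lt_two_pow_self

theorem sketches_sketch (h : Admissible (lam n) k ε) (shared priv : ℕ → Bool)
    (x : EuclideanSpace ℝ (Fin k)) :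
    ∃ t, Sketches 16 sketchProg n k ε shared priv x
      (sketch (lam n) k ε shared priv (coords x)) t ∧ t ≤ sketchTime (lam n) k ε := by
  obtain ⟨s', t, hr, h1, h2⟩ := sketchProg_spec
    (s := initStore (wordLength 16 n) n k 0 ε (coords x))
    (env_of h fun b => if b then priv else shared) (initStore_k h _ _) (initStore_bits _ _)
    rfl rfl
  exact ⟨t, ⟨s', h1, hr⟩, h2⟩

/-- Determinism: the run constructed in `sketches_sketch` is the only one, so the program can be
replaced by a function. -/
theorem eq_sketch (h : Admissible (lam n) k ε) {shared priv : ℕ → Bool}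
    {x : EuclideanSpace ℝ (Fin k)} {a : List Bool} {t : ℕ}
    (ha : Sketches 16 sketchProg n k ε shared priv x a t) :
    a = sketch (lam n) k ε shared priv (coords x) := by
  obtain ⟨t', ⟨s', h1, h2⟩, -⟩ := sketches_sketch h shared priv x
  obtain ⟨s, rfl, hr⟩ := ha
  rw [← h1, (hr.det h2).1]

theorem recovers_recovered (h : Admissible (lam n) k ε) (shared priv priv' : ℕ → Bool)
    (x y : ℕ → ℝ) :
    ∃ r, Recovers 16 recoverProg n k ε (sketch (lam n) k ε shared priv x)
      (sketch (lam n) k ε shared priv' y) (recovered (lam n) k ε shared priv priv' x y) r ∧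
      r ≤ 130 * dim (lam n) k ε := by
  have hL : (sketch (lam n) k ε shared priv x).length = sketchLength (lam n) k ε :=
    length_sketchOf _ _ _ _ _
  have hw : (initStore (wordLength 16 n) n k (sketch (lam n) k ε shared priv x).length ε
      fun _ => 0).word 0 3 = sketchLength (lam n) k ε := by
    rw [hL]
    have E := env_of h fun _ _ => false
    have := E.sketchLength_lt
    exact Nat.mod_eq_of_lt (a := sketchLength (lam n) k ε) (b := 2 ^ wordLength 16 n)
      (show sketchLength (lam n) k ε < 2 ^ (16 * lam n) by omega)
  obtain ⟨s', t, hr, h1, h2⟩ := recoverProg_spec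
    (s := initStore (wordLength 16 n) n k (sketch (lam n) k ε shared priv x).length ε fun _ => 0)
    (env_of h _) (initStore_k h _ _) (initStore_bits _ _) hw rfl
    (isCode_sketch (lam n) k ε shared priv x) (isCode_sketch (lam n) k ε shared priv' y) rfl
  exact ⟨t, ⟨s', h1, hr⟩, h2⟩

theorem eq_recovered (h : Admissible (lam n) k ε) {shared priv priv' : ℕ → Bool}
    {x y : ℕ → ℝ} {v : ℝ} {r : ℕ}
    (hv : Recovers 16 recoverProg n k ε (sketch (lam n) k ε shared priv x)
      (sketch (lam n) k ε shared priv' y) v r) :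
    v = recovered (lam n) k ε shared priv priv' x y := by
  obtain ⟨t', ⟨s', h1, h2⟩, -⟩ := recovers_recovered h shared priv priv' x y
  obtain ⟨s, rfl, hr⟩ := hv
  rw [← h1, (hr.det h2).1]

/-- Separates programs from probability: what remains is the failure probability of an explicit
function of the coins. -/
theorem isSketchAlgorithm_of (h : Admissible (lam n) k ε) {S R : ℝ}
    (hS : (sketchTime (lam n) k ε : ℝ) ≤ S) (hR : ((130 * dim (lam n) k ε : ℕ) : ℝ) ≤ R)
    (hprob : ∀ x : Fin n → EuclideanSpace ℝ (Fin k), (∀ i, ‖x i‖ ≤ 1) →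
      coins n {ω | ∃ i j : Fin n, i ≠ j ∧
        ε < |recovered (lam n) k ε (fun m => ω (none, m)) (fun m => ω (some i, m))
          (fun m => ω (some j, m)) (coords (x i)) (coords (x j)) - ‖x i - x j‖ ^ 2|} ≤
        ENNReal.ofReal (1 / n)) :
    IsSketchAlgorithm 16 sketchProg recoverProg n k ε (sketchLength (lam n) k ε) S R := by
  refine ⟨fun shared priv x _ => ?_, fun shared priv priv' x y _ _ a b t t' ha hb => ?_,
    fun x hx => ?_⟩
  · obtain ⟨t, h1, h2⟩ := sketches_sketch h shared priv x
    exact ⟨_, t, h1, length_sketchOf _ _ _ _ _, le_trans (by exact_mod_cast h2) hS⟩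
  · rw [eq_sketch h ha, eq_sketch h hb]
    obtain ⟨r, h1, h2⟩ := recovers_recovered h shared priv priv' (coords x) (coords y)
    exact ⟨_, r, h1, le_trans (by exact_mod_cast h2) hR⟩
  · refine le_trans (MeasureTheory.measure_mono ?_) (hprob x hx)
    rintro ω ⟨i, j, hij, a, b, t, t', r, v, ha, hb, hv, hε⟩
    refine ⟨i, j, hij, ?_⟩
    rw [eq_sketch h ha, eq_sketch h hb] at hv
    rwa [eq_recovered h hv] at hε

end

end DistanceSketch

namespace DistanceSketch

/-! ## Uniform distributions on finite types -/

open Finset MeasureTheory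

open scoped BigOperators

open Classical in
/-- The probability of `E` under the uniform distribution. -/
noncomputable def prob {Ω : Type*} [Fintype Ω] (E : Ω → Prop) : ℝ :=
  𝔼 ω, if E ω then (1 : ℝ) else 0

section

variable {Ω Ω' α J : Type*} [Fintype Ω] [Fintype Ω'] [Fintype α] [Fintype J]

theorem prob_mono {E F : Ω → Prop} (h : ∀ ω, E ω → F ω) : prob E ≤ prob F := by
  refine expect_le_expect fun ω _ => ?_
  by_cases hE : E ω
  · simp [hE, h ω hE]
  · simp only [hE, if_false]
    split_ifs <;> norm_num

theorem prob_le_one (E : Ω → Prop) : prob E ≤ 1 := by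
  classical
  unfold prob
  rw [Fintype.expect_eq_sum_div_card]
  refine div_le_one_of_le₀ ?_ (by positivity)
  calc (∑ ω, if E ω then (1 : ℝ) else 0) ≤ ∑ _ω : Ω, 1 :=
        sum_le_sum fun ω _ => by split_ifs <;> norm_num
    _ = _ := by simp

theorem prob_or_le (E F : Ω → Prop) : prob (fun ω => E ω ∨ F ω) ≤ prob E + prob F := by
  unfold prob
  rw [← expect_add_distrib]
  refine expect_le_expect fun ω _ => ?_
  by_cases hE : E ω <;> by_cases hF : F ω <;> simp [hE, hF]

theorem prob_exists_le {ι : Type*} [Fintype ι] {E : ι → Ω → Prop} {p : ℝ}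
    (h : ∀ i, prob (E i) ≤ p) : prob (fun ω => ∃ i, E i ω) ≤ Fintype.card ι * p := by
  classical
  calc prob (fun ω => ∃ i, E i ω) ≤ 𝔼 ω, ∑ i, if E i ω then (1 : ℝ) else 0 := by
        refine expect_le_expect fun ω _ => ?_
        split_ifs with h
        · obtain ⟨i, hi⟩ := h
          refine le_trans (by simp [hi]) (single_le_sum (f := fun i => if E i ω then (1 : ℝ) else 0)
            (fun j _ => ?_) (mem_univ i))
          split_ifs <;> norm_num
        · exact sum_nonneg fun i _ => by split_ifs <;> norm_num
    _ = ∑ i, prob (E i) := expect_sum_comm _ _ _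
    _ ≤ ∑ _i : ι, p := sum_le_sum fun i _ => h i
    _ = _ := by simp

theorem expect_prod (f : Ω × Ω' → ℝ) : 𝔼 z, f z = 𝔼 a, 𝔼 b, f (a, b) := by
  rw [← expect_product' univ univ (fun a b => f (a, b)), univ_product_univ]

theorem prob_prod_le [Nonempty Ω] {E : Ω × Ω' → Prop} {p : ℝ} (h : ∀ a, prob (fun b => E (a, b)) ≤ p) :
    prob E ≤ p := by
  unfold prob
  rw [expect_prod]
  calc _ ≤ 𝔼 _a : Ω, p := expect_le_expect fun a _ => h a
    _ = p := Fintype.expect_const p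

theorem prob_equiv (e : Ω ≃ Ω') (E : Ω' → Prop) : prob E = prob fun ω => E (e ω) := by
  unfold prob
  exact (Fintype.expect_equiv e _ _ fun _ => rfl).symm

theorem prob_fst [Nonempty Ω'] (E : Ω → Prop) : prob (fun z : Ω × Ω' => E z.1) = prob E := by
  classical
  unfold prob
  rw [expect_prod]
  exact expect_congr rfl fun a _ => Fintype.expect_const (if E a then (1 : ℝ) else 0)

/-- Independence of the coordinates, in the form from which the exponential moment bounds are
derived. -/
theorem expect_pi [DecidableEq J] (F : J → α → ℝ) :
    𝔼 z : J → α, ∏ j, F j (z j) = ∏ j, 𝔼 a, F j a := by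
  simp only [Fintype.expect_eq_sum_div_card, prod_div_distrib, prod_univ_sum]
  simp

theorem prob_pi_apply [DecidableEq J] [Nonempty α] (j : J) (E : α → Prop) :
    prob (fun z : J → α => E (z j)) = prob E := by
  classical
  have h := expect_pi (J := J) (α := α) fun i a => if i = j then (if E a then 1 else 0) else 1
  unfold prob
  simp only [prod_ite_eq', mem_univ, if_true] at h
  rw [h, ← mul_prod_erase univ _ (mem_univ j), prod_eq_one, mul_one]
  · simp
  · intro i hi
    simp [ne_of_mem_erase hi]

/-- The exponential Markov inequality. -/
theorem prob_le_exp {f : Ω → ℝ} {r lambda : ℝ} (hl : 0 ≤ lambda) :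
    prob (fun ω => r ≤ f ω) ≤ Real.exp (-(lambda * r)) * 𝔼 ω, Real.exp (lambda * f ω) := by
  unfold prob
  rw [mul_expect]
  refine expect_le_expect fun ω _ => ?_
  rw [← Real.exp_add]
  split_ifs with h
  · exact Real.one_le_exp (by nlinarith)
  · positivity

theorem prob_abs_le (f : Ω → ℝ) (r : ℝ) :
    prob (fun ω => r ≤ |f ω|) ≤ prob (fun ω => r ≤ f ω) + prob (fun ω => r ≤ -f ω) :=
  (prob_mono fun _ h => le_abs.1 h).trans (prob_or_le _ _)

/-- A centered function with values in `[-B, B]` is sub-Gaussian. -/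
theorem expect_exp_le [Nonempty α] {f : α → ℝ} {B : ℝ} (hB : ∀ a, |f a| ≤ B)
    (h0 : ∑ a, f a = 0) : 𝔼 a, Real.exp (f a) ≤ Real.exp (B ^ 2 / 2) := by
  obtain ⟨a₀⟩ := ‹Nonempty α›
  have hB0 : 0 ≤ B := (abs_nonneg _).trans (hB a₀)
  rcases hB0.eq_or_lt with rfl | hB0
  · have : ∀ a, f a = 0 := fun a => abs_nonpos_iff.1 (hB a)
    simp [this, Fintype.expect_eq_sum_div_card]
  -- By convexity the exponential lies below its chord over [-B, B]; the linear term of the chord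
  -- averages to zero.
  have key : ∀ a, Real.exp (f a) ≤ Real.cosh B + f a * (Real.sinh B / B) := by
    intro a
    obtain ⟨h1, h2⟩ := abs_le.1 (hB a)
    have hc := convexOn_exp.2 (Set.mem_univ B) (Set.mem_univ (-B))
      (div_nonneg (by linarith) (by linarith) : 0 ≤ (B + f a) / (2 * B))
      (div_nonneg (by linarith) (by linarith) : 0 ≤ (B - f a) / (2 * B))
      (by field_simp; ring)
    simp only [smul_eq_mul] at hc
    have e1 : (B + f a) / (2 * B) * B + (B - f a) / (2 * B) * -B = f a := by
      field_simp; ring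
    rw [e1] at hc
    refine hc.trans (le_of_eq ?_)
    rw [Real.cosh_eq, Real.sinh_eq]
    field_simp
    ring
  calc 𝔼 a, Real.exp (f a) ≤ 𝔼 a, (Real.cosh B + f a * (Real.sinh B / B)) :=
        expect_le_expect fun a _ => key a
    _ = Real.cosh B := by
        rw [expect_add_distrib, ← expect_mul, Fintype.expect_eq_sum_div_card (f := f), h0]
        have : Nonempty α := ⟨a₀⟩
        simp
    _ ≤ _ := Real.cosh_le_exp_half_sq B

/-- Hoeffding's inequality. -/
theorem hoeffding [DecidableEq J] [Nonempty α] {f : J → α → ℝ} {B : J → ℝ} {S r : ℝ}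
    (hB : ∀ j a, |f j a| ≤ B j) (h0 : ∀ j, ∑ a, f j a = 0) (hS : ∑ j, B j ^ 2 ≤ S) (hS0 : 0 < S)
    (hr : 0 ≤ r) :
    prob (fun z : J → α => r ≤ |∑ j, f j (z j)|) ≤ 2 * Real.exp (-(r ^ 2 / (2 * S))) := by
  have key : ∀ g : J → α → ℝ, (∀ j a, |g j a| ≤ B j) → (∀ j, ∑ a, g j a = 0) →
      prob (fun z : J → α => r ≤ ∑ j, g j (z j)) ≤ Real.exp (-(r ^ 2 / (2 * S))) := by
    intro g hg hg0
    -- The value r/S minimizes λ²S/2 - λr.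
    refine (prob_le_exp (lambda := r / S) (by positivity)).trans ?_
    have h1 : 𝔼 z : J → α, Real.exp (r / S * ∑ j, g j (z j)) ≤
        Real.exp ((r / S) ^ 2 * S / 2) := by
      calc 𝔼 z : J → α, Real.exp (r / S * ∑ j, g j (z j))
          = 𝔼 z : J → α, ∏ j, Real.exp (r / S * g j (z j)) := by
            simp only [mul_sum, Real.exp_sum]
        _ = ∏ j, 𝔼 a, Real.exp (r / S * g j a) :=
            expect_pi fun j a => Real.exp (r / S * g j a)
        _ ≤ ∏ j, Real.exp ((r / S * B j) ^ 2 / 2) := by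
            refine prod_le_prod (fun j _ => expect_nonneg fun a _ => (Real.exp_pos _).le)
              fun j _ => expect_exp_le (fun a => ?_) ?_
            · rw [abs_mul, abs_of_nonneg (by positivity : 0 ≤ r / S)]
              exact mul_le_mul_of_nonneg_left (hg j a) (by positivity)
            · rw [← mul_sum, hg0, mul_zero]
        _ = Real.exp ((r / S) ^ 2 * (∑ j, B j ^ 2) / 2) := by
            rw [← Real.exp_sum, mul_sum, sum_div]
            simp only [mul_pow]
        _ ≤ _ := by gcongr
    calc _ ≤ Real.exp (-(r / S * r)) * Real.exp ((r / S) ^ 2 * S / 2) := by gcongr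
      _ = _ := by
        rw [← Real.exp_add]
        congr 1
        field_simp
        ring
  refine (prob_abs_le _ _).trans ?_
  have h1 := key f hB h0
  have h2 := key (fun j a => -f j a) (fun j a => by rw [abs_neg]; exact hB j a)
    fun j => by rw [sum_neg_distrib, h0, neg_zero]
  simp only [sum_neg_distrib] at h2
  linarith

/-- A Chernoff bound for functions with values in `[0, L]` and mean at most `1`. -/
theorem chernoff [DecidableEq J] [Nonempty α] {f : α → ℝ} {L : ℝ} (hL : 0 < L)
    (hf : ∀ a, 0 ≤ f a) (hf' : ∀ a, f a ≤ L) (h1 : 𝔼 a, f a ≤ 1) :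
    prob (fun z : J → α => 3 * (Fintype.card J : ℝ) ≤ ∑ j, f (z j)) ≤
      Real.exp (-(Fintype.card J / L)) := by
  refine (prob_le_exp (lambda := 1 / L) (by positivity)).trans ?_
  -- The chord of the exponential over [0, 1], whose slope e - 1 is replaced by 2.
  have key : ∀ a, Real.exp (1 / L * f a) ≤ 1 + f a * (2 / L) := by
    intro a
    have h0 : 0 ≤ f a / L := div_nonneg (hf a) hL.le
    have h0' : f a / L ≤ 1 := div_le_one_of_le₀ (hf' a) hL.le
    have hc := convexOn_exp.2 (Set.mem_univ 1) (Set.mem_univ 0) h0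
      (sub_nonneg.2 h0') (by ring)
    simp only [smul_eq_mul, mul_one, mul_zero, add_zero, Real.exp_zero] at hc
    have he := Real.exp_one_lt_d9
    calc Real.exp (1 / L * f a) = Real.exp (f a / L) := by congr 1; ring
      _ ≤ f a / L * Real.exp 1 + (1 - f a / L) := hc
      _ ≤ f a / L * 3 + (1 - f a / L) := by gcongr; linarith
      _ = _ := by ring
  have h2 : 𝔼 z : J → α, Real.exp (1 / L * ∑ j, f (z j)) ≤ Real.exp (2 / L * Fintype.card J) := by
    calc 𝔼 z : J → α, Real.exp (1 / L * ∑ j, f (z j))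
        = 𝔼 z : J → α, ∏ j, Real.exp (1 / L * f (z j)) := by
          simp only [mul_sum, Real.exp_sum]
      _ = ∏ _j : J, 𝔼 a, Real.exp (1 / L * f a) :=
          expect_pi fun _ a => Real.exp (1 / L * f a)
      _ ≤ ∏ _j : J, Real.exp (2 / L) := by
          refine prod_le_prod (fun j _ => expect_nonneg fun a _ => (Real.exp_pos _).le)
            fun j _ => ?_
          calc 𝔼 a, Real.exp (1 / L * f a) ≤ 𝔼 a, (1 + f a * (2 / L)) :=
                expect_le_expect fun a _ => key a
            _ = 1 + (𝔼 a, f a) * (2 / L) := by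
                rw [expect_add_distrib, ← expect_mul, Fintype.expect_const]
            _ ≤ 1 + 1 * (2 / L) := by gcongr
            _ ≤ Real.exp (2 / L) := by
                have := Real.add_one_le_exp (2 / L)
                linarith
      _ = _ := by
          rw [prod_const, ← Real.exp_nat_mul, card_univ]
          congr 1; ring
  calc _ ≤ Real.exp (-(1 / L * (3 * (Fintype.card J : ℝ)))) *
        Real.exp (2 / L * Fintype.card J) := by gcongr
    _ = _ := by
      rw [← Real.exp_add]
      congr 1; ring

end

/-! ## The random bits -/

/-- An event that depends on finitely many coins at distinct places is a disjoint union of cylinders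
of equal measure. This passes from the infinite product measure to counting. -/
theorem coins_eq {n : ℕ} {T : Type*} [Fintype T] [DecidableEq T] {c : T → Option (Fin n) × ℕ}
    (hc : Function.Injective c) (E : (T → Bool) → Prop) :
    coins n {ω | E fun t => ω (c t)} = ENNReal.ofReal (prob E) := by
  classical
  have key : ∀ z : T → Bool, coins n {ω | (fun t => ω (c t)) = z} =
      ENNReal.ofReal (1 / Fintype.card (T → Bool)) := by
    intro z
    have h1 : {ω : Option (Fin n) × ℕ → Bool | (fun t => ω (c t)) = z} =
        Set.pi (univ.image c : Finset _) fun i => {b | ∀ t, c t = i → b = z t} := by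
      ext ω
      simp only [Set.mem_ofPred_eq, Set.mem_pi, coe_image, coe_univ, Set.image_univ,
        Set.mem_range, forall_exists_index, forall_apply_eq_imp_iff, funext_iff]
      constructor
      · intro h t t' ht
        rw [← h t', hc ht]
      · intro h t
        exact h t t rfl
    rw [h1, coins, Measure.infinitePi_pi _ (fun _ _ => MeasurableSet.of_discrete),
      prod_image fun _ _ _ _ h => hc h]
    have h2 : ∀ t, {b : Bool | ∀ t', c t' = c t → b = z t'} = {z t} := by
      intro t
      ext b
      simp only [Set.mem_ofPred_eq, Set.mem_singleton_iff]
      constructor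
      · intro h
        exact h t rfl
      · intro h t' ht
        rw [h, hc ht]
    simp only [h2]
    rw [prod_congr rfl fun t _ => PMF.toMeasure_apply_singleton _ _ (MeasurableSet.of_discrete)]
    simp only [PMF.uniformOfFintype_apply, Fintype.card_bool, prod_const, card_univ,
      Fintype.card_fun]
    rw [ENNReal.ofReal_div_of_pos (by positivity)]
    simp [ENNReal.inv_pow]
  have h1 : {ω : Option (Fin n) × ℕ → Bool | E fun t => ω (c t)} =
      ⋃ z ∈ univ.filter E, {ω | (fun t => ω (c t)) = z} := by
    ext ω
    simp
  have hm : Measurable fun (ω : Option (Fin n) × ℕ → Bool) (t : T) => ω (c t) :=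
    measurable_pi_lambda _ fun t => measurable_pi_apply _
  rw [h1, measure_biUnion_finset]
  · rw [sum_congr rfl fun z _ => key z, ← ENNReal.ofReal_sum_of_nonneg fun _ _ => by positivity]
    congr 1
    unfold prob
    rw [Fintype.expect_eq_sum_div_card, sum_const, sum_boole]
    simp [div_eq_mul_inv]
  · intro z _ z' _ hzz
    refine Set.disjoint_left.2 fun ω h h' => hzz (h.symm.trans h')
  · intro z _
    exact hm (MeasurableSet.of_discrete (s := {z}))

end DistanceSketch

namespace DistanceSketch

/-! ## Random signs -/

open Finset MeasureTheory

open scoped BigOperators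

section

variable {J I : Type*} [Fintype J] [Fintype I] [DecidableEq J] [DecidableEq I]

theorem abs_sgn (b : Bool) : |sgn b| = 1 := by cases b <;> simp [sgn]

theorem sum_sgn : ∑ b : Bool, sgn b = 0 := by simp [sgn]

/-- The sum of the `v i` with random signs. -/
noncomputable def signSum (v : I → ℝ) (σ : I → Bool) : ℝ := ∑ i, sgn (σ i) * v i

theorem expect_sgn_mul_sgn (i j : I) :
    𝔼 σ : I → Bool, sgn (σ i) * sgn (σ j) = if i = j then 1 else 0 := by
  have h := expect_pi (J := I) (α := Bool) fun k a =>
    (if k = i then sgn a else 1) * (if k = j then sgn a else 1)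
  simp only [prod_mul_distrib, prod_ite_eq', mem_univ, if_true] at h
  rw [h]
  split_ifs with hij
  · subst hij
    refine prod_eq_one fun k _ => ?_
    rw [Fintype.expect_eq_sum_div_card, Fintype.sum_bool]
    by_cases hk : k = i <;> norm_num [hk, sgn]
  · refine prod_eq_zero (mem_univ i) ?_
    rw [Fintype.expect_eq_sum_div_card, Fintype.sum_bool]
    simp [hij, sgn]

theorem expect_signSum_mul (v v' : I → ℝ) :
    𝔼 σ, signSum v σ * signSum v' σ = ∑ i, v i * v' i := by
  unfold signSum
  simp only [sum_mul_sum]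
  rw [expect_sum_comm]
  refine sum_congr rfl fun i _ => ?_
  rw [expect_sum_comm]
  have : ∀ j, 𝔼 σ : I → Bool, sgn (σ i) * v i * (sgn (σ j) * v' j) =
      (if i = j then 1 else 0) * (v i * v' j) := by
    intro j
    rw [← expect_sgn_mul_sgn, expect_mul]
    exact expect_congr rfl fun σ _ => by ring
  simp [this]

theorem expect_exp_signSum_le (v : I → ℝ) (x : ℝ) :
    𝔼 σ, Real.exp (x * signSum v σ) ≤ Real.exp (x ^ 2 * (∑ i, v i ^ 2) / 2) := by
  calc 𝔼 σ, Real.exp (x * signSum v σ) = 𝔼 σ : I → Bool, ∏ i, Real.exp (x * (sgn (σ i) * v i)) := by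
        simp only [signSum, mul_sum, Real.exp_sum]
    _ = ∏ i, 𝔼 b, Real.exp (x * (sgn b * v i)) :=
        expect_pi fun i b => Real.exp (x * (sgn b * v i))
    _ ≤ ∏ i, Real.exp (|x * v i| ^ 2 / 2) := by
        refine prod_le_prod (fun j _ => expect_nonneg fun a _ => (Real.exp_pos _).le)
          fun i _ => expect_exp_le (fun b => ?_) ?_
        · rw [mul_left_comm, abs_mul, abs_sgn, one_mul]
        · simp [sgn]
    _ = _ := by
        rw [← Real.exp_sum, mul_sum, sum_div]
        simp only [sq_abs, mul_pow]

/-- The square of a sum with random signs has an exponential moment. -/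
theorem expect_exp_sq_le {v : I → ℝ} (hv : ∑ i, v i ^ 2 ≤ 3) :
    𝔼 σ, Real.exp (signSum v σ ^ 2 / 8) ≤ 2 := by
  have hint : ∀ z : ℝ, Integrable fun x : ℝ => Real.exp (-(1 / 2) * (x - z / 2) ^ 2) := fun z =>
    (integrable_exp_neg_mul_sq (by norm_num : (0 : ℝ) < 1 / 2)).comp_sub_right (z / 2)
  have hexp : ∀ z x : ℝ, Real.exp (z ^ 2 / 8) * Real.exp (-(1 / 2) * (x - z / 2) ^ 2) =
      Real.exp (-(1 / 2) * x ^ 2) * Real.exp (x / 2 * z) := by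
    intro z x
    rw [← Real.exp_add, ← Real.exp_add]
    congr 1; ring
  -- Completing the square linearizes z²/8: the exponent becomes linear in z under a Gaussian
  -- average over x, and the sub-Gaussian bound for sums with random signs applies for each x.
  have h1 : ∀ z : ℝ, Real.exp (z ^ 2 / 8) * √(2 * Real.pi) =
      ∫ x : ℝ, Real.exp (-(1 / 2) * x ^ 2) * Real.exp (x / 2 * z) := by
    intro z
    have := integral_sub_right_eq_self (fun x : ℝ => Real.exp (-(1 / 2) * x ^ 2)) (z / 2)
      (μ := volume)
    rw [integral_gaussian] at this
    simp only [← hexp, integral_const_mul, this]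
    congr 2; ring
  have hint' : ∀ z : ℝ, Integrable fun x : ℝ =>
      Real.exp (-(1 / 2) * x ^ 2) * Real.exp (x / 2 * z) := by
    intro z
    simp only [← hexp]
    exact (hint z).const_mul _
  have hpi : 0 < √(2 * Real.pi) := by positivity
  refine le_of_mul_le_mul_right ?_ hpi
  calc (𝔼 σ, Real.exp (signSum v σ ^ 2 / 8)) * √(2 * Real.pi)
      = 𝔼 σ, ∫ x : ℝ, Real.exp (-(1 / 2) * x ^ 2) * Real.exp (x / 2 * signSum v σ) := by
        rw [expect_mul]
        exact expect_congr rfl fun σ _ => h1 _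
    _ = ∫ x : ℝ, 𝔼 σ, Real.exp (-(1 / 2) * x ^ 2) * Real.exp (x / 2 * signSum v σ) := by
        simp only [Fintype.expect_eq_sum_div_card]
        rw [integral_div, integral_finsetSum _ fun σ _ => hint' _]
    _ ≤ ∫ x : ℝ, Real.exp (-(1 / 8) * x ^ 2) := by
        refine integral_mono ?_ (integrable_exp_neg_mul_sq (by norm_num)) fun x => ?_
        · simp only [Fintype.expect_eq_sum_div_card]
          exact (integrable_finsetSum _ fun σ _ => hint' _).div_const _
        · simp only [← mul_expect]
          calc _ ≤ Real.exp (-(1 / 2) * x ^ 2) * Real.exp ((x / 2) ^ 2 * (∑ i, v i ^ 2) / 2) := by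
                gcongr
                exact expect_exp_signSum_le v _
            -- The exponents add up to -x²/8, which is negative because 3 < 4. The wider Gaussian
            -- accounts for the final factor 2.
            _ ≤ Real.exp (-(1 / 2) * x ^ 2) * Real.exp ((x / 2) ^ 2 * 3 / 2) := by gcongr
            _ = _ := by
                rw [← Real.exp_add]
                congr 1; ring
    _ = 2 * √(2 * Real.pi) := by
        rw [integral_gaussian, show Real.pi / (1 / 8) = 2 ^ 2 * (2 * Real.pi) by ring,
          Real.sqrt_mul (by norm_num), Real.sqrt_sq (by norm_num)]

/-- The Taylor remainder of order two. The linear term is kept exactly, so that it vanishes for a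
centered variable. -/
theorem exp_le_quadratic (x : ℝ) : Real.exp x ≤ 1 + x + x ^ 2 * Real.exp |x| := by
  have h := Complex.norm_exp_sub_sum_le_norm_mul_exp (x : ℂ) 2
  have e : Complex.exp x - ∑ m ∈ range 2, (x : ℂ) ^ m / m.factorial =
      ((Real.exp x - 1 - x : ℝ) : ℂ) := by
    simp [sum_range_succ]
    ring
  rw [e, Complex.norm_real, Complex.norm_real, Real.norm_eq_abs, Real.norm_eq_abs, sq_abs] at h
  linarith [le_abs_self (Real.exp x - 1 - x)]

/-- The product of two sums with the same random signs has mean ∑ v v', so the linear term of the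
expansion averages out. The quadratic remainder is controlled by the exponential moments of the two
squares, which is why x must be small. -/
theorem expect_exp_chaos_le {v v' : I → ℝ} (hv : ∑ i, v i ^ 2 ≤ 3) (hv' : ∑ i, v' i ^ 2 ≤ 3)
    {x : ℝ} (hx : |x| ≤ 1 / 32) :
    𝔼 σ, Real.exp (x * (signSum v σ * signSum v' σ - ∑ i, v i * v' i)) ≤
      Real.exp (5120 * x ^ 2) := by
  set m := ∑ i, v i * v' i with hm
  have hm3 : |m| ≤ 3 := by
    calc |m| ≤ ∑ i, |v i * v' i| := abs_sum_le_sum_abs _ _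
      _ ≤ ∑ i, (v i ^ 2 + v' i ^ 2) / 2 := by
          refine sum_le_sum fun i _ => ?_
          rw [abs_mul]
          nlinarith [sq_nonneg (|v i| - |v' i|), sq_abs (v i), sq_abs (v' i)]
      _ ≤ 3 := by rw [← sum_div, sum_add_distrib]; linarith
  have he : Real.exp (3 / 16) ≤ 5 / 4 := by
    have h1 := Real.one_sub_le_exp_neg (3 / 16)
    have h2 : Real.exp (3 / 16) * Real.exp (-(3 / 16)) = 1 := by rw [← Real.exp_add]; simp
    nlinarith [Real.exp_pos (3 / 16)]
  have key : ∀ σ, Real.exp (x * (signSum v σ * signSum v' σ - m)) ≤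
      1 + x * (signSum v σ * signSum v' σ - m) + x ^ 2 * (1280 *
        (Real.exp (signSum v σ ^ 2 / 8) + Real.exp (signSum v' σ ^ 2 / 8))) := by
    intro σ
    set z := signSum v σ
    set z' := signSum v' σ
    set Y := |z * z' - m| with hY
    have hY0 : 0 ≤ Y := abs_nonneg _
    have hYz : Y ≤ (z ^ 2 + z' ^ 2) / 2 + 3 := by
      have h1 : Y ≤ |z * z'| + |m| := abs_sub _ _
      have h2 : |z * z'| ≤ (z ^ 2 + z' ^ 2) / 2 := by
        rw [abs_mul]
        nlinarith [sq_nonneg (|z| - |z'|), sq_abs z, sq_abs z']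
      linarith
    have h1 := exp_le_quadratic (x * (z * z' - m))
    have h2 : (x * (z * z' - m)) ^ 2 * Real.exp |x * (z * z' - m)| ≤
        x ^ 2 * (2048 * Real.exp (Y / 16)) := by
      rw [abs_mul, mul_pow, mul_assoc, ← hY, ← sq_abs (z * z' - m), ← hY]
      refine mul_le_mul_of_nonneg_left ?_ (sq_nonneg x)
      -- Half of (Y/32)² is at most exp(Y/32), and 2048 = 2·32². The factor exp(|x|Y) supplies the
      -- other half of Y/16.
      have h3 := Real.quadratic_le_exp_of_nonneg (x := Y / 32) (by positivity)
      have h4 : Y ^ 2 ≤ 2048 * Real.exp (Y / 32) := by nlinarith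
      have h5 : Real.exp (|x| * Y) ≤ Real.exp (Y / 32) := by
        refine Real.exp_le_exp.2 ?_
        nlinarith
      calc Y ^ 2 * Real.exp (|x| * Y) ≤ 2048 * Real.exp (Y / 32) * Real.exp (Y / 32) := by
            gcongr
        _ = _ := by
            rw [mul_assoc, ← Real.exp_add]
            congr 2; ring
    have h3 : Real.exp (Y / 16) ≤ 5 / 8 * (Real.exp (z ^ 2 / 8) + Real.exp (z' ^ 2 / 8)) := by
      have e1 : Real.exp (Y / 16) ≤
          Real.exp (3 / 16) * (Real.exp (z ^ 2 / 32) * Real.exp (z' ^ 2 / 32)) := by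
        rw [← Real.exp_add, ← Real.exp_add]
        refine Real.exp_le_exp.2 ?_
        linarith
      have e2 : ∀ y : ℝ, Real.exp (y ^ 2 / 32) ^ 2 ≤ Real.exp (y ^ 2 / 8) := by
        intro y
        rw [← Real.exp_nat_mul]
        refine Real.exp_le_exp.2 ?_
        push_cast
        nlinarith [sq_nonneg y]
      have e3 := e2 z
      have e4 := e2 z'
      set a := Real.exp (z ^ 2 / 32)
      set b := Real.exp (z' ^ 2 / 32)
      have ha : 0 < a := Real.exp_pos _
      have hb : 0 < b := Real.exp_pos _
      calc Real.exp (Y / 16) ≤ Real.exp (3 / 16) * (a * b) := e1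
        _ ≤ 5 / 4 * (a * b) := by gcongr
        _ ≤ _ := by nlinarith [sq_nonneg (a - b)]
    have h4 : x ^ 2 * (2048 * Real.exp (Y / 16)) ≤
        x ^ 2 * (1280 * (Real.exp (z ^ 2 / 8) + Real.exp (z' ^ 2 / 8))) := by
      refine mul_le_mul_of_nonneg_left ?_ (sq_nonneg x)
      linarith
    linarith
  calc _ ≤ 𝔼 σ, (1 + x * (signSum v σ * signSum v' σ - m) + x ^ 2 * (1280 *
        (Real.exp (signSum v σ ^ 2 / 8) + Real.exp (signSum v' σ ^ 2 / 8)))) :=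
        expect_le_expect fun σ _ => key σ
    _ = 1 + x * ((𝔼 σ, signSum v σ * signSum v' σ) - m) + x ^ 2 * (1280 *
        ((𝔼 σ, Real.exp (signSum v σ ^ 2 / 8)) + 𝔼 σ, Real.exp (signSum v' σ ^ 2 / 8))) := by
        simp only [expect_add_distrib, ← mul_expect, expect_sub_distrib, Fintype.expect_const]
    _ ≤ 1 + x * 0 + x ^ 2 * (1280 * (2 + 2)) := by
        rw [expect_signSum_mul, sub_self]
        have h1 := expect_exp_sq_le hv
        have h2 := expect_exp_sq_le hv'
        gcongr
    _ ≤ _ := by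
        have := Real.add_one_le_exp (5120 * x ^ 2)
        linarith

/-- The average of products of pairs of sums with random signs is concentrated. -/
theorem prob_chaos_le {v v' : J → I → ℝ} (hv : ∀ j, ∑ i, v j i ^ 2 ≤ 3)
    (hv' : ∀ j, ∑ i, v' j i ^ 2 ≤ 3) {r : ℝ} (hr : 0 ≤ r) (hr' : r ≤ 320) :
    prob (fun σ : J → I → Bool => Fintype.card J * r ≤
      |∑ j, (signSum (v j) (σ j) * signSum (v' j) (σ j) - ∑ i, v j i * v' j i)|) ≤
      2 * Real.exp (-(Fintype.card J * r ^ 2 / 20480)) := by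
  -- The value r/10240 minimizes 5120x² - rx, and r ≤ 320 keeps |x| within 1/32. Both signs of x are
  -- used, for the two tails.
  have key : ∀ x : ℝ, |x| = r / 10240 →
      prob (fun σ : J → I → Bool => Fintype.card J * (r * (r / 10240)) ≤
        x * ∑ j, (signSum (v j) (σ j) * signSum (v' j) (σ j) - ∑ i, v j i * v' j i)) ≤
      Real.exp (-(Fintype.card J * r ^ 2 / 20480)) := by
    intro x hx
    refine (prob_le_exp (lambda := 1) (by norm_num)).trans ?_
    have h1 : 𝔼 σ : J → I → Bool, Real.exp (1 * (x * ∑ j, (signSum (v j) (σ j) *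
        signSum (v' j) (σ j) - ∑ i, v j i * v' j i))) ≤
        Real.exp (Fintype.card J * (5120 * x ^ 2)) := by
      calc _ = 𝔼 σ : J → I → Bool, ∏ j, Real.exp (x * (signSum (v j) (σ j) *
            signSum (v' j) (σ j) - ∑ i, v j i * v' j i)) := by
            simp only [one_mul, mul_sum, Real.exp_sum]
        _ = ∏ j, 𝔼 τ, Real.exp (x * (signSum (v j) τ * signSum (v' j) τ -
            ∑ i, v j i * v' j i)) :=
            expect_pi fun j τ => Real.exp (x * (signSum (v j) τ * signSum (v' j) τ -
              ∑ i, v j i * v' j i))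
        _ ≤ ∏ _j : J, Real.exp (5120 * x ^ 2) := by
            refine prod_le_prod (fun j _ => expect_nonneg fun a _ => (Real.exp_pos _).le)
              fun j _ => expect_exp_chaos_le (hv j) (hv' j) ?_
            rw [hx]
            linarith
        _ = _ := by rw [prod_const, ← Real.exp_nat_mul, card_univ]
    calc _ ≤ Real.exp (-(1 * (Fintype.card J * (r * (r / 10240))))) *
          Real.exp (Fintype.card J * (5120 * x ^ 2)) := by gcongr
      _ = _ := by
        rw [← Real.exp_add, ← sq_abs x, hx]
        congr 1; ring
  have h1 := key (r / 10240) (abs_of_nonneg (by positivity))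
  have h2 := key (-(r / 10240)) (by rw [abs_neg]; exact abs_of_nonneg (by positivity))
  rcases hr.eq_or_lt with rfl | hr0
  · refine (prob_le_one _).trans ?_
    simp
  refine (prob_abs_le _ _).trans ?_
  refine (add_le_add (le_trans (prob_mono fun σ h => ?_) h1)
    (le_trans (prob_mono fun σ h => ?_) h2)).trans (by linarith)
  · have := mul_le_mul_of_nonneg_right h (by positivity : 0 ≤ r / 10240)
    linarith
  · have := mul_le_mul_of_nonneg_right h (by positivity : 0 ≤ r / 10240)
    linarith

end

end DistanceSketch

namespace DistanceSketch

/-! ## The Walsh-Hadamard transform -/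

open Finset

open scoped BigOperators

theorem sum_range_two_mul (f : ℕ → ℝ) (m : ℕ) :
    ∑ i ∈ range (2 * m), f i = ∑ i ∈ range m, (f (2 * i) + f (2 * i + 1)) := by
  induction m with
  | zero => simp
  | succ m ih => rw [mul_add, mul_one, sum_range_succ, sum_range_succ, sum_range_succ, ih]; ring

/-- The polarized parallelogram law: (a + b)(c + d) + (a - b)(c - d) = 2(ac + bd). So p rounds
multiply inner products by 2^p. -/
theorem sum_butterfly_mul (m : ℕ) (a b : ℕ → ℝ) :
    ∑ i ∈ range (2 * m), butterfly m a i * butterfly m b i =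
      2 * ∑ i ∈ range (2 * m), a i * b i := by
  rw [sum_range_two_mul (fun i => a i * b i), two_mul m, sum_range_add, ← sum_add_distrib, mul_sum]
  refine sum_congr rfl fun i hi => ?_
  have : i < m := mem_range.1 hi
  simp only [butterfly, this, if_true, Nat.add_sub_cancel_left,
    show ¬ m + i < m by omega, if_false]
  ring

theorem sum_hadamard_mul (p : ℕ) (a b : ℕ → ℝ) :
    ∑ i ∈ range (2 ^ p), hadamard p a i * hadamard p b i =
      2 ^ p * ∑ i ∈ range (2 ^ p), a i * b i := by
  rcases p with _ | p
  · simp [hadamard]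
  have h2 : 2 ^ (p + 1) = 2 * (2 ^ (p + 1) / 2) := by rw [pow_succ]; omega
  have key : ∀ q, ∑ i ∈ range (2 ^ (p + 1)), (butterfly (2 ^ (p + 1) / 2))^[q] a i *
      (butterfly (2 ^ (p + 1) / 2))^[q] b i = 2 ^ q * ∑ i ∈ range (2 ^ (p + 1)), a i * b i := by
    intro q
    induction q with
    | zero => simp
    | succ q ih =>
      simp only [Function.iterate_succ', Function.comp_apply]
      have := sum_butterfly_mul (2 ^ (p + 1) / 2) ((butterfly (2 ^ (p + 1) / 2))^[q] a)
        ((butterfly (2 ^ (p + 1) / 2))^[q] b)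
      rw [← h2] at this
      rw [this, ih]
      ring
  exact key _

theorem butterfly_sum (m : ℕ) {ι : Type*} (s : Finset ι) (c : ι → ℝ) (b : ι → ℕ → ℝ) :
    butterfly m (fun i => ∑ j ∈ s, c j * b j i) = fun i => ∑ j ∈ s, c j * butterfly m (b j) i := by
  ext i
  unfold butterfly
  split_ifs
  · rw [← sum_add_distrib]
    exact sum_congr rfl fun j _ => by ring
  · rw [← sum_sub_distrib]
    exact sum_congr rfl fun j _ => by ring

/-- The matrix of the Walsh-Hadamard transform. -/
def hadamardCoeff (p i j : ℕ) : ℝ := hadamard p (Pi.single j 1) i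

theorem hadamard_eq_sum (p : ℕ) (a : ℕ → ℝ) {i : ℕ} (hi : i < 2 ^ p) :
    hadamard p a i = ∑ j ∈ range (2 ^ p), a j * hadamardCoeff p i j := by
  rcases p with _ | p
  · obtain rfl : i = 0 := by omega
    simp [hadamardCoeff, hadamard]
  have h2 : 2 ^ (p + 1) = 2 * (2 ^ (p + 1) / 2) := by rw [pow_succ]; omega
  have key : ∀ q, ∀ i < 2 ^ (p + 1), (butterfly (2 ^ (p + 1) / 2))^[q] a i =
      ∑ j ∈ range (2 ^ (p + 1)), a j *
        (butterfly (2 ^ (p + 1) / 2))^[q] (Pi.single j (1 : ℝ)) i := by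
    intro q
    induction q with
    | zero =>
      intro i hi
      simp only [Function.iterate_zero, id, Pi.single_apply, mul_ite, mul_one, mul_zero]
      rw [sum_ite_eq (range _) i a, if_pos (mem_range.2 hi)]
    | succ q ih =>
      intro i hi
      simp only [Function.iterate_succ', Function.comp_apply]
      rw [butterfly_congr (a' := fun i => ∑ j ∈ range (2 ^ (p + 1)), a j *
        (butterfly (2 ^ (p + 1) / 2))^[q] (Pi.single j (1 : ℝ)) i)
        (fun i hi => ih i (by omega)) (by omega), butterfly_sum]
  exact key _ i hi

/-- A basis vector spreads without overlaps. After q rounds its image vanishes except where the low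
p - q bits of the position are the high p - q bits of j, so of the two entries that a butterfly
combines at most one is nonzero, and no entry leaves [-1, 1]. -/
theorem abs_hadamardCoeff_le (p : ℕ) {i j : ℕ} (hi : i < 2 ^ p) (hj : j < 2 ^ p) :
    |hadamardCoeff p i j| ≤ 1 := by
  have key : ∀ q ≤ p, ∀ i < 2 ^ p,
      |(butterfly (2 ^ p / 2))^[q] (Pi.single j (1 : ℝ)) i| ≤ 1 ∧
      (i % 2 ^ (p - q) ≠ j / 2 ^ q → (butterfly (2 ^ p / 2))^[q] (Pi.single j (1 : ℝ)) i = 0) := by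
    intro q
    induction q with
    | zero =>
      intro _ i hi
      simp only [Function.iterate_zero, id, Pi.single_apply, pow_zero, Nat.div_one, Nat.sub_zero,
        Nat.mod_eq_of_lt hi]
      refine ⟨?_, fun h => if_neg h⟩
      split_ifs <;> simp
    | succ q ih =>
      intro hq i hi
      have ih := ih (by omega)
      obtain ⟨r, rfl⟩ : ∃ r, p = q + 1 + r := ⟨p - (q + 1), by omega⟩
      have e1 : q + 1 + r - q = r + 1 := by omega
      have e2 : q + 1 + r - (q + 1) = r := by omega
      have e3 : 2 ^ (q + 1 + r) / 2 = 2 ^ q * 2 ^ r := by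
        rw [show q + 1 + r = q + r + 1 by omega, pow_succ, Nat.mul_div_cancel _ two_pos, pow_add]
      have e4 : 2 ^ (q + 1 + r) = 2 * (2 ^ q * 2 ^ r) := by
        rw [pow_add, pow_succ]; ring
      simp only [e1, e2, e3] at ih ⊢
      simp only [Function.iterate_succ', Function.comp_apply]
      set g := (butterfly (2 ^ q * 2 ^ r))^[q] (Pi.single j (1 : ℝ)) with hg
      have hjq : j / 2 ^ (q + 1) = j / 2 ^ q / 2 := by rw [pow_succ, Nat.div_div_eq_div_mul]
      have hodd : ∀ c, (2 * c + 1) % 2 ^ (r + 1) = 2 * (c % 2 ^ r) + 1 := by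
        intro c
        rw [pow_succ', Nat.mod_mul, show (2 * c + 1) / 2 = c by omega]
        omega
      have heven : ∀ c, (2 * c) % 2 ^ (r + 1) = 2 * (c % 2 ^ r) := by
        intro c
        rw [pow_succ', Nat.mul_mod_mul_left]
      have main : ∀ c < 2 ^ q * 2 ^ r, ∀ η : ℝ, |η| = 1 → |g (2 * c) + η * g (2 * c + 1)| ≤ 1 ∧
          (c % 2 ^ r ≠ j / 2 ^ (q + 1) → g (2 * c) + η * g (2 * c + 1) = 0) := by
        intro c hc η hη
        obtain ⟨h1, h2⟩ := ih (2 * c) (by omega)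
        obtain ⟨h3, h4⟩ := ih (2 * c + 1) (by omega)
        rw [heven] at h2
        rw [hodd] at h4
        rw [hjq]
        by_cases h5 : 2 * (c % 2 ^ r) = j / 2 ^ q
        · rw [h4 (by omega), mul_zero, add_zero]
          exact ⟨h1, fun h => absurd (by omega) h⟩
        · rw [h2 h5, zero_add, abs_mul, hη, one_mul]
          refine ⟨h3, fun h => ?_⟩
          rw [h4 (by omega), mul_zero]
      unfold butterfly
      split_ifs with h
      · simpa using main i h 1 (by simp)
      · have := main (i - 2 ^ q * 2 ^ r) (by omega) (-1) (by simp)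
        have e5 : (i - 2 ^ q * 2 ^ r) % 2 ^ r = i % 2 ^ r := by
          conv_rhs => rw [← Nat.sub_add_cancel (le_of_not_gt h), Nat.add_mul_mod_self_right]
        rw [e5] at this
        simpa [sub_eq_add_neg] using this
  exact (key p le_rfl i hi).1

/-- Random signs flatten the Walsh-Hadamard transform of a vector. -/
theorem prob_flatten_le (p : ℕ) {x : ℕ → ℝ} (hx : ∑ i ∈ range (2 ^ p), x i ^ 2 ≤ 1) {L : ℝ}
    (hL : 0 ≤ L) {i : ℕ} (hi : i < 2 ^ p) :
    prob (fun f : Fin (2 ^ p) → Bool =>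
      L ≤ |∑ j, sgn (f j) * (x j * hadamardCoeff p i j)|) ≤ 2 * Real.exp (-(L ^ 2 / 2)) := by
  have h := hoeffding (J := Fin (2 ^ p)) (α := Bool)
    (f := fun j b => sgn b * (x j * hadamardCoeff p i j)) (B := fun j => |x j|) (S := 1) (r := L)
    (fun j b => ?_) (fun j => ?_) ?_ one_pos hL
  · simpa using h
  · rw [abs_mul, abs_sgn, one_mul, abs_mul]
    exact mul_le_of_le_one_right (abs_nonneg _) (abs_hadamardCoeff_le p hi j.2)
  · rw [← sum_mul, sum_sgn, zero_mul]
  · simp only [sq_abs]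
    rw [Fin.sum_univ_eq_sum_range (fun j => x j ^ 2)]
    exact hx

theorem mixed_eq_sum (p : ℕ) (f : ℕ → Bool) (x : ℕ → ℝ) {i : ℕ} (hi : i < 2 ^ p) :
    mixed p f x i = ∑ j : Fin (2 ^ p), sgn (f j) * (x j * hadamardCoeff p i j) := by
  rw [mixed, hadamard_eq_sum p _ hi, ← Fin.sum_univ_eq_sum_range (fun j => sgn (f j) * x j *
    hadamardCoeff p i j)]
  exact sum_congr rfl fun j _ => by ring

theorem sum_mixed_mul (p : ℕ) (f : ℕ → Bool) (x y : ℕ → ℝ) :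
    ∑ i ∈ range (2 ^ p), mixed p f x i * mixed p f y i =
      2 ^ p * ∑ i ∈ range (2 ^ p), x i * y i := by
  unfold mixed
  rw [sum_hadamard_mul]
  congr 1
  refine sum_congr rfl fun i _ => ?_
  cases f i <;> simp [sgn]

end DistanceSketch

namespace DistanceSketch

/-! ## The projection -/

open Finset

open scoped BigOperators

/-- Conditioning on the first stage of a random experiment, whose bad outcomes form `F`. -/
theorem prob_prod_le_add {Ω Ω' : Type*} [Fintype Ω] [Fintype Ω'] [Nonempty Ω] {E : Ω × Ω' → Prop}
    {F : Ω → Prop} {p : ℝ} (hp : 0 ≤ p) (h : ∀ a, ¬ F a → prob (fun b => E (a, b)) ≤ p) :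
    prob E ≤ prob F + p := by
  classical
  calc prob E = 𝔼 a, prob (fun b => E (a, b)) := by
        unfold prob
        exact expect_prod _
    _ ≤ 𝔼 a, ((if F a then 1 else 0) + p) := by
        refine expect_le_expect fun a _ => ?_
        split_ifs with hF
        · linarith [prob_le_one fun b => E (a, b)]
        · linarith [h a hF]
    _ = _ := by
        rw [expect_add_distrib, Fintype.expect_const]
        unfold prob
        congr! 1

section

variable {J Θ A : Type*} [Fintype J] [Fintype Θ] [Fintype A] [DecidableEq J] [DecidableEq Θ]
  [Nonempty A]

/-- The samples `a (I i)`, scaled by `1 / τ`, with random signs. -/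
noncomputable def sampleSum (a : A → ℝ) (τ : ℝ) (I : Θ → A) (σ : Θ → Bool) : ℝ :=
  signSum (fun i => a (I i) / τ) σ

/-- Ensures that the sampled vectors, scaled by 1/τ, have squared norm at most 3, as `prob_chaos_le`
requires. Flatness, the bound `L`, is what makes the Chernoff bound effective. -/
theorem prob_exists_sample_sq_le {a : A → ℝ} {L : ℝ} (hL : 0 < L) (ha : ∀ i, a i ^ 2 ≤ L)
    (ha1 : 𝔼 i, a i ^ 2 ≤ 1) :
    prob (fun I : J → Θ → A => ∃ j, 3 * (Fintype.card Θ : ℝ) ≤ ∑ i, a (I j i) ^ 2) ≤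
      Fintype.card J * Real.exp (-(Fintype.card Θ / L)) := by
  have h := chernoff (J := Θ) (f := fun b => a b ^ 2) hL (fun i => sq_nonneg _) ha ha1
  refine prob_exists_le fun j => ?_
  exact (prob_pi_apply (J := J) j fun I : Θ → A =>
    3 * (Fintype.card Θ : ℝ) ≤ ∑ i, a (I i) ^ 2).trans_le h

theorem abs_mul_le_of_sq_le {x y L : ℝ} (hx : x ^ 2 ≤ L) (hy : y ^ 2 ≤ L) : |x * y| ≤ L := by
  rw [abs_mul]
  nlinarith [sq_nonneg (|x| - |y|), sq_abs x, sq_abs y]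

/-- Given the samples, the products of the new coordinates have the sample averages as expectations.
These are compared here with the true inner product, by Hoeffding over all J × Θ samples at once. -/
theorem prob_sample_mean_le {a a' : A → ℝ} {L r : ℝ} (hL : 0 < L) (ha : ∀ i, a i ^ 2 ≤ L)
    (ha' : ∀ i, a' i ^ 2 ≤ L) (hJ : 0 < Fintype.card J) (hΘ : 0 < Fintype.card Θ) (hr : 0 ≤ r) :
    prob (fun I : J → Θ → A => Fintype.card J * Fintype.card Θ * r ≤
      |∑ j, ∑ i, (a (I j i) * a' (I j i) - 𝔼 b, a b * a' b)|) ≤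
      2 * Real.exp (-(Fintype.card J * Fintype.card Θ * r ^ 2 / (8 * L ^ 2))) := by
  set m := 𝔼 b, a b * a' b with hm
  have hJ' : (0 : ℝ) < Fintype.card J := by exact_mod_cast hJ
  have hΘ' : (0 : ℝ) < Fintype.card Θ := by exact_mod_cast hΘ
  have hmL : |m| ≤ L := by
    rw [hm]
    refine (abs_expect_le _ _).trans ?_
    calc 𝔼 b, |a b * a' b| ≤ 𝔼 _b : A, L :=
          expect_le_expect fun b _ => abs_mul_le_of_sq_le (ha b) (ha' b)
      _ = L := Fintype.expect_const L
  have h := hoeffding (J := J × Θ) (α := A) (f := fun _ b => a b * a' b - m) (B := fun _ => 2 * L)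
    (S := Fintype.card J * Fintype.card Θ * (2 * L) ^ 2)
    (r := Fintype.card J * Fintype.card Θ * r) (fun _ b => ?_) (fun _ => ?_) ?_ (by positivity)
    (by positivity)
  · rw [prob_equiv (Equiv.curry J Θ A).symm] at h
    simp only [Fintype.sum_prod_type] at h
    refine h.trans (le_of_eq ?_)
    congr 2
    field_simp
    ring
  · exact (abs_sub _ _).trans (by linarith [abs_mul_le_of_sq_le (ha b) (ha' b)])
  · rw [sum_sub_distrib, hm, Fintype.expect_eq_sum_div_card]
    have : (Fintype.card A : ℝ) ≠ 0 := by simp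
    simp
    field_simp
    ring
  · simp

/-- Inner products are approximately preserved by sampling flat vectors. -/
theorem prob_sampleSum_le {a a' : A → ℝ} {L τ ε : ℝ} (hL : 0 < L) (ha : ∀ i, a i ^ 2 ≤ L)
    (ha' : ∀ i, a' i ^ 2 ≤ L) (ha1 : 𝔼 i, a i ^ 2 ≤ 1) (ha1' : 𝔼 i, a' i ^ 2 ≤ 1)
    (hJ : 0 < Fintype.card J) (hτ : 0 < τ) (hΘ : (Fintype.card Θ : ℝ) = τ ^ 2) (hε : 0 < ε)
    (hε1 : ε ≤ 1) :
    prob (fun z : (J → Θ → A) × (J → Θ → Bool) => Fintype.card J * (3 * ε / 16) ≤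
      |∑ j, sampleSum a τ (z.1 j) (z.2 j) * sampleSum a' τ (z.1 j) (z.2 j) -
        Fintype.card J * 𝔼 b, a b * a' b|) ≤
      2 * Fintype.card J * Real.exp (-(τ ^ 2 / L)) +
      2 * Real.exp (-(Fintype.card J * τ ^ 2 * (ε / 16) ^ 2 / (8 * L ^ 2))) +
      2 * Real.exp (-(Fintype.card J * (ε / 8) ^ 2 / 20480)) := by
  set m := 𝔼 b, a b * a' b with hm
  have hJ' : (0 : ℝ) < Fintype.card J := by exact_mod_cast hJ
  have hΘ0 : 0 < Fintype.card Θ := by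
    have : (0 : ℝ) < Fintype.card Θ := by rw [hΘ]; positivity
    exact_mod_cast this
  have h1 := prob_exists_sample_sq_le (J := J) (Θ := Θ) hL ha ha1
  have h2 := prob_exists_sample_sq_le (J := J) (Θ := Θ) hL ha' ha1'
  have h3 := prob_sample_mean_le (J := J) (Θ := Θ) (r := ε / 16) hL ha ha' hJ hΘ0 (by positivity)
  rw [hΘ] at h1 h2 h3
  -- The samples are drawn first, the signs second. The error 3ε/16 is divided into ε/16 for the
  -- sample averages and ε/8 for the random signs.
  refine (prob_prod_le_add (p := 2 * Real.exp (-(Fintype.card J * (ε / 8) ^ 2 / 20480)))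
    (by positivity) fun I hI => ?_).trans (add_le_add_left ((prob_or_le _ _).trans
      (add_le_add ((prob_or_le _ _).trans (add_le_add h1 h2)) h3)) _ |>.trans (by linarith))
  simp only [not_or, not_exists, not_le] at hI
  obtain ⟨⟨hI1, hI2⟩, hI3⟩ := hI
  have hc : ∀ (b : A → ℝ) (j : J), ∑ i, b (I j i) ^ 2 < 3 * τ ^ 2 →
      ∑ i, (b (I j i) / τ) ^ 2 ≤ 3 := by
    intro b j h
    simp only [div_pow]
    rw [← sum_div, div_le_iff₀ (by positivity)]
    exact h.le
  have h4 := prob_chaos_le (v := fun j i => a (I j i) / τ) (v' := fun j i => a' (I j i) / τ)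
    (fun j => hc a j (hI1 j)) (fun j => hc a' j (hI2 j)) (r := ε / 8) (by positivity) (by linarith)
  refine (prob_mono fun σ hσ => ?_).trans h4
  simp only at hσ
  have e1 : ∑ j, ∑ i, (a (I j i) * a' (I j i) - m) =
      τ ^ 2 * (∑ j, ∑ i, a (I j i) / τ * (a' (I j i) / τ) - Fintype.card J * m) := by
    simp only [sum_sub_distrib, sum_const, card_univ, nsmul_eq_mul, mul_sub]
    rw [hΘ, mul_sum]
    congr 1
    · refine sum_congr rfl fun j _ => ?_
      rw [mul_sum]
      exact sum_congr rfl fun i _ => by field_simp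
    · ring
  rw [e1, abs_mul, abs_of_nonneg (by positivity : 0 ≤ τ ^ 2), mul_right_comm, mul_comm (τ ^ 2),
    mul_lt_mul_iff_left₀ (by positivity)] at hI3
  have e2 : ∑ j, sampleSum a τ (I j) (σ j) * sampleSum a' τ (I j) (σ j) - Fintype.card J * m =
      ∑ j, (signSum (fun i => a (I j i) / τ) (σ j) * signSum (fun i => a' (I j i) / τ) (σ j) -
        ∑ i, a (I j i) / τ * (a' (I j i) / τ)) +
      (∑ j, ∑ i, a (I j i) / τ * (a' (I j i) / τ) - Fintype.card J * m) := by
    simp only [sampleSum, sum_sub_distrib]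
    ring
  rw [e2] at hσ
  have := abs_add_le (∑ j, (signSum (fun i => a (I j i) / τ) (σ j) *
    signSum (fun i => a' (I j i) / τ) (σ j) - ∑ i, a (I j i) / τ * (a' (I j i) / τ)))
    (∑ j, ∑ i, a (I j i) / τ * (a' (I j i) / τ) - Fintype.card J * m)
  linarith

end

end DistanceSketch

namespace DistanceSketch

/-! ## Dithered rounding -/

open Finset

open scoped BigOperators

theorem budget_add_sum {T : ℝ} {y : ℕ → ℝ} {R N : ℕ} (h : ∑ i ∈ range N, ⌊|y i| / T⌋₊ ≤ R) :
    budget T y R N + ∑ i ∈ range N, ⌊|y i| / T⌋₊ = R := by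
  induction N with
  | zero => simp [budget]
  | succ N ih =>
    rw [sum_range_succ] at h ⊢
    have := ih (by omega)
    rw [budget, coarsePos]
    omega

/-- If all floors together fit into the budget, the cap in `coarsePos` is never active. -/
theorem floor_le_budget {T : ℝ} {y : ℕ → ℝ} {R N : ℕ} (h : ∑ i ∈ range N, ⌊|y i| / T⌋₊ ≤ R)
    {i : ℕ} (hi : i < N) : ⌊|y i| / T⌋₊ ≤ budget T y R i := by
  have h1 : ∑ i ∈ range (i + 1), ⌊|y i| / T⌋₊ ≤ ∑ i ∈ range N, ⌊|y i| / T⌋₊ :=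
    sum_le_sum_of_subset (range_mono hi)
  have h2 := budget_add_sum (T := T) (y := y) (R := R) (N := i)
    (by rw [sum_range_succ] at h1; omega)
  rw [sum_range_succ] at h1
  omega

/-- The error of rounding down `a` after adding the dither `u`. -/
noncomputable def roundErr (a u : ℝ) : ℝ := ⌊a + u⌋₊ - a

theorem abs_roundErr_le {a u : ℝ} (ha : 0 ≤ a) (hu : 0 ≤ u) (hu' : u < 1) :
    |roundErr a u| ≤ 1 := by
  have h1 := Nat.floor_le (add_nonneg ha hu)
  have h2 := Nat.lt_floor_add_one (a + u)
  unfold roundErr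
  rw [abs_le]
  constructor <;> linarith

/-- What is left of `y` after coarse rounding, in multiples of `s`. -/
noncomputable def residue (T s y : ℝ) : ℝ := (|y| - ⌊|y| / T⌋₊ * T) / s

theorem residue_nonneg {T s : ℝ} (hT : 0 < T) (hs : 0 < s) (y : ℝ) : 0 ≤ residue T s y := by
  have := Nat.floor_le (div_nonneg (abs_nonneg y) hT.le)
  rw [le_div_iff₀ hT] at this
  exact div_nonneg (by linarith) hs.le

/-- When neither cap is active, decoding returns the coordinate up to the dithered rounding error.
The sign factor appears because the absolute value is what is rounded; `hb` makes the binary part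
wide enough. -/
theorem symbolVal_symbol {T s : ℝ} (hT : 0 < T) (hs : 0 < s) {b : ℕ} (hb : T + s ≤ s * 2 ^ b)
    {y u : ℕ → ℝ} {R i : ℕ} (hu' : u i < 1) (hR : ⌊|y i| / T⌋₊ ≤ budget T y R i) :
    symbolVal T s (symbol T s b y u R i) =
      y i + (if y i < 0 then -1 else 1) * s * roundErr (residue T s (y i)) (u i) := by
  have hq : coarsePos T (y i) (budget T y R i) = ⌊|y i| / T⌋₊ := min_eq_left hR
  have h1 := Nat.lt_floor_add_one (|y i| / T)
  rw [div_lt_iff₀ hT] at h1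
  have hr : (|y i| - ⌊|y i| / T⌋₊ * T + s * u i) / s = residue T s (y i) + u i := by
    unfold residue
    field_simp
  have hlt : residue T s (y i) + u i < (2 ^ b : ℕ) := by
    rw [← hr, div_lt_iff₀ hs]
    push_cast
    nlinarith
  have hf : finePos s b (|y i| - ⌊|y i| / T⌋₊ * T + s * u i) = ⌊residue T s (y i) + u i⌋₊ := by
    unfold finePos
    rw [hr]
    refine min_eq_left ?_
    have : ⌊residue T s (y i) + u i⌋₊ < 2 ^ b := (Nat.floor_lt' (by positivity)).2 hlt
    omega
  have hres : |y i| = ⌊|y i| / T⌋₊ * T + s * residue T s (y i) := by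
    unfold residue
    field_simp
    ring
  simp only [symbol, symbolVal, hq, hf, decide_eq_true_eq, roundErr]
  split_ifs with h
  · rw [abs_of_neg h] at *
    linarith
  · rw [abs_of_nonneg (not_lt.1 h)] at *
    linarith

/-- With m = ⌊a⌋ every dither rounds to m or m + 1, and m + 1 occurs exactly for i ≥ c = P(m + 1 -
a). The sum is therefore c - ⌈c⌉: a dither with P equally spaced values has bias at most 1/P. -/
theorem abs_sum_roundErr_le {a : ℝ} (ha : 0 ≤ a) {P : ℕ} (hP : 0 < P) :
    |∑ i ∈ range P, roundErr a (i / P)| ≤ 1 := by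
  have hP' : (0 : ℝ) < P := by exact_mod_cast hP
  set m := ⌊a⌋₊ with hm
  have hm1 := Nat.floor_le ha
  have hm2 := Nat.lt_floor_add_one a
  set c : ℝ := P * (m + 1 - a) with hc
  have hc0 : 0 < c := by
    have : 0 < m + 1 - a := by linarith
    positivity
  have hcP : c ≤ P := by nlinarith
  have h1 : ∀ i ∈ range P, roundErr a (i / P) = (m - a) + if ⌈c⌉₊ ≤ i then 1 else 0 := by
    intro i hi
    have hiP : (i : ℝ) < P := by exact_mod_cast mem_range.1 hi
    have hi1 : (i : ℝ) / P < 1 := (div_lt_one hP').2 hiP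
    have hi0 : 0 ≤ (i : ℝ) / P := by positivity
    have key : c ≤ i ↔ m + 1 - a ≤ i / P := by rw [le_div_iff₀ hP', hc, mul_comm]
    simp only [Nat.ceil_le, key]
    unfold roundErr
    split_ifs with h
    · have : ⌊a + i / P⌋₊ = m + 1 := by
        rw [Nat.floor_eq_iff (by positivity)]
        push_cast
        constructor <;> linarith
      rw [this]; push_cast; ring
    · have : ⌊a + i / P⌋₊ = m := by
        rw [Nat.floor_eq_iff (by positivity)]
        constructor <;> linarith
      rw [this]; ring
  have h2 : ((range P).filter fun i => ⌈c⌉₊ ≤ i).card = P - ⌈c⌉₊ := by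
    rw [← Nat.card_Ico]
    congr 1
    ext i
    simp only [mem_filter, mem_range, mem_Ico]
    tauto
  have h3 : ⌈c⌉₊ ≤ P := Nat.ceil_le.2 hcP
  have h4 := Nat.le_ceil c
  have h5 := Nat.ceil_lt_add_one hc0.le
  rw [sum_congr rfl h1, sum_add_distrib, sum_const, card_range, nsmul_eq_mul, sum_boole, h2,
    Nat.cast_sub h3, abs_le]
  constructor <;> nlinarith

/-- Binary numbers. -/
def bitsEquiv (w : ℕ) : (Fin w → Bool) ≃ Fin (2 ^ w) :=
  ((Equiv.refl (Fin w)).arrowCongr finTwoEquiv.symm).trans finFunctionFinEquiv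

theorem bitsEquiv_apply (w : ℕ) (f : ℕ → Bool) (p : ℕ) :
    (bitsEquiv w fun t => f (p + t) : ℕ) = bitsVal f p w := by
  rw [bitsEquiv, Equiv.trans_apply, finFunctionFinEquiv_apply, bitsVal,
    ← Fin.sum_univ_eq_sum_range (fun t => if f (p + t) then 2 ^ t else 0)]
  refine sum_congr rfl fun t _ => ?_
  simp only [Equiv.arrowCongr_apply, Equiv.coe_refl, Equiv.refl_symm, Function.comp_apply, id]
  cases f (p + t) <;> simp [finTwoEquiv]

/-- The dither given by some random bits. -/
noncomputable def ditherOf (w : ℕ) (z : Fin w → Bool) : ℝ := (bitsEquiv w z : ℕ) / (2 ^ w : ℕ)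

theorem ditherOf_nonneg (w : ℕ) (z : Fin w → Bool) : 0 ≤ ditherOf w z := by
  unfold ditherOf; positivity

theorem ditherOf_lt_one (w : ℕ) (z : Fin w → Bool) : ditherOf w z < 1 := by
  unfold ditherOf
  rw [div_lt_one (by positivity)]
  exact_mod_cast (bitsEquiv w z).2

theorem sum_bits (w : ℕ) (g : ℕ → ℝ) :
    ∑ z : Fin w → Bool, g (bitsEquiv w z) = ∑ i ∈ range (2 ^ w), g i := by
  rw [← Fin.sum_univ_eq_sum_range]
  exact Equiv.sum_comp (bitsEquiv w) fun i => g i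

/-- The total rounding error is concentrated. -/
theorem prob_rounding_le {D w : ℕ} {s ε lambda : ℝ} {c η a : Fin D → ℝ} (hs : 0 < s) (hε : 0 < ε)
    (hc : ∑ i, c i ^ 2 ≤ 6) (hη : ∀ i, |η i| = 1) (ha : ∀ i, 0 ≤ a i)
    (hw : (D : ℝ) ≤ (2 ^ w) ^ 2) (hsε : 2 ^ 13 * s ≤ ε)
    (h : D * (2 ^ 13 * s) ^ 2 ≤ ε ^ 2 ∨ lambda * (2 ^ 13 * s) ^ 2 ≤ ε ^ 2) :
    prob (fun z : Fin D → Fin w → Bool =>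
      ε / 8 ≤ |∑ i, c i * (η i * s * roundErr (a i) (ditherOf w (z i)))|) ≤
      2 * Real.exp (-(8 * lambda)) := by
  have hC : (∑ i, |c i|) ^ 2 ≤ 6 * D := by
    have := sum_mul_sq_le_sq_mul_sq univ (fun i => |c i|) fun _ => (1 : ℝ)
    simp only [mul_one, sq_abs, one_pow, sum_const, card_univ, Fintype.card_fin, nsmul_eq_mul]
      at this
    nlinarith
  have hC0 : 0 ≤ ∑ i, |c i| := sum_nonneg fun _ _ => abs_nonneg _
  -- If D is small compared with ε²/s², even the worst case s ∑ |c i| ≤ s√(6D) stays below ε/8, and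
  -- the event is empty.
  rcases h with h | h
  · have hzero : ∀ z : Fin D → Fin w → Bool,
        ¬ ε / 8 ≤ |∑ i, c i * (η i * s * roundErr (a i) (ditherOf w (z i)))| := by
      intro z hz
      have h1 : |∑ i, c i * (η i * s * roundErr (a i) (ditherOf w (z i)))| ≤
          s * ∑ i, |c i| := by
        rw [mul_sum]
        refine (abs_sum_le_sum_abs _ _).trans (sum_le_sum fun i _ => ?_)
        rw [abs_mul, abs_mul, abs_mul, hη, one_mul, abs_of_pos hs, mul_comm s |c i|]
        have := abs_roundErr_le (ha i) (ditherOf_nonneg w (z i)) (ditherOf_lt_one w (z i))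
        have h2 : s * |roundErr (a i) (ditherOf w (z i))| ≤ s := mul_le_of_le_one_right hs.le this
        exact mul_le_mul_of_nonneg_left h2 (abs_nonneg _)
      have h2 : (s * ∑ i, |c i|) ^ 2 < (ε / 8) ^ 2 := by
        have h3 : (s * ∑ i, |c i|) ^ 2 ≤ s ^ 2 * (6 * D) := by rw [mul_pow]; gcongr
        have h4 : 0 < ε ^ 2 := by positivity
        nlinarith
      have h3 := lt_of_pow_lt_pow_left₀ 2 (by positivity) h2
      linarith
    refine le_trans (le_of_eq ?_) (by positivity : (0 : ℝ) ≤ 2 * Real.exp (-(8 * lambda)))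
    unfold prob
    simp [hzero]
  set m : Fin D → ℝ := fun i => 𝔼 z : Fin w → Bool, roundErr (a i) (ditherOf w z) with hm
  have hP : (0 : ℝ) < 2 ^ w := by positivity
  have hmP : ∀ i, |m i| ≤ 1 / 2 ^ w := by
    intro i
    have h1 : ∑ z : Fin w → Bool, roundErr (a i) (ditherOf w z) =
        ∑ j ∈ range (2 ^ w), roundErr (a i) (j / (2 ^ w : ℕ)) :=
      sum_bits w fun j => roundErr (a i) (j / (2 ^ w : ℕ))
    simp only [hm]
    rw [Fintype.expect_eq_sum_div_card, h1, abs_div]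
    simp only [Fintype.card_fun, Fintype.card_bool, Fintype.card_fin, Nat.cast_pow,
      Nat.cast_ofNat, abs_of_pos hP]
    have := abs_sum_roundErr_le (ha i) (P := 2 ^ w) (by positivity)
    push_cast at this
    gcongr
  have hm1 : ∀ i, |m i| ≤ 1 := fun i => (hmP i).trans (by
    rw [div_le_one hP]; exact one_le_pow₀ (by norm_num))
  -- The dithers have only w bits, which leaves a bias of at most s/2^w per coordinate. As √D ≤ 2^w,
  -- Cauchy-Schwarz bounds the total bias by 3s.
  have hbias : |∑ i, c i * (η i * s * m i)| ≤ ε / 16 := by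
    have h1 : |∑ i, c i * (η i * s * m i)| ≤ s / 2 ^ w * ∑ i, |c i| := by
      rw [mul_sum]
      refine (abs_sum_le_sum_abs _ _).trans (sum_le_sum fun i _ => ?_)
      rw [abs_mul, abs_mul, abs_mul, hη, one_mul, abs_of_pos hs, mul_comm (s / 2 ^ w)]
      refine mul_le_mul_of_nonneg_left ?_ (abs_nonneg _)
      calc s * |m i| ≤ s * (1 / 2 ^ w) := by gcongr; exact hmP i
        _ = _ := by ring
    have h2 : ∑ i, |c i| ≤ 3 * 2 ^ w := by
      refine le_of_sq_le_sq ?_ (by positivity)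
      nlinarith
    calc _ ≤ s / 2 ^ w * ∑ i, |c i| := h1
      _ ≤ s / 2 ^ w * (3 * 2 ^ w) := by gcongr
      _ = 3 * s := by field_simp
      _ ≤ _ := by linarith
  -- Applied to the centered errors, each of size at most 2s |c i|. The remaining deviation ε/16
  -- gives the exponent ε²/(12288 s²), well above 8·lambda.
  have hh := hoeffding (J := Fin D) (α := Fin w → Bool)
    (f := fun i z => c i * (η i * s * (roundErr (a i) (ditherOf w z) - m i)))
    (B := fun i => |c i| * (2 * s)) (S := 6 * (2 * s) ^ 2) (r := ε / 16)
    (fun i z => ?_) (fun i => ?_) ?_ (by positivity) (by positivity)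
  · refine (prob_mono fun z hz => ?_).trans (hh.trans ?_)
    · have e : ∑ i, c i * (η i * s * roundErr (a i) (ditherOf w (z i))) =
          ∑ i, c i * (η i * s * (roundErr (a i) (ditherOf w (z i)) - m i)) +
          ∑ i, c i * (η i * s * m i) := by
        rw [← sum_add_distrib]
        exact sum_congr rfl fun i _ => by ring
      rw [e] at hz
      have := abs_add_le (∑ i, c i * (η i * s * (roundErr (a i) (ditherOf w (z i)) - m i)))
        (∑ i, c i * (η i * s * m i))
      linarith
    · gcongr
      rw [le_div_iff₀ (by positivity)]
      nlinarith [sq_nonneg s]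
  · rw [abs_mul, abs_mul, abs_mul, hη, one_mul, abs_of_pos hs, mul_comm 2 s]
    have h1 := abs_roundErr_le (ha i) (ditherOf_nonneg w z) (ditherOf_lt_one w z)
    have h2 := abs_sub (roundErr (a i) (ditherOf w z)) (m i)
    have h3 := hm1 i
    gcongr
    linarith
  · rw [← mul_sum, ← mul_sum, sum_sub_distrib]
    simp only [hm]
    rw [Fintype.expect_eq_sum_div_card]
    simp
    right; right
    field_simp
    simp
  · simp only [mul_pow, sq_abs]
    rw [← sum_mul]
    gcongr

end DistanceSketch

namespace DistanceSketch

/-! ## The error of the algorithm, in terms of independent blocks of bits -/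

open Finset

open scoped BigOperators

/-- The shared random bits that are used. -/
abbrev SharedBits (l k : ℕ) (ε : ℝ) : Type :=
  (Fin (2 ^ log2ceil k) → Bool) ×
    ((Fin (dim l k ε) → Fin (16 * l * (16 * l)) → Fin (log2ceil k) → Bool) ×
      (Fin (dim l k ε) → Fin (16 * l * (16 * l)) → Bool))

/-- The private random bits of a point that are used. -/
abbrev PrivateBits (l k : ℕ) (ε : ℝ) : Type :=
  Fin (dim l k ε) → Fin (log2ceil (rootDim l k ε)) → Bool

/-- The Walsh-Hadamard transform of a vector with random signs. -/
noncomputable def mixedOf (p : ℕ) (f : Fin (2 ^ p) → Bool) (x : ℕ → ℝ) (i : ℕ) : ℝ :=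
  ∑ j, sgn (f j) * (x j * hadamardCoeff p i j)

theorem sum_mixedOf_mul (p : ℕ) (f : Fin (2 ^ p) → Bool) (x y : ℕ → ℝ) :
    ∑ i ∈ range (2 ^ p), mixedOf p f x i * mixedOf p f y i =
      2 ^ p * ∑ i ∈ range (2 ^ p), x i * y i := by
  have key : ∀ x : ℕ → ℝ, ∀ i ∈ range (2 ^ p), mixedOf p f x i =
      mixed p (fun i => if h : i < 2 ^ p then f ⟨i, h⟩ else false) x i := by
    intro x i hi
    rw [mixed_eq_sum p _ x (mem_range.1 hi)]
    simp [mixedOf]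
  rw [← sum_mixed_mul p fun i => if h : i < 2 ^ p then f ⟨i, h⟩ else false]
  exact sum_congr rfl fun i hi => by rw [key x i hi, key y i hi]

theorem expect_mixedOf_mul (p : ℕ) (f : Fin (2 ^ p) → Bool) (x y : ℕ → ℝ) :
    𝔼 z, mixedOf p f x (bitsEquiv p z) * mixedOf p f y (bitsEquiv p z) =
      ∑ i ∈ range (2 ^ p), x i * y i := by
  rw [Fintype.expect_eq_sum_div_card,
    sum_bits p fun i => mixedOf p f x i * mixedOf p f y i, sum_mixedOf_mul]
  simp

/-- The projection of a point. -/
noncomputable def projOf (l k : ℕ) (ε : ℝ) (ω : SharedBits l k ε) (x : ℕ → ℝ)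
    (j : Fin (dim l k ε)) : ℝ :=
  sampleSum (fun z => mixedOf (log2ceil k) ω.1 x (bitsEquiv _ z)) (16 * l : ℕ) (ω.2.1 j) (ω.2.2 j) /
    rootDim l k ε

/-- The point that is rounded. -/
noncomputable def embeddedOf (l k : ℕ) (ε : ℝ) (ω : SharedBits l k ε) (x : ℕ → ℝ)
    (j : Fin (dim l k ε)) : ℝ :=
  if rootDim l k ε * rootDim l k ε < k then projOf l k ε ω x j else x j

/-- A point of the unit ball, followed by zeros. -/
structure InBall (k : ℕ) (x : ℕ → ℝ) : Prop where
  zero : ∀ i, k ≤ i → x i = 0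
  sum_le : ∑ i ∈ range k, x i ^ 2 ≤ 1

theorem InBall.sum_eq {k N : ℕ} {x y : ℕ → ℝ} (hx : InBall k x) (hN : k ≤ N) :
    ∑ i ∈ range N, x i * y i = ∑ i ∈ range k, x i * y i :=
  (sum_subset (range_mono hN) fun i _ hi => by
    rw [hx.zero i (by simpa using hi), zero_mul]).symm

variable {l k : ℕ} {ε : ℝ}

/-- The random signs flatten both vectors except with probability 4·2^l·exp(-8l), by a union bound
over at most 2^l entries of each. Sampling flat vectors then fails with probability at most
6·2^l·exp(-8l). Choosing τ and the bound for the squared entries both as 16l makes τ²/L = 16l in the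
Chernoff term. -/
theorem prob_projOf_le (h : Admissible l k ε) (hp : rootDim l k ε * rootDim l k ε < k)
    {x x' : ℕ → ℝ} (hx : InBall k x) (hx' : InBall k x') :
    prob (fun ω : SharedBits l k ε => 3 * ε / 16 ≤
      |∑ j, projOf l k ε ω x j * projOf l k ε ω x' j - ∑ i ∈ range k, x i * x' i|) ≤
      10 * (2 ^ l * Real.exp (-(8 * l))) := by
  have hε := h.hε
  have hε' := h.hε'
  have hl0 : (7 : ℝ) ≤ l := by exact_mod_cast h.hl
  have hD : dim l k ε = rootDim l k ε * rootDim l k ε := if_pos hp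
  have hD1 := h.dim_pos
  have he : (0 : ℝ) < rootDim l k ε := by exact_mod_cast h.rootDim_pos
  have hkl := h.hproj hp
  have hpl : log2ceil k ≤ l := log2ceil_le hkl
  have hpk := log2ceil_spec k
  set p := log2ceil k with hpdef
  have hx2 : ∀ {x : ℕ → ℝ}, InBall k x → ∑ i ∈ range (2 ^ p), x i ^ 2 ≤ 1 := by
    intro x hx
    simp only [pow_two]
    rw [hx.sum_eq hpk]
    simpa only [pow_two] using hx.sum_le
  have hDε : 2 ^ 24 * (l : ℝ) ≤ ε ^ 2 * dim l k ε := by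
    rcases rootDim_spec l k ε with h1 | h1
    · omega
    · rw [hD]; push_cast; rw [pow_two]; exact h1
  have hDl : (dim l k ε : ℝ) ≤ 2 ^ l := by
    have : dim l k ε ≤ 2 ^ l := by omega
    exact_mod_cast this
  have hτ : ((16 * l : ℕ) : ℝ) = 16 * l := by push_cast; ring
  have hL : (0 : ℝ) < (16 * l : ℕ) := by rw [hτ]; linarith
  have hflat : ∀ {x : ℕ → ℝ}, InBall k x →
      prob (fun f : Fin (2 ^ p) → Bool => ∃ i : Fin (2 ^ p), √(16 * l : ℕ) ≤ |mixedOf p f x i|) ≤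
      2 ^ l * (2 * Real.exp (-(8 * l))) := by
    intro x hx
    refine (prob_exists_le (E := fun (i : Fin (2 ^ p)) f => √(16 * l : ℕ) ≤ |mixedOf p f x i|)
      fun i => prob_flatten_le p (hx2 hx) (Real.sqrt_nonneg _) i.2).trans ?_
    rw [Real.sq_sqrt hL.le, hτ, show (16 * l / 2 : ℝ) = 8 * l by ring, Fintype.card_fin]
    push_cast
    gcongr
    norm_num
  refine (prob_prod_le_add (F := fun f => (∃ i : Fin (2 ^ p), √(16 * l : ℕ) ≤ |mixedOf p f x i|) ∨
    ∃ i : Fin (2 ^ p), √(16 * l : ℕ) ≤ |mixedOf p f x' i|)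
    (p := 6 * (2 ^ l * Real.exp (-(8 * l)))) (by positivity) fun f hf => ?_).trans
    (add_le_add_left ((prob_or_le _ _).trans (add_le_add (hflat hx) (hflat hx'))) _ |>.trans
      (by linarith))
  simp only [not_or, not_exists, not_le] at hf
  have hsq : ∀ {x : ℕ → ℝ}, (∀ i : Fin (2 ^ p), |mixedOf p f x i| < √(16 * l : ℕ)) →
      ∀ z, mixedOf p f x (bitsEquiv p z) ^ 2 ≤ (16 * l : ℕ) := by
    intro x hx z
    rw [← sq_abs, ← Real.sq_sqrt hL.le]
    exact pow_le_pow_left₀ (abs_nonneg _) (hx _).le 2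
  have hmean : ∀ {x : ℕ → ℝ}, InBall k x → 𝔼 z, mixedOf p f x (bitsEquiv p z) ^ 2 ≤ 1 := by
    intro x hx
    have := hx2 hx
    simp only [pow_two] at this ⊢
    rw [expect_mixedOf_mul]
    exact this
  have main := prob_sampleSum_le (J := Fin (dim l k ε)) (Θ := Fin (16 * l * (16 * l)))
    (τ := (16 * l : ℕ)) hL (hsq hf.1)
    (hsq hf.2) (hmean hx) (hmean hx') (by rw [Fintype.card_fin]; exact hD1) hL (by simp [pow_two]) hε (by linarith)
  refine (prob_mono fun ω hω => ?_).trans (main.trans ?_)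
  · simp only [projOf] at hω
    have e1 : ∀ y y' : Fin (dim l k ε) → ℝ, ∑ j, y j / rootDim l k ε * (y' j / rootDim l k ε) =
        (∑ j, y j * y' j) / dim l k ε := by
      intro y y'
      rw [sum_div]
      refine sum_congr rfl fun j _ => ?_
      rw [hD, div_mul_div_comm, Nat.cast_mul]
    have hD0 : (0 : ℝ) < dim l k ε := by exact_mod_cast hD1
    rw [e1] at hω
    rw [expect_mixedOf_mul, hx.sum_eq hpk, Fintype.card_fin]
    refine (mul_le_mul_of_nonneg_left hω hD0.le).trans (le_of_eq ?_)
    rw [← abs_of_pos hD0, ← abs_mul, abs_of_pos hD0]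
    congr 1
    field_simp
    rfl
  · rw [Fintype.card_fin, show ((16 * l : ℕ) : ℝ) ^ 2 / (16 * l : ℕ) = (16 * l : ℕ) by
      field_simp, hτ]
    -- As ε²D ≥ 2^24 l, the last two exponents are at least 8192l and 12l. The Chernoff term has
    -- exponent 16l, and its factor D is at most 2^l.
    have e1 : (dim l k ε : ℝ) * (16 * l) ^ 2 * (ε / 16) ^ 2 / (8 * (16 * l) ^ 2) =
        ε ^ 2 * dim l k ε / 2048 := by
      field_simp
      ring
    rw [e1]
    have hE : Real.exp (-(8 * l : ℝ)) ≤ 1 := by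
      rw [Real.exp_le_one_iff]; linarith
    have h2l : (1 : ℝ) ≤ 2 ^ l := one_le_pow₀ (by norm_num)
    have t1 : (dim l k ε : ℝ) * Real.exp (-(16 * l)) ≤ 2 ^ l * Real.exp (-(8 * l)) := by
      gcongr
      linarith
    have t2 : Real.exp (-(ε ^ 2 * dim l k ε / 2048)) ≤ 2 ^ l * Real.exp (-(8 * l)) := by
      refine le_trans ?_ (le_mul_of_one_le_left (Real.exp_pos _).le h2l)
      gcongr
      linarith
    have t3 : Real.exp (-(dim l k ε * (ε / 8) ^ 2 / 20480)) ≤ 2 ^ l * Real.exp (-(8 * l)) := by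
      refine le_trans ?_ (le_mul_of_one_le_left (Real.exp_pos _).le h2l)
      gcongr
      linarith
    linarith

theorem prob_embeddedOf_le (h : Admissible l k ε) {x x' : ℕ → ℝ} (hx : InBall k x)
    (hx' : InBall k x') :
    prob (fun ω : SharedBits l k ε => 3 * ε / 16 ≤
      |∑ j, embeddedOf l k ε ω x j * embeddedOf l k ε ω x' j - ∑ i ∈ range k, x i * x' i|) ≤
      10 * (2 ^ l * Real.exp (-(8 * l))) := by
  by_cases hp : rootDim l k ε * rootDim l k ε < k
  · simp only [embeddedOf, hp, if_true]
    exact prob_projOf_le h hp hx hx'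
  · have hD : dim l k ε = k := if_neg hp
    have hε := h.hε
    have : ∀ ω : SharedBits l k ε, ¬ 3 * ε / 16 ≤
        |∑ j, embeddedOf l k ε ω x j * embeddedOf l k ε ω x' j - ∑ i ∈ range k, x i * x' i| := by
      intro ω
      simp only [embeddedOf, hp, if_false]
      rw [Fin.sum_univ_eq_sum_range (fun i => x i * x' i), hD, sub_self, abs_zero, not_le]
      positivity
    refine le_trans (le_of_eq ?_) (by positivity :
      (0 : ℝ) ≤ 10 * (2 ^ l * Real.exp (-(8 * l))))
    unfold prob
    simp [this]

/-! ### Parameters of the rounding -/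

theorem Admissible.rootDim_sq_le_dim (h : Admissible l k ε) :
    rootDim l k ε * rootDim l k ε ≤ 4 * dim l k ε := by
  have := h.rootDim_sq_le
  unfold dim
  split_ifs <;> omega

theorem Admissible.fine_mul (h : Admissible l k ε) :
    2 ^ 13 * fine l k ε * rootMin l (dim l k ε) = ε := by
  have : (0 : ℝ) < rootMin l (dim l k ε) := by exact_mod_cast h.rootMin_pos
  unfold fine
  field_simp

theorem Admissible.fine_le (h : Admissible l k ε) : 2 ^ 13 * fine l k ε ≤ ε := by
  have h1 : (1 : ℝ) ≤ rootMin l (dim l k ε) := by exact_mod_cast h.rootMin_pos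
  have h2 := h.fine_pos
  have h3 := h.fine_mul
  nlinarith

/-- The square of `rootMin` is at least D or at least l. These are the two cases of
`prob_rounding_le`. -/
theorem Admissible.fine_or (h : Admissible l k ε) :
    dim l k ε * (2 ^ 13 * fine l k ε) ^ 2 ≤ ε ^ 2 ∨ l * (2 ^ 13 * fine l k ε) ^ 2 ≤ ε ^ 2 := by
  have h3 := h.fine_mul
  have key : ∀ m : ℕ, m ≤ rootMin l (dim l k ε) * rootMin l (dim l k ε) →
      (m : ℝ) * (2 ^ 13 * fine l k ε) ^ 2 ≤ ε ^ 2 := by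
    intro m hm
    have hm' : (m : ℝ) ≤ rootMin l (dim l k ε) * rootMin l (dim l k ε) := by exact_mod_cast hm
    calc (m : ℝ) * (2 ^ 13 * fine l k ε) ^ 2 ≤
          rootMin l (dim l k ε) * rootMin l (dim l k ε) * (2 ^ 13 * fine l k ε) ^ 2 := by gcongr
      _ = (2 ^ 13 * fine l k ε * rootMin l (dim l k ε)) ^ 2 := by ring
      _ = ε ^ 2 := by rw [h3]
  exact (rootMin_spec l (dim l k ε)).imp (key _) (key _)

/-- The converse of the search condition: the predecessor of the root violates it, and doubling
costs a factor of four. -/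
theorem Admissible.rootDim_sq_mul_le (h : Admissible l k ε) :
    ε ^ 2 * (rootDim l k ε * rootDim l k ε) ≤ 2 ^ 26 * (l : ℝ) := by
  have hl0 : (7 : ℝ) ≤ l := by exact_mod_cast h.hl
  have hε := h.hε
  have hε' := h.hε'
  rcases Nat.lt_or_ge 1 (rootDim l k ε) with h1 | h1
  · have h2 := (of_lt_rootDim (l := l) (k := k) (ε := ε) (i := rootDim l k ε - 1) (by omega)).2
    have h3 : (2 : ℝ) ≤ rootDim l k ε := by exact_mod_cast h1
    rw [Nat.cast_sub h1.le, Nat.cast_one] at h2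
    have h4 : (rootDim l k ε * rootDim l k ε : ℝ) ≤
        4 * ((rootDim l k ε - 1) * (rootDim l k ε - 1)) := by nlinarith
    calc ε ^ 2 * (rootDim l k ε * rootDim l k ε) ≤
          ε ^ 2 * (4 * ((rootDim l k ε - 1) * (rootDim l k ε - 1))) := by gcongr
      _ ≤ _ := by nlinarith
  · have h3 : (rootDim l k ε : ℝ) ≤ 1 := by exact_mod_cast h1
    have h4 : (rootDim l k ε * rootDim l k ε : ℝ) ≤ 1 := mul_le_one₀ h3 (by positivity) h3
    nlinarith

/-- Rounding moves a point by at most s√D ≤ 1. The rounded point therefore still has bounded norm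
when it serves as the coefficient vector for the rounding errors of the other point. -/
theorem Admissible.dim_mul_fine_sq_le (h : Admissible l k ε) :
    dim l k ε * fine l k ε ^ 2 ≤ 1 := by
  have hε := h.hε
  have hε' := h.hε'
  have hε2 : ε ^ 2 ≤ 1 := by nlinarith
  rcases h.fine_or with h1 | h1
  · nlinarith
  · have h2 : (dim l k ε : ℝ) ≤ rootDim l k ε * rootDim l k ε := by
      exact_mod_cast dim_le_sq l k ε
    have h3 := h.rootDim_sq_mul_le
    have h4 : ε ^ 2 * dim l k ε ≤ 2 ^ 26 * (l : ℝ) :=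
      (mul_le_mul_of_nonneg_left h2 (sq_nonneg ε)).trans h3
    have h5 : 0 < ε ^ 2 := by positivity
    have h6 : ε ^ 2 * (dim l k ε * fine l k ε ^ 2) ≤ ε ^ 2 * 1 := by
      calc ε ^ 2 * (dim l k ε * fine l k ε ^ 2) = ε ^ 2 * dim l k ε * fine l k ε ^ 2 := by ring
        _ ≤ 2 ^ 26 * (l : ℝ) * fine l k ε ^ 2 := by gcongr
        _ = l * (2 ^ 13 * fine l k ε) ^ 2 := by ring
        _ ≤ ε ^ 2 * 1 := by rw [mul_one]; exact h1
    exact le_of_mul_le_mul_left h6 h5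

/-- With T = 1/e, each floor is at most e|y| ≤ e²y²/6 + 3/2. As e² ≤ 4D and ∑ y² ≤ 2, the
coordinates need at most 4D/3 + 3D/2 digits, and the norm at most e ≤ D more. -/
theorem Admissible.sum_floor_le (h : Admissible l k ε) {y : ℕ → ℝ}
    (hy : ∑ i ∈ range (dim l k ε), y i ^ 2 ≤ 2) (hy' : |y (dim l k ε)| ≤ 1) :
    ∑ i ∈ range (dim l k ε + 1), ⌊|y i| / coarse l k ε⌋₊ ≤ 4 * (dim l k ε + 1) := by
  set D := dim l k ε
  have he : (rootDim l k ε * rootDim l k ε : ℝ) ≤ 4 * D := by exact_mod_cast h.rootDim_sq_le_dim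
  have he' : (rootDim l k ε : ℝ) ≤ D := by exact_mod_cast rootDim_le_dim l k ε
  set e := (rootDim l k ε : ℝ)
  have he0 : 0 ≤ e := Nat.cast_nonneg _
  have hfl : ∀ i, (⌊|y i| / coarse l k ε⌋₊ : ℝ) ≤ e * |y i| := by
    intro i
    refine (Nat.floor_le (div_nonneg (abs_nonneg _) h.coarse_pos.le)).trans (le_of_eq ?_)
    unfold coarse
    rw [div_div_eq_mul_div, div_one, mul_comm]
  have h1 : ∑ i ∈ range D, (⌊|y i| / coarse l k ε⌋₊ : ℝ) ≤
      ∑ i ∈ range D, (e * e * (1 / 6) * y i ^ 2 + 3 / 2) := by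
    refine sum_le_sum fun i _ => (hfl i).trans ?_
    rw [← sq_abs (y i)]
    nlinarith [sq_nonneg (e * |y i| - 3)]
  rw [sum_add_distrib, ← mul_sum, sum_const, card_range, nsmul_eq_mul] at h1
  have h2 : e * e * (1 / 6) * ∑ i ∈ range D, y i ^ 2 ≤ 4 * D * (1 / 6) * 2 := by
    have : 0 ≤ ∑ i ∈ range D, y i ^ 2 := sum_nonneg fun _ _ => sq_nonneg _
    gcongr
  have h3 : (⌊|y D| / coarse l k ε⌋₊ : ℝ) ≤ e := (hfl D).trans (by nlinarith)
  have h4 : ((∑ i ∈ range (D + 1), ⌊|y i| / coarse l k ε⌋₊ : ℕ) : ℝ) ≤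
      ((4 * (D + 1) : ℕ) : ℝ) := by
    rw [sum_range_succ]
    push_cast
    have : (0 : ℝ) ≤ D := Nat.cast_nonneg _
    linarith
  exact_mod_cast h4

end DistanceSketch

namespace DistanceSketch

/-! ### The failure event of a pair of points and its probability. -/

open Finset

open scoped BigOperators

variable {l k : ℕ} {ε : ℝ}

/-- The error that results from rounding `y` with the dither `u`. -/
noncomputable def coordErr (T s y u : ℝ) : ℝ :=
  (if y < 0 then -1 else 1) * s * roundErr (residue T s y) u

theorem abs_ite_sign (y : ℝ) : |(if y < 0 then -1 else 1 : ℝ)| = 1 := by split_ifs <;> simp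

theorem abs_coordErr_le {T s y u : ℝ} (hT : 0 < T) (hs : 0 < s) (hu : 0 ≤ u) (hu' : u < 1) :
    |coordErr T s y u| ≤ s := by
  unfold coordErr
  rw [abs_mul, abs_mul, abs_ite_sign, one_mul, abs_of_pos hs]
  exact mul_le_of_le_one_right hs.le (abs_roundErr_le (residue_nonneg hT hs y) hu hu')

/-- The inner product of `x` and `x'` is not preserved. -/
def Distorted (l k : ℕ) (ε : ℝ) (x x' : ℕ → ℝ) (ω : SharedBits l k ε) : Prop :=
  3 * ε / 16 ≤
    |∑ j, embeddedOf l k ε ω x j * embeddedOf l k ε ω x' j - ∑ i ∈ range k, x i * x' i|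

/-- The distance of `x` and `x'` is possibly not recovered. -/
def Fails (l k : ℕ) (ε : ℝ) (x x' : ℕ → ℝ)
    (z : SharedBits l k ε × PrivateBits l k ε × PrivateBits l k ε) : Prop :=
  ((Distorted l k ε x x' z.1 ∨ Distorted l k ε x x z.1) ∨ Distorted l k ε x' x' z.1) ∨
  -- From (x + e)(x' + e') = xx' + x'e + (x + e)e': each error term is a combination of the rounding
  -- errors of one point with coefficients that do not depend on its dithers.
  ε / 8 ≤ |∑ j, embeddedOf l k ε z.1 x' j *
    coordErr (coarse l k ε) (fine l k ε) (embeddedOf l k ε z.1 x j) (ditherOf _ (z.2.1 j))| ∨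
  ε / 8 ≤ |∑ j, (embeddedOf l k ε z.1 x j +
    coordErr (coarse l k ε) (fine l k ε) (embeddedOf l k ε z.1 x j) (ditherOf _ (z.2.1 j))) *
    coordErr (coarse l k ε) (fine l k ε) (embeddedOf l k ε z.1 x' j) (ditherOf _ (z.2.2 j))|

theorem sum_sq_le_of_not_distorted (h : Admissible l k ε) {x : ℕ → ℝ} (hx : InBall k x)
    {ω : SharedBits l k ε} (hω : ¬ Distorted l k ε x x ω) :
    ∑ j, embeddedOf l k ε ω x j ^ 2 ≤ 2 := by
  have h1 := hx.sum_le
  have h2 := h.hε'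
  simp only [Distorted, not_le, ← pow_two] at hω
  have := (abs_lt.1 hω).2
  linarith

theorem prob_coordErr_le (h : Admissible l k ε) {c : Fin (dim l k ε) → ℝ} (hc : ∑ i, c i ^ 2 ≤ 6)
    (y : Fin (dim l k ε) → ℝ) :
    prob (fun z : PrivateBits l k ε => ε / 8 ≤ |∑ j, c j *
      coordErr (coarse l k ε) (fine l k ε) (y j) (ditherOf _ (z j))|) ≤
      2 * Real.exp (-(8 * l)) := by
  refine prob_rounding_le h.fine_pos h.hε hc (fun i => abs_ite_sign (y i))
    (fun i => residue_nonneg h.coarse_pos h.fine_pos (y i)) ?_ h.fine_le h.fine_or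
  have h1 := dim_le_sq l k ε
  have h2 := log2ceil_spec (rootDim l k ε)
  have h3 : dim l k ε ≤ (2 ^ log2ceil (rootDim l k ε)) ^ 2 := by
    rw [pow_two]
    exact h1.trans (Nat.mul_le_mul h2 h2)
  exact_mod_cast h3

/-- Three inner products, two of them squared norms, contribute 10 each. Undistorted norms bound the
coefficients, and the two rounding errors contribute 2 each. -/
theorem prob_fails_le (h : Admissible l k ε) {x x' : ℕ → ℝ} (hx : InBall k x)
    (hx' : InBall k x') :
    prob (Fails l k ε x x') ≤ 34 * (2 ^ l * Real.exp (-(8 * l))) := by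
  have h1 := prob_embeddedOf_le h hx hx'
  have h2 := prob_embeddedOf_le h hx hx
  have h3 := prob_embeddedOf_le h hx' hx'
  have h2l : (1 : ℝ) ≤ 2 ^ l := one_le_pow₀ (by norm_num)
  have hE := le_mul_of_one_le_left (Real.exp_pos (-(8 * l))).le h2l
  set F : SharedBits l k ε → Prop := fun ω => (Distorted l k ε x x' ω ∨ Distorted l k ε x x ω) ∨
    Distorted l k ε x' x' ω with hF
  have h4 : prob F ≤ 30 * (2 ^ l * Real.exp (-(8 * l))) := by
    have e1 := prob_or_le (Distorted l k ε x x') (Distorted l k ε x x)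
    have e2 := prob_or_le (fun ω => Distorted l k ε x x' ω ∨ Distorted l k ε x x ω)
      (Distorted l k ε x' x')
    change prob (Distorted l k ε x x') ≤ _ at h1
    change prob (Distorted l k ε x x) ≤ _ at h2
    change prob (Distorted l k ε x' x') ≤ _ at h3
    exact e2.trans (by linarith)
  have h5 : prob (Fails l k ε x x') ≤ prob F + 4 * Real.exp (-(8 * l)) := by
    refine prob_prod_le_add (by positivity) fun ω hω => ?_
    unfold Fails
    simp only [hF] at hω
    simp only [hω, false_or]
    simp only [not_or] at hω
    have s1 := sum_sq_le_of_not_distorted h hx hω.1.2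
    have s2 := sum_sq_le_of_not_distorted h hx' hω.2
    refine (prob_or_le _ _).trans ?_
    have p1 := prob_coordErr_le h (c := embeddedOf l k ε ω x') (by linarith) (embeddedOf l k ε ω x)
    rw [← prob_fst (Ω' := PrivateBits l k ε)] at p1
    have p2 : prob (fun z : PrivateBits l k ε × PrivateBits l k ε =>
        ε / 8 ≤ |∑ j, (embeddedOf l k ε ω x j +
        coordErr (coarse l k ε) (fine l k ε) (embeddedOf l k ε ω x j) (ditherOf _ (z.1 j))) *
        coordErr (coarse l k ε) (fine l k ε) (embeddedOf l k ε ω x' j) (ditherOf _ (z.2 j))|) ≤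
        2 * Real.exp (-(8 * l)) := by
      -- Fixing the private bits of the first point fixes the coefficients x + e. This is where the
      -- privacy of the dithers is used.
      refine prob_prod_le fun U => ?_
      refine prob_coordErr_le h (c := fun j => embeddedOf l k ε ω x j +
        coordErr (coarse l k ε) (fine l k ε) (embeddedOf l k ε ω x j) (ditherOf _ (U j))) ?_
        (embeddedOf l k ε ω x')
      have hs := h.fine_pos
      calc _ ≤ ∑ j, (2 * embeddedOf l k ε ω x j ^ 2 + 2 * fine l k ε ^ 2) := by
            refine sum_le_sum fun j _ => ?_
            have e1 := abs_coordErr_le (y := embeddedOf l k ε ω x j) h.coarse_pos hs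
              (ditherOf_nonneg _ (U j)) (ditherOf_lt_one _ (U j))
            have e2 := sq_le_sq' (abs_le.1 e1).1 (abs_le.1 e1).2
            nlinarith [sq_nonneg (embeddedOf l k ε ω x j - coordErr (coarse l k ε) (fine l k ε)
              (embeddedOf l k ε ω x j) (ditherOf _ (U j)))]
        _ = 2 * ∑ j, embeddedOf l k ε ω x j ^ 2 + 2 * (dim l k ε * fine l k ε ^ 2) := by
            rw [sum_add_distrib, ← mul_sum, sum_const, card_univ, Fintype.card_fin, nsmul_eq_mul]
            ring
        _ ≤ 6 := by linarith [h.dim_mul_fine_sq_le]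
    exact (add_le_add p1 p2).trans (by linarith)
  linarith

/-- The distance is recovered unless the algorithm fails. -/
theorem abs_estimate_sub_le (h : Admissible l k ε) {x x' : ℕ → ℝ} (hx : InBall k x)
    (hx' : InBall k x') {z : SharedBits l k ε × PrivateBits l k ε × PrivateBits l k ε}
    (hz : ¬ Fails l k ε x x' z) {y y' u u' : ℕ → ℝ}
    (hy : ∀ j : Fin (dim l k ε), y j = embeddedOf l k ε z.1 x j)
    (hy' : ∀ j : Fin (dim l k ε), y' j = embeddedOf l k ε z.1 x' j)
    (hyD : y (dim l k ε) = ∑ i ∈ range k, x i ^ 2)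
    (hyD' : y' (dim l k ε) = ∑ i ∈ range k, x' i ^ 2)
    (hu : ∀ j : Fin (dim l k ε), u j = ditherOf _ (z.2.1 j))
    (hu' : ∀ j : Fin (dim l k ε), u' j = ditherOf _ (z.2.2 j))
    (hub : ∀ i, 0 ≤ u i ∧ u i < 1) (hub' : ∀ i, 0 ≤ u' i ∧ u' i < 1) :
    |estimate (coarse l k ε) (fine l k ε) (dim l k ε)
      (symbol (coarse l k ε) (fine l k ε) (fineBits (coarse l k ε) (fine l k ε)) y u
        (4 * (dim l k ε + 1)))
      (symbol (coarse l k ε) (fine l k ε) (fineBits (coarse l k ε) (fine l k ε)) y' u'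
        (4 * (dim l k ε + 1))) - ∑ i ∈ range k, (x i - x' i) ^ 2| ≤ ε := by
  have hT := h.coarse_pos
  have hs := h.fine_pos
  have hb := fineBits_spec (T := coarse l k ε) hs
  have hsε := h.fine_le
  have hε := h.hε
  simp only [Fails, not_or, Distorted, not_le] at hz
  obtain ⟨⟨⟨hz1, hz2⟩, hz3⟩, hz4, hz5⟩ := hz
  have s1 := sum_sq_le_of_not_distorted h hx (ω := z.1) (by simpa [Distorted] using hz2)
  have s2 := sum_sq_le_of_not_distorted h hx' (ω := z.1) (by simpa [Distorted] using hz3)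
  simp only [← hy, ← hy', ← hu, ← hu'] at s1 s2 hz1 hz4 hz5
  rw [Fin.sum_univ_eq_sum_range (fun i => y i ^ 2)] at s1
  rw [Fin.sum_univ_eq_sum_range (fun i => y' i ^ 2)] at s2
  rw [Fin.sum_univ_eq_sum_range (fun i => y i * y' i)] at hz1
  rw [Fin.sum_univ_eq_sum_range (fun i => y' i *
    coordErr (coarse l k ε) (fine l k ε) (y i) (u i))] at hz4
  rw [Fin.sum_univ_eq_sum_range (fun i => (y i + coordErr (coarse l k ε) (fine l k ε) (y i) (u i)) *
    coordErr (coarse l k ε) (fine l k ε) (y' i) (u' i))] at hz5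
  have hval : ∀ {x y u : ℕ → ℝ}, InBall k x → ∑ i ∈ range (dim l k ε), y i ^ 2 ≤ 2 →
      y (dim l k ε) = ∑ i ∈ range k, x i ^ 2 → (∀ i, 0 ≤ u i ∧ u i < 1) →
      ∀ i ≤ dim l k ε, symbolVal (coarse l k ε) (fine l k ε) (symbol (coarse l k ε) (fine l k ε)
        (fineBits (coarse l k ε) (fine l k ε)) y u (4 * (dim l k ε + 1)) i) =
        y i + coordErr (coarse l k ε) (fine l k ε) (y i) (u i) := by
    intro x y u hx hy hyD hu i hi
    refine symbolVal_symbol hT hs hb (hu i).2 (floor_le_budget (h.sum_floor_le hy ?_)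
      (Nat.lt_succ_of_le hi))
    rw [hyD, abs_of_nonneg (sum_nonneg fun _ _ => sq_nonneg _)]
    exact hx.sum_le
  have v1 := hval hx s1 hyD hub
  have v2 := hval hx' s2 hyD' hub'
  have e1 := abs_le.1 (abs_coordErr_le (y := y (dim l k ε)) hT hs (hub (dim l k ε)).1 (hub _).2)
  have e2 := abs_le.1 (abs_coordErr_le (y := y' (dim l k ε)) hT hs (hub' (dim l k ε)).1 (hub' _).2)
  unfold estimate
  rw [v1 _ le_rfl, v2 _ le_rfl, sum_congr rfl fun i hi => by
    rw [v1 i (mem_range.1 hi).le, v2 i (mem_range.1 hi).le], hyD, hyD']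
  rw [hyD] at e1
  rw [hyD'] at e2
  have e3 : ∑ i ∈ range (dim l k ε), (y i + coordErr (coarse l k ε) (fine l k ε) (y i) (u i)) *
      (y' i + coordErr (coarse l k ε) (fine l k ε) (y' i) (u' i)) =
      ∑ i ∈ range (dim l k ε), y i * y' i +
      ∑ i ∈ range (dim l k ε), y' i * coordErr (coarse l k ε) (fine l k ε) (y i) (u i) +
      ∑ i ∈ range (dim l k ε), (y i + coordErr (coarse l k ε) (fine l k ε) (y i) (u i)) *
        coordErr (coarse l k ε) (fine l k ε) (y' i) (u' i) := by
    rw [← sum_add_distrib, ← sum_add_distrib]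
    exact sum_congr rfl fun i _ => by ring
  have e4 : ∑ i ∈ range k, (x i - x' i) ^ 2 = ∑ i ∈ range k, x i ^ 2 + ∑ i ∈ range k, x' i ^ 2 -
      2 * ∑ i ∈ range k, x i * x' i := by
    rw [mul_sum, ← sum_add_distrib, ← sum_sub_distrib]
    exact sum_congr rfl fun i _ => by ring
  rw [e3, e4]
  have a1 := abs_lt.1 hz1
  have a2 := abs_lt.1 hz4
  have a3 := abs_lt.1 hz5
  -- The inner product is off by at most 3ε/16 + ε/8 + ε/8 and enters twice, which gives 7ε/8. The
  -- two rounded norms add at most 2s ≤ ε/2^12.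
  rw [abs_le]
  constructor <;> linarith

/-! ### The blocks of bits -/

/-- The blocks of the shared bits. -/
noncomputable def sharedBits (l k : ℕ) (ε : ℝ) (f : ℕ → Bool) : SharedBits l k ε :=
  (fun j => f j, fun j i b => f (2 ^ log2ceil k + (j * (16 * l * (16 * l)) + i) * log2ceil k + b),
    fun j i => f (2 ^ log2ceil k + dim l k ε * (16 * l * (16 * l)) * log2ceil k +
      (j * (16 * l * (16 * l)) + i)))

/-- The blocks of the private bits. -/
noncomputable def privateBits (l k : ℕ) (ε : ℝ) (f : ℕ → Bool) : PrivateBits l k ε :=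
  fun j b => f (j * log2ceil (rootDim l k ε) + b)

theorem dither_eq (l k : ℕ) (ε : ℝ) (f : ℕ → Bool) (j : Fin (dim l k ε)) :
    dither (log2ceil (rootDim l k ε)) f j = ditherOf _ (privateBits l k ε f j) := by
  unfold dither ditherOf privateBits
  rw [bitsEquiv_apply]
  simp

theorem dither_nonneg (w : ℕ) (f : ℕ → Bool) (i : ℕ) : 0 ≤ dither w f i := by
  unfold dither; positivity

theorem dither_lt_one (w : ℕ) (f : ℕ → Bool) (i : ℕ) : dither w f i < 1 := by
  unfold dither
  rw [div_lt_one (by positivity)]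
  exact_mod_cast bitsVal_lt f (i * w) w

theorem projection_eq (l k : ℕ) (ε : ℝ) (f : ℕ → Bool) (x : ℕ → ℝ) (j : Fin (dim l k ε)) :
    projection (log2ceil k) (dim l k ε) (16 * l) (rootDim l k ε) f x j =
      projOf l k ε (sharedBits l k ε f) x j := by
  unfold projection projOf sampleSum signSum
  rw [← Fin.sum_univ_eq_sum_range (fun i => sampleSign (log2ceil k)
    (dim l k ε * (16 * l * (16 * l))) f (j * (16 * l * (16 * l)) + i) *
    mixed (log2ceil k) f x (sampleIndex (log2ceil k) f (j * (16 * l * (16 * l)) + i))),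
    Nat.cast_mul, ← div_div, sum_div]
  congr 1
  refine sum_congr rfl fun i _ => ?_
  rw [mul_div_assoc]
  congr 2
  rw [sampleIndex, mixed_eq_sum _ _ _ (bitsVal_lt _ _ _)]
  unfold mixedOf sharedBits
  simp only [bitsEquiv_apply]

theorem embedded_eq (l k : ℕ) (ε : ℝ) (f : ℕ → Bool) (x : ℕ → ℝ) (j : Fin (dim l k ε)) :
    embedded l k ε f x j = embeddedOf l k ε (sharedBits l k ε f) x j := by
  unfold embedded embeddedOf
  rw [if_pos j.2, projection_eq]

theorem embedded_dim (l k : ℕ) (ε : ℝ) (f : ℕ → Bool) (x : ℕ → ℝ) :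
    embedded l k ε f x (dim l k ε) = ∑ i ∈ range k, x i ^ 2 := by
  unfold embedded
  rw [if_neg (lt_irrefl _)]

theorem abs_recovered_sub_le (h : Admissible l k ε) {x x' : ℕ → ℝ} (hx : InBall k x)
    (hx' : InBall k x') {f g g' : ℕ → Bool}
    (hz : ¬ Fails l k ε x x' (sharedBits l k ε f, privateBits l k ε g, privateBits l k ε g')) :
    |recovered l k ε f g g' x x' - ∑ i ∈ range k, (x i - x' i) ^ 2| ≤ ε :=
  abs_estimate_sub_le h hx hx' hz (embedded_eq l k ε f x) (embedded_eq l k ε f x')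
    (embedded_dim l k ε f x) (embedded_dim l k ε f x') (dither_eq l k ε g) (dither_eq l k ε g')
    (fun i => ⟨dither_nonneg _ _ i, dither_lt_one _ _ i⟩)
    fun i => ⟨dither_nonneg _ _ i, dither_lt_one _ _ i⟩

/-- The places of the blocks of bits. -/
abbrev Places (K D t p w : ℕ) : Type :=
  (Fin K ⊕ (Fin D × Fin t × Fin p) ⊕ (Fin D × Fin t)) ⊕ (Fin D × Fin w) ⊕ (Fin D × Fin w)

def placesEquiv (K D t p w : ℕ) :
    (Places K D t p w → Bool) ≃ ((Fin K → Bool) × (Fin D → Fin t → Fin p → Bool) ×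
      (Fin D → Fin t → Bool)) × (Fin D → Fin w → Bool) × (Fin D → Fin w → Bool) where
  toFun z := ((fun a => z (.inl (.inl a)), fun a b c => z (.inl (.inr (.inl (a, b, c)))),
    fun a b => z (.inl (.inr (.inr (a, b))))), fun a b => z (.inr (.inl (a, b))),
    fun a b => z (.inr (.inr (a, b))))
  invFun z := Sum.elim (Sum.elim z.1.1 (Sum.elim (fun a => z.1.2.1 a.1 a.2.1 a.2.2)
    fun a => z.1.2.2 a.1 a.2)) (Sum.elim (fun a => z.2.1 a.1 a.2) fun a => z.2.2 a.1 a.2)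
  left_inv z := by
    ext a
    rcases a with (a | a | a) | a | a <;> rfl
  right_inv _ := rfl

/-- The place of a bit. -/
def place {n : ℕ} (i j : Fin n) (K D t p w : ℕ) : Places K D t p w → Option (Fin n) × ℕ :=
  Sum.elim (Sum.elim (fun a => (none, a)) (Sum.elim
    (fun a => (none, K + (a.1 * t + a.2.1) * p + a.2.2))
    fun a => (none, K + D * t * p + (a.1 * t + a.2))))
    (Sum.elim (fun a => (some i, a.1 * w + a.2)) fun a => (some j, a.1 * w + a.2))

theorem mul_add_inj {w a a' b b' : ℕ} (hb : b < w) (hb' : b' < w) (h : a * w + b = a' * w + b') :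
    a = a' ∧ b = b' := by
  have hw : 0 < w := by omega
  have h1 : (a * w + b) / w = a := by
    rw [mul_comm, Nat.mul_add_div hw, Nat.div_eq_of_lt hb, add_zero]
  have h2 : (a' * w + b') / w = a' := by
    rw [mul_comm, Nat.mul_add_div hw, Nat.div_eq_of_lt hb', add_zero]
  have h3 : a = a' := by rw [← h1, h, h2]
  subst h3
  exact ⟨rfl, by omega⟩

theorem mul_add_lt {w a b D : ℕ} (hb : b < w) (ha : a < D) : a * w + b < D * w := by
  calc a * w + b < a * w + w := by omega
    _ = (a + 1) * w := by ring
    _ ≤ D * w := Nat.mul_le_mul_right _ ha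

/-- All bits used for a pair come from different coins, hence are independent; i ≠ j keeps the two
private sequences apart. -/
theorem place_injective {n : ℕ} {i j : Fin n} (hij : i ≠ j) (K D t p w : ℕ) :
    Function.Injective (place i j K D t p w) := by
  rintro ((a | ⟨a, b, c⟩ | ⟨a, b⟩) | ⟨a, b⟩ | ⟨a, b⟩)
    ((a' | ⟨a', b', c'⟩ | ⟨a', b'⟩) | ⟨a', b'⟩ | ⟨a', b'⟩) h <;>
    simp only [place, Sum.elim_inl, Sum.elim_inr, Prod.mk.injEq, true_and, reduceCtorEq,
      false_and, Option.some.injEq, hij, hij.symm] at h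
  · rw [Fin.ext h]
  · have := a.2; omega
  · have := a.2; omega
  · have := a'.2; omega
  · obtain ⟨h1, h2⟩ := mul_add_inj c.2 c'.2
      (show (a * t + b : ℕ) * p + c = (a' * t + b' : ℕ) * p + c' by omega)
    obtain ⟨h3, h4⟩ := mul_add_inj b.2 b'.2 h1
    rw [Fin.ext h2, Fin.ext h3, Fin.ext h4]
  · have := mul_add_lt c.2 (mul_add_lt b.2 a.2)
    omega
  · have := a'.2; omega
  · have := mul_add_lt c'.2 (mul_add_lt b'.2 a'.2)
    omega
  · obtain ⟨h3, h4⟩ := mul_add_inj b.2 b'.2 (show (a * t + b : ℕ) = a' * t + b' by omega)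
    rw [Fin.ext h3, Fin.ext h4]
  · obtain ⟨h3, h4⟩ := mul_add_inj b.2 b'.2 h
    rw [Fin.ext h3, Fin.ext h4]
  · obtain ⟨h3, h4⟩ := mul_add_inj b.2 b'.2 h
    rw [Fin.ext h3, Fin.ext h4]

theorem coins_fails {n : ℕ} {i j : Fin n} (hij : i ≠ j) (l k : ℕ) (ε : ℝ) (x x' : ℕ → ℝ) :
    coins n {ω | Fails l k ε x x' (sharedBits l k ε fun m => ω (none, m),
      privateBits l k ε fun m => ω (some i, m), privateBits l k ε fun m => ω (some j, m))} =
      ENNReal.ofReal (prob (Fails l k ε x x')) := by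
  have h := coins_eq (place_injective hij (2 ^ log2ceil k) (dim l k ε) (16 * l * (16 * l))
    (log2ceil k) (log2ceil (rootDim l k ε)))
    fun z => Fails l k ε x x' (placesEquiv _ _ _ _ _ z)
  rw [prob_equiv (placesEquiv _ _ _ _ _), ← h]
  rfl

/-- The factor 8^l bounds n³: n² pairs, and the target probability 1/n. As exp 8 ≥ 2^8, the product
is at most 34/16^l. -/
theorem eight_pow_mul_le {l : ℕ} (hl : 7 ≤ l) :
    8 ^ l * (34 * (2 ^ l * Real.exp (-(8 * l)))) ≤ 1 := by
  have h1 : Real.exp (-(8 * l)) ≤ ((1 : ℝ) / 256) ^ l := by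
    have e := Real.exp_one_gt_d9
    have e1 : (256 : ℝ) ≤ Real.exp 8 := by
      calc (256 : ℝ) = 2 ^ 8 := by norm_num
        _ ≤ Real.exp 1 ^ 8 := by gcongr; linarith
        _ = Real.exp 8 := by rw [← Real.exp_nat_mul]; norm_num
    have e2 : Real.exp (-(8 * l)) = (1 / Real.exp 8) ^ l := by
      rw [one_div, ← Real.exp_neg, ← Real.exp_nat_mul]
      congr 1; ring
    rw [e2]
    gcongr
  calc (8 : ℝ) ^ l * (34 * (2 ^ l * Real.exp (-(8 * l))))
      ≤ 8 ^ l * (34 * (2 ^ l * (1 / 256) ^ l)) := by gcongr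
    _ = 34 * (1 / 16) ^ l := by
        rw [show (1 / 16 : ℝ) = 8 * 2 * (1 / 256) by norm_num, mul_pow, mul_pow]
        ring
    _ ≤ 34 * (1 / 16) ^ 7 := by
        gcongr ?_ * ?_
        exact pow_le_pow_of_le_one (by norm_num) (by norm_num) hl
    _ ≤ 1 := by norm_num

theorem sum_coords {k : ℕ} (x : EuclideanSpace ℝ (Fin k)) :
    ∑ i ∈ range k, coords x i ^ 2 = ‖x‖ ^ 2 := by
  rw [EuclideanSpace.norm_sq_eq, ← Fin.sum_univ_eq_sum_range (fun i => coords x i ^ 2)]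
  refine sum_congr rfl fun i _ => ?_
  simp [coords]

theorem inBall_coords {k : ℕ} {x : EuclideanSpace ℝ (Fin k)} (hx : ‖x‖ ≤ 1) :
    InBall k (coords x) where
  zero i hi := by simp [coords, not_lt.2 hi]
  sum_le := by
    rw [sum_coords]
    exact pow_le_one₀ (norm_nonneg _) hx

/-- The algorithm is a sketching algorithm. -/
theorem isSketchAlgorithm {n k : ℕ} {ε : ℝ} (h : Admissible (lam n) k ε) {S R : ℝ}
    (hS : (sketchTime (lam n) k ε : ℝ) ≤ S) (hR : ((130 * dim (lam n) k ε : ℕ) : ℝ) ≤ R) :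
    IsSketchAlgorithm 16 sketchProg recoverProg n k ε (sketchLength (lam n) k ε) S R := by
  refine isSketchAlgorithm_of h hS hR fun x hx => ?_
  set q : ℝ := 34 * (2 ^ lam n * Real.exp (-(8 * lam n))) with hq
  set E : Fin n × Fin n → Set (Option (Fin n) × ℕ → Bool) := fun ij =>
    if ij.1 = ij.2 then ∅ else {ω | Fails (lam n) k ε (coords (x ij.1)) (coords (x ij.2))
      (sharedBits (lam n) k ε fun m => ω (none, m),
        privateBits (lam n) k ε fun m => ω (some ij.1, m),
        privateBits (lam n) k ε fun m => ω (some ij.2, m))} with hE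
  have hEq : ∀ ij, coins n (E ij) ≤ ENNReal.ofReal q := by
    intro ij
    simp only [hE]
    split_ifs with hij
    · simp
    · rw [coins_fails hij]
      exact ENNReal.ofReal_le_ofReal
        (prob_fails_le h (inBall_coords (hx _)) (inBall_coords (hx _)))
  calc coins n {ω | ∃ i j : Fin n, i ≠ j ∧ ε < |recovered (lam n) k ε (fun m => ω (none, m))
        (fun m => ω (some i, m)) (fun m => ω (some j, m)) (coords (x i)) (coords (x j)) -
        ‖x i - x j‖ ^ 2|} ≤ coins n (⋃ ij ∈ (univ : Finset (Fin n × Fin n)), E ij) := by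
        refine MeasureTheory.measure_mono ?_
        rintro ω ⟨i, j, hij, hω⟩
        simp only [mem_univ, Set.iUnion_true, Set.mem_iUnion]
        refine ⟨(i, j), ?_⟩
        simp only [hE, hij, if_false, Set.mem_ofPred_eq]
        by_contra hF
        have h1 := abs_recovered_sub_le h (inBall_coords (hx i)) (inBall_coords (hx j)) hF
        have h2 : ∑ m ∈ range k, (coords (x i) m - coords (x j) m) ^ 2 = ‖x i - x j‖ ^ 2 := by
          rw [← sum_coords]
          refine sum_congr rfl fun m _ => ?_
          congr 1
          unfold coords
          split_ifs <;> simp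
        rw [h2] at h1
        linarith
    _ ≤ ∑ ij : Fin n × Fin n, coins n (E ij) := MeasureTheory.measure_biUnion_finset_le _ _
    _ ≤ ∑ _ij : Fin n × Fin n, ENNReal.ofReal q := sum_le_sum fun ij _ => hEq ij
    _ = ENNReal.ofReal (n * n * q) := by
        rw [sum_const, card_univ, Fintype.card_prod, Fintype.card_fin, nsmul_eq_mul,
          ENNReal.ofReal_mul (p := n * n) (by positivity), ← Nat.cast_mul,
          ENNReal.ofReal_natCast]
    _ ≤ ENNReal.ofReal (1 / n) := by
        refine ENNReal.ofReal_le_ofReal ?_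
        rcases Nat.eq_zero_or_pos n with rfl | hn
        · simp
        have hn' : (0 : ℝ) < n := by exact_mod_cast hn
        rw [le_div_iff₀ hn']
        have h1 : (n : ℝ) ≤ 2 ^ lam n := by
          exact_mod_cast (Nat.lt_pow_succ_log_self one_lt_two n).le
        have h2 := eight_pow_mul_le h.hl
        calc (n : ℝ) * n * q * n = n ^ 3 * q := by ring
          _ ≤ (2 ^ lam n) ^ 3 * q := by gcongr
          _ = 8 ^ lam n * q := by
            rw [← pow_mul, mul_comm (lam n), pow_mul]; norm_num
          _ ≤ 1 := h2

end DistanceSketch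

namespace DistanceSketch

/-! ## The length of the sketches and the running times -/

/-- The assumptions on `n` and `ε`. -/
structure InRange (n : ℕ) (ε : ℝ) : Prop where
  pos : 0 < n
  le : 1 / (n : ℝ) ^ (0.49 : ℝ) ≤ ε
  le' : ε ≤ 0.1

section

variable {n k : ℕ} {ε : ℝ}

theorem InRange.eps_pos (h : InRange n ε) : 0 < ε := by
  have : (0 : ℝ) < n := by exact_mod_cast h.pos
  exact lt_of_lt_of_le (by positivity) h.le

theorem InRange.one_le_sq_mul (h : InRange n ε) : 1 ≤ ε ^ 2 * n := by
  have hn : (1 : ℝ) ≤ n := by exact_mod_cast h.pos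
  have h1 : (n : ℝ) ^ (0.49 : ℝ) ≤ √n := by
    rw [Real.sqrt_eq_rpow]
    exact Real.rpow_le_rpow_of_exponent_le hn (by norm_num)
  have h2 : 0 < (n : ℝ) ^ (0.49 : ℝ) := by positivity
  have h3 := h.le
  rw [div_le_iff₀ h2] at h3
  have h4 : 1 ≤ ε * √n := h3.trans (mul_le_mul_of_nonneg_left h1 h.eps_pos.le)
  calc (1 : ℝ) ≤ (ε * √n) ^ 2 := one_le_pow₀ h4
    _ = ε ^ 2 * n := by rw [mul_pow, Real.sq_sqrt (by positivity)]

theorem InRange.sq_le (h : InRange n ε) : ε ^ 2 ≤ 1 / 100 := by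
  have h1 := h.eps_pos
  have h2 := h.le'
  norm_num at h2 ⊢
  nlinarith

theorem InRange.hundred_le (h : InRange n ε) : 100 ≤ n := by
  have h1 := h.one_le_sq_mul
  have h2 := h.sq_le
  have hn : (0 : ℝ) < n := by exact_mod_cast h.pos
  have : (100 : ℝ) ≤ n := by nlinarith
  exact_mod_cast this

theorem InRange.four_le_log (h : InRange n ε) : 4 ≤ Real.log n := by
  have hn : (100 : ℝ) ≤ n := by exact_mod_cast h.hundred_le
  rw [Real.le_log_iff_exp_le (by linarith)]
  have e := Real.exp_one_lt_d9
  calc Real.exp 4 = Real.exp 1 ^ 4 := by rw [← Real.exp_nat_mul]; norm_num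
    _ ≤ 2.72 ^ 4 := by gcongr; linarith
    _ ≤ 100 := by norm_num
    _ ≤ n := hn

theorem InRange.log_le_lam (h : InRange n ε) : Real.log n ≤ lam n := by
  have hn : (0 : ℝ) < n := by exact_mod_cast h.pos
  have h1 : (n : ℝ) ≤ 2 ^ lam n := by
    exact_mod_cast (Nat.lt_pow_succ_log_self one_lt_two n).le
  have h2 := Real.log_le_log hn h1
  rw [Real.log_pow] at h2
  have := Real.log_two_lt_d9
  have h3 : (0 : ℝ) ≤ lam n := Nat.cast_nonneg _
  nlinarith

theorem InRange.lam_le (h : InRange n ε) : (lam n : ℝ) ≤ 2 * Real.log n := by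
  have h1 : ((2 : ℝ) ^ Nat.log 2 n) ≤ n := by
    exact_mod_cast Nat.pow_log_le_self 2 h.pos.ne'
  have h2 := Real.log_le_log (by positivity) h1
  rw [Real.log_pow] at h2
  have := Real.log_two_gt_d9
  have h3 := h.four_le_log
  have h4 : (lam n : ℝ) = Nat.log 2 n + 1 := by unfold lam; push_cast; ring
  have h5 : (0 : ℝ) ≤ Nat.log 2 n := Nat.cast_nonneg _
  rw [h4]
  nlinarith

theorem InRange.log_le_div (h : InRange n ε) : Real.log n ≤ Real.log n / ε ^ 2 := by
  have h1 := h.sq_le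
  have h2 : 0 < ε ^ 2 := by have := h.eps_pos; positivity
  have h3 := h.four_le_log
  rw [le_div_iff₀ h2]
  nlinarith

/-- Here k is far below 2^24 l/ε², so the search for the root can stop only at e² ≥ k. -/
theorem InRange.not_project (h : InRange n ε) (hk : (k : ℝ) ≤ Real.log n / ε ^ 2) :
    ¬ rootDim (lam n) k ε * rootDim (lam n) k ε < k := by
  intro hlt
  have h2 : 0 < ε ^ 2 := by have := h.eps_pos; positivity
  rw [le_div_iff₀ h2] at hk
  rcases rootDim_spec (lam n) k ε with h1 | h1
  · omega
  · have h3 : (rootDim (lam n) k ε * rootDim (lam n) k ε : ℝ) ≤ k := by exact_mod_cast hlt.le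
    have h4 := h.log_le_lam
    have h5 := h.four_le_log
    have h6 : ε * ε * (rootDim (lam n) k ε * rootDim (lam n) k ε) ≤ ε * ε * k :=
      mul_le_mul_of_nonneg_left h3 (mul_self_nonneg ε)
    nlinarith

theorem InRange.dim_eq (h : InRange n ε) (hk : (k : ℝ) ≤ Real.log n / ε ^ 2) :
    dim (lam n) k ε = k := if_neg (h.not_project hk)

theorem InRange.admissible (h : InRange n ε) (hk : 1 ≤ k)
    (hk' : k ≤ n ∨ (k : ℝ) ≤ Real.log n / ε ^ 2) : Admissible (lam n) k ε := by
  have hn : n ≤ 2 ^ lam n := (Nat.lt_pow_succ_log_self one_lt_two n).le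
  have hn' : (n : ℝ) ≤ 2 ^ lam n := by exact_mod_cast hn
  have hn0 : (1 : ℝ) ≤ n := by exact_mod_cast h.pos
  have hε := h.eps_pos
  have h1 := h.one_le_sq_mul
  have h2 : 0 < ε ^ 2 := by positivity
  have hε1 := h.le'
  constructor
  · have h64 : 6 ≤ Nat.log 2 n :=
      Nat.le_log_of_pow_le one_lt_two (le_trans (by norm_num) h.hundred_le)
    unfold lam
    omega
  · exact hk
  · rcases hk' with hk' | hk'
    · exact (hk'.trans hn).trans (Nat.pow_le_pow_right two_pos (by omega))
    · have h3 : (k : ℝ) ≤ n * n := by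
        rw [le_div_iff₀ h2] at hk'
        have h4 := Real.log_le_self (by linarith : (0 : ℝ) ≤ n)
        have hk0 : (0 : ℝ) ≤ k := Nat.cast_nonneg _
        have h5 : (k : ℝ) * 1 ≤ k * (ε ^ 2 * n) := mul_le_mul_of_nonneg_left h1 hk0
        nlinarith
      have h4 : k ≤ n * n := by exact_mod_cast h3
      calc k ≤ n * n := h4
        _ ≤ 2 ^ lam n * 2 ^ lam n := Nat.mul_le_mul hn hn
        _ = 2 ^ (2 * lam n) := by rw [← pow_add, two_mul]
        _ ≤ 2 ^ (3 * lam n) := Nat.pow_le_pow_right two_pos (by omega)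
  · exact hε
  · norm_num at hε1 ⊢; exact hε1
  · have h3 : ε ^ 2 * n ≤ ε * 2 ^ lam n := by
      rw [pow_two]
      have h4 : ε * ε ≤ ε := by norm_num at hε1; nlinarith
      gcongr
    linarith
  · intro hlt
    rcases hk' with hk' | hk'
    · exact hk'.trans hn
    · exact absurd hlt (h.not_project hk')

end

/-! ### The number of bits in terms of the two spacings. -/

section

variable {l k : ℕ} {ε : ℝ}

theorem rootMin_sq_le {D : ℕ} (hl : 1 ≤ l) (hD : 1 ≤ D) :
    rootMin l D * rootMin l D ≤ 4 * D ∧ rootMin l D * rootMin l D ≤ 4 * l := by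
  have h1 := rootMin_pos hl hD
  obtain ⟨m, hm⟩ : ∃ m, rootMin l D = m + 1 := ⟨rootMin l D - 1, by omega⟩
  have h2 := of_lt_rootMin (l := l) (D := D) (i := m) (by omega)
  rw [hm]
  rcases Nat.eq_zero_or_pos m with rfl | hm0
  · constructor <;> omega
  · constructor <;> nlinarith

/-- The ratio between the coarse and the fine spacing. -/
theorem Admissible.ratio_eq (h : Admissible l k ε) :
    (coarse l k ε / fine l k ε) ^ 2 * (ε ^ 2 * (rootDim l k ε * rootDim l k ε : ℕ)) =
      2 ^ 26 * (rootMin l (dim l k ε) * rootMin l (dim l k ε) : ℕ) := by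
  have h1 : (0 : ℝ) < rootDim l k ε := by exact_mod_cast h.rootDim_pos
  have h2 : (0 : ℝ) < rootMin l (dim l k ε) := by exact_mod_cast h.rootMin_pos
  have h3 := h.hε
  unfold coarse fine
  push_cast
  field_simp

theorem Admissible.ratio_pos (h : Admissible l k ε) : 0 < coarse l k ε / fine l k ε :=
  div_pos h.coarse_pos h.fine_pos

theorem Admissible.ratio_lt (h : Admissible l k ε) :
    coarse l k ε / fine l k ε ≤ 2 ^ fineBits (coarse l k ε) (fine l k ε) := by
  have h1 := h.fine_pos
  have h2 := fineBits_spec (T := coarse l k ε) h1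
  rw [div_le_iff₀ h1]
  linarith

theorem Admissible.two_pow_fineBits_sq_le (h : Admissible l k ε) :
    ((2 : ℝ) ^ fineBits (coarse l k ε) (fine l k ε)) ^ 2 ≤
      8 * ((coarse l k ε / fine l k ε) ^ 2 + 1) := by
  have h1 := two_pow_fineBits_le h.coarse_pos h.fine_pos
  have h2 := h.ratio_pos
  calc ((2 : ℝ) ^ fineBits (coarse l k ε) (fine l k ε)) ^ 2
      ≤ (2 * (coarse l k ε / fine l k ε + 1)) ^ 2 := pow_le_pow_left₀ (by positivity) h1 2
    _ ≤ _ := by nlinarith [sq_nonneg (coarse l k ε / fine l k ε - 1)]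

theorem le_log_of_two_pow_sq_le {b : ℕ} {x : ℝ} (h : ((2 : ℝ) ^ b) ^ 2 ≤ x) :
    (b : ℝ) ≤ Real.log x := by
  have h1 := Real.log_le_log (by positivity) h
  rw [Real.log_pow, Real.log_pow] at h1
  have h2 := Real.log_two_gt_d9
  have h3 : (0 : ℝ) ≤ b := Nat.cast_nonneg _
  push_cast at h1
  nlinarith

theorem log_le_of_le_two_pow {b : ℕ} {x : ℝ} (hx : 0 < x) (h : x ≤ 2 ^ b) :
    Real.log x ≤ b := by
  have h1 := Real.log_le_log hx h
  rw [Real.log_pow] at h1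
  have h2 := Real.log_two_lt_d9
  have h3 : (0 : ℝ) ≤ b := Nat.cast_nonneg _
  nlinarith

theorem sketchLength_cast (l k : ℕ) (ε : ℝ) : (sketchLength l k ε : ℝ) =
    (dim l k ε + 1) * (fineBits (coarse l k ε) (fine l k ε) + 6) := by
  unfold sketchLength
  push_cast
  ring

theorem sketchTime_of_not_project (hp : ¬ rootDim l k ε * rootDim l k ε < k) :
    (sketchTime l k ε : ℝ) ≤ 123 * sketchLength l k ε := by
  have hD : dim l k ε = k := if_neg hp
  have h1 : sketchTime l k ε ≤ 123 * sketchLength l k ε := by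
    unfold sketchTime
    rw [if_neg hp]
    unfold sketchLength
    rw [hD]
    have : (k + 1) * 6 ≤ (k + 1) * (fineBits (coarse l k ε) (fine l k ε) + 6) :=
      Nat.mul_le_mul_left _ (by omega)
    omega
  exact_mod_cast h1

theorem sketchLength_le (h : Admissible l k ε) {x : ℝ}
    (hb : (fineBits (coarse l k ε) (fine l k ε) + 6 : ℝ) ≤ x) :
    (sketchLength l k ε : ℝ) ≤ 2 * (dim l k ε * x) := by
  have h1 : (1 : ℝ) ≤ dim l k ε := by exact_mod_cast h.dim_pos
  have h2 : (0 : ℝ) ≤ fineBits (coarse l k ε) (fine l k ε) := Nat.cast_nonneg _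
  rw [sketchLength_cast]
  nlinarith

theorem le_sketchLength {x : ℝ} (hb : x ≤ (fineBits (coarse l k ε) (fine l k ε) + 6 : ℝ)) :
    dim l k ε * x ≤ sketchLength l k ε := by
  have h1 : (0 : ℝ) ≤ dim l k ε := Nat.cast_nonneg _
  have h2 : (0 : ℝ) ≤ fineBits (coarse l k ε) (fine l k ε) := Nat.cast_nonneg _
  rw [sketchLength_cast]
  nlinarith

end

section

variable {n k : ℕ} {ε : ℝ}

/-! ### Low dimension -/

theorem InRange.one_le_log_inv (h : InRange n ε) : 1 ≤ Real.log (1 / ε) := by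
  have hε := h.eps_pos
  rw [Real.le_log_iff_exp_le (by positivity), le_div_iff₀ hε]
  have e := Real.exp_one_lt_d9
  have := h.le'
  norm_num at this
  nlinarith

/-- Both e² and r² are of order k, since k ≤ l, so `Admissible.ratio_eq` makes T/s of order 1/ε. -/
theorem InRange.low_length (h : InRange n ε) (hk : 1 ≤ k) (hk' : (k : ℝ) ≤ Real.log n) :
    k * Real.log (1 / ε) ≤ sketchLength (lam n) k ε ∧
    sketchLength (lam n) k ε ≤ 100 * (k * Real.log (1 / ε)) := by
  have hk2 : (k : ℝ) ≤ Real.log n / ε ^ 2 := hk'.trans h.log_le_div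
  have hA := h.admissible hk (Or.inr hk2)
  have hD := h.dim_eq hk2
  have hε := h.eps_pos
  have hkl : k ≤ lam n := by exact_mod_cast hk'.trans h.log_le_lam
  have hr := hA.ratio_eq
  have hr0 := hA.ratio_pos
  have hr1 := hA.ratio_lt
  have hr2 := hA.two_pow_fineBits_sq_le
  have hlog := h.one_le_log_inv
  have hlow := fun x : ℝ => le_sketchLength (l := lam n) (k := k) (ε := ε) (x := x)
  have hup := fun x : ℝ => sketchLength_le hA (x := x)
  have hε2 := h.sq_le
  set ρ := coarse (lam n) k ε / fine (lam n) k ε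
  set b := fineBits (coarse (lam n) k ε) (fine (lam n) k ε)
  rw [hD] at hr hlow hup
  have he1 : k ≤ rootDim (lam n) k ε * rootDim (lam n) k ε := not_lt.1 (h.not_project hk2)
  have he2 := hA.rootDim_sq_le
  have hm1 : k ≤ rootMin (lam n) k * rootMin (lam n) k := by
    rcases rootMin_spec (lam n) k with h1 | h1 <;> omega
  have hm2 := (rootMin_sq_le (l := lam n) (D := k) (by have := hA.hl; omega) hk).1
  have hk0 : (1 : ℝ) ≤ k := by exact_mod_cast hk
  have f1 : (k : ℝ) ≤ (rootDim (lam n) k ε * rootDim (lam n) k ε : ℕ) := by exact_mod_cast he1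
  have f2 : ((rootDim (lam n) k ε * rootDim (lam n) k ε : ℕ) : ℝ) ≤ 4 * k := by exact_mod_cast he2
  have f3 : (k : ℝ) ≤ (rootMin (lam n) k * rootMin (lam n) k : ℕ) := by exact_mod_cast hm1
  have f4 : ((rootMin (lam n) k * rootMin (lam n) k : ℕ) : ℝ) ≤ 4 * k := by exact_mod_cast hm2
  set E : ℝ := ((rootDim (lam n) k ε * rootDim (lam n) k ε : ℕ) : ℝ)
  set R : ℝ := ((rootMin (lam n) k * rootMin (lam n) k : ℕ) : ℝ)
  have g1 : 1 ≤ ρ ^ 2 * ε ^ 2 := by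
    have : ρ ^ 2 * ε ^ 2 * (4 * k) ≥ 2 ^ 26 * k := by
      calc ρ ^ 2 * ε ^ 2 * (4 * k) ≥ ρ ^ 2 * ε ^ 2 * E := by gcongr
        _ = ρ ^ 2 * (ε ^ 2 * E) := by ring
        _ = 2 ^ 26 * R := hr
        _ ≥ 2 ^ 26 * k := by gcongr
    by_contra hc
    nlinarith
  have g2 : ρ ^ 2 * ε ^ 2 ≤ 2 ^ 28 := by
    have : ρ ^ 2 * ε ^ 2 * k ≤ 2 ^ 28 * k := by
      calc ρ ^ 2 * ε ^ 2 * k ≤ ρ ^ 2 * ε ^ 2 * E := by gcongr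
        _ = ρ ^ 2 * (ε ^ 2 * E) := by ring
        _ = 2 ^ 26 * R := hr
        _ ≤ 2 ^ 26 * (4 * k) := by gcongr
        _ = 2 ^ 28 * k := by ring
    exact le_of_mul_le_mul_right this (by linarith)
  have hlb : Real.log (1 / ε) ≤ b := by
    refine log_le_of_le_two_pow (by positivity) (le_trans ?_ hr1)
    rw [div_le_iff₀ hε]
    rw [← mul_pow] at g1
    exact (one_le_sq_iff₀ (by positivity)).1 g1
  have hub : (b : ℝ) + 6 ≤ 50 * Real.log (1 / ε) := by
    have h1 : ((2 : ℝ) ^ b) ^ 2 ≤ 2 ^ 32 * (1 / ε) ^ 2 := by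
      refine hr2.trans ?_
      rw [one_div_pow, mul_one_div, le_div_iff₀ (by positivity)]
      linarith
    have h2 := le_log_of_two_pow_sq_le h1
    rw [Real.log_mul (by positivity) (by positivity), Real.log_pow, Real.log_pow] at h2
    have h3 := Real.log_two_lt_d9
    push_cast at h2
    linarith
  constructor
  · exact hlow _ (by linarith)
  · exact (hup _ hub).trans (le_of_eq (by ring))

/-! ### Intermediate dimension -/

/-- Now e² is of order k but r² of order log n, so (T/s)² is of order log n/(ε²k). -/
theorem InRange.mid_length (h : InRange n ε) (hk : Real.log n ≤ k)
    (hk' : (k : ℝ) ≤ Real.log n / ε ^ 2) :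
    k * Real.log (2 + Real.log n / (ε ^ 2 * k)) ≤ 2 * sketchLength (lam n) k ε ∧
    sketchLength (lam n) k ε ≤ 100 * (k * Real.log (2 + Real.log n / (ε ^ 2 * k))) := by
  have h4 := h.four_le_log
  have hk0 : (1 : ℝ) ≤ k := by linarith
  have hk1 : 1 ≤ k := by exact_mod_cast hk0
  have hA := h.admissible hk1 (Or.inr hk')
  have hD := h.dim_eq hk'
  have hε := h.eps_pos
  have hr := hA.ratio_eq
  have hr0 := hA.ratio_pos
  have hr1 := hA.ratio_lt
  have hr2 := hA.two_pow_fineBits_sq_le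
  have hlow := fun x : ℝ => le_sketchLength (l := lam n) (k := k) (ε := ε) (x := x)
  have hup := fun x : ℝ => sketchLength_le hA (x := x)
  have hll := h.log_le_lam
  have hlu := h.lam_le
  set ρ := coarse (lam n) k ε / fine (lam n) k ε
  set b := fineBits (coarse (lam n) k ε) (fine (lam n) k ε)
  rw [hD] at hr hlow hup
  have he1 : k ≤ rootDim (lam n) k ε * rootDim (lam n) k ε := not_lt.1 (h.not_project hk')
  have he2 := hA.rootDim_sq_le
  have hm2 := (rootMin_sq_le (l := lam n) (D := k) (by have := hA.hl; omega) hk1).2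
  have f1 : (k : ℝ) ≤ (rootDim (lam n) k ε * rootDim (lam n) k ε : ℕ) := by exact_mod_cast he1
  have f2 : ((rootDim (lam n) k ε * rootDim (lam n) k ε : ℕ) : ℝ) ≤ 4 * k := by exact_mod_cast he2
  have f3 : Real.log n ≤ (rootMin (lam n) k * rootMin (lam n) k : ℕ) := by
    rcases rootMin_spec (lam n) k with h1 | h1
    · exact hk.trans (by exact_mod_cast h1)
    · exact hll.trans (by exact_mod_cast h1)
  have f4 : ((rootMin (lam n) k * rootMin (lam n) k : ℕ) : ℝ) ≤ 4 * lam n := by exact_mod_cast hm2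
  set E : ℝ := ((rootDim (lam n) k ε * rootDim (lam n) k ε : ℕ) : ℝ)
  set R : ℝ := ((rootMin (lam n) k * rootMin (lam n) k : ℕ) : ℝ)
  set A := Real.log n / (ε ^ 2 * k) with hAdef
  have hε2 : 0 < ε ^ 2 := by positivity
  have hA1 : 1 ≤ A := by
    rw [hAdef, le_div_iff₀ (by positivity)]
    rw [le_div_iff₀ hε2] at hk'
    linarith
  have hAeq : A * (ε ^ 2 * k) = Real.log n := by
    rw [hAdef]; field_simp
  have hlog1 : 1 ≤ Real.log (2 + A) := by
    rw [Real.le_log_iff_exp_le (by linarith)]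
    have e := Real.exp_one_lt_d9
    linarith
  have hkε : 0 < ε ^ 2 * k := by positivity
  have g1 : 2 + A ≤ ρ ^ 2 := by
    have : ρ ^ 2 * (ε ^ 2 * (4 * k)) ≥ 2 ^ 26 * (A * (ε ^ 2 * k)) := by
      calc ρ ^ 2 * (ε ^ 2 * (4 * k)) ≥ ρ ^ 2 * (ε ^ 2 * E) := by gcongr
        _ = 2 ^ 26 * R := hr
        _ ≥ 2 ^ 26 * (A * (ε ^ 2 * k)) := by rw [hAeq]; gcongr
    have h2 : 2 ^ 24 * A ≤ ρ ^ 2 := by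
      refine le_of_mul_le_mul_right ?_ hkε
      nlinarith
    linarith
  have g2 : ρ ^ 2 ≤ 2 ^ 29 * A := by
    refine le_of_mul_le_mul_right ?_ hkε
    calc ρ ^ 2 * (ε ^ 2 * k) ≤ ρ ^ 2 * (ε ^ 2 * E) := by gcongr
      _ = 2 ^ 26 * R := hr
      _ ≤ 2 ^ 26 * (4 * lam n) := by gcongr
      _ ≤ 2 ^ 26 * (4 * (2 * (A * (ε ^ 2 * k)))) := by rw [hAeq]; gcongr
      _ = _ := by ring
  have hlb : Real.log (2 + A) ≤ 2 * b := by
    have h1 : 2 + A ≤ 2 ^ (2 * b) := by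
      rw [mul_comm, pow_mul]
      exact g1.trans (pow_le_pow_left₀ hr0.le hr1 2)
    have := log_le_of_le_two_pow (by linarith) h1
    push_cast at this
    exact this
  have hub : (b : ℝ) + 6 ≤ 50 * Real.log (2 + A) := by
    have h1 : ((2 : ℝ) ^ b) ^ 2 ≤ 2 ^ 33 * (2 + A) := by
      refine hr2.trans ?_
      linarith
    have h2 := le_log_of_two_pow_sq_le h1
    rw [Real.log_mul (by positivity) (by positivity), Real.log_pow] at h2
    have h3 := Real.log_two_lt_d9
    push_cast at h2
    linarith
  constructor
  · have := hlow (Real.log (2 + A) / 2) (by linarith)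
    linarith
  · exact (hup _ hub).trans (le_of_eq (by ring))

/-! ### High dimension -/

theorem InRange.le_dim (h : InRange n ε) (hk : Real.log n / ε ^ 2 ≤ k) :
    Real.log n / ε ^ 2 ≤ dim (lam n) k ε := by
  have h2 : 0 < ε ^ 2 := by have := h.eps_pos; positivity
  unfold dim
  split_ifs with hp
  · rcases rootDim_spec (lam n) k ε with h1 | h1
    · omega
    · rw [div_le_iff₀ h2]
      have := h.log_le_lam
      have := h.four_le_log
      push_cast
      nlinarith
  · exact hk

theorem InRange.dim_le_div (h : InRange n ε) (hA : Admissible (lam n) k ε) :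
    dim (lam n) k ε ≤ 2 ^ 27 * (Real.log n / ε ^ 2) := by
  have h2 : 0 < ε ^ 2 := by have := h.eps_pos; positivity
  have h1 := hA.rootDim_sq_mul_le
  have h3 : (dim (lam n) k ε : ℝ) ≤ rootDim (lam n) k ε * rootDim (lam n) k ε := by
    exact_mod_cast dim_le_sq (lam n) k ε
  have h4 := h.lam_le
  rw [← mul_div_assoc, le_div_iff₀ h2]
  nlinarith

/-- Here e² is at least log n/ε² and r² is O(log n), so T/s is bounded and a coordinate takes O(1)
bits. -/
theorem InRange.high_length (h : InRange n ε) (hA : Admissible (lam n) k ε)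
    (hk : Real.log n / ε ^ 2 ≤ k) :
    Real.log n / ε ^ 2 ≤ sketchLength (lam n) k ε ∧
    sketchLength (lam n) k ε ≤ 2 ^ 34 * (Real.log n / ε ^ 2) := by
  have hε := h.eps_pos
  have h4 := h.four_le_log
  have hr := hA.ratio_eq
  have hr0 := hA.ratio_pos
  have hr2 := hA.two_pow_fineBits_sq_le
  have hlow := le_sketchLength (l := lam n) (k := k) (ε := ε) (x := 1)
  have hup := fun x : ℝ => sketchLength_le hA (x := x)
  have hlu := h.lam_le
  have hD1 := h.le_dim hk
  have hD2 := h.dim_le_div hA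
  set ρ := coarse (lam n) k ε / fine (lam n) k ε
  set b := fineBits (coarse (lam n) k ε) (fine (lam n) k ε)
  have hε2 : 0 < ε ^ 2 := by positivity
  have hb0 : (0 : ℝ) ≤ b := Nat.cast_nonneg _
  have f1 : (dim (lam n) k ε : ℝ) ≤ (rootDim (lam n) k ε * rootDim (lam n) k ε : ℕ) := by
    exact_mod_cast dim_le_sq (lam n) k ε
  have f4 : ((rootMin (lam n) (dim (lam n) k ε) * rootMin (lam n) (dim (lam n) k ε) : ℕ) : ℝ) ≤
      4 * lam n := by
    exact_mod_cast (rootMin_sq_le (l := lam n) (by have := hA.hl; omega) hA.dim_pos).2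
  have g2 : ρ ^ 2 ≤ 2 ^ 29 := by
    refine le_of_mul_le_mul_right ?_ (by linarith : 0 < Real.log n)
    calc ρ ^ 2 * Real.log n = ρ ^ 2 * (ε ^ 2 * (Real.log n / ε ^ 2)) := by field_simp
      _ ≤ ρ ^ 2 * (ε ^ 2 * (rootDim (lam n) k ε * rootDim (lam n) k ε : ℕ)) := by
          gcongr
          exact hD1.trans f1
      _ = _ := hr
      _ ≤ 2 ^ 26 * (4 * lam n) := by gcongr
      _ ≤ _ := by linarith
  have hub : (b : ℝ) + 6 ≤ 50 := by
    have h1 : ((2 : ℝ) ^ b) ^ 2 ≤ 2 ^ 33 := by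
      refine hr2.trans ?_
      linarith
    have h2 := le_log_of_two_pow_sq_le h1
    rw [Real.log_pow] at h2
    have h3 := Real.log_two_lt_d9
    push_cast at h2
    linarith
  have hpos : 0 < Real.log n / ε ^ 2 := by positivity
  constructor
  · have := hlow (by linarith)
    linarith
  · have := hup _ hub
    linarith

/-- Padding to a power of two at most doubles k, so the transform takes O(k log k). The sampling
term D(16l)² is O(log³ n/ε²), and the encoding is linear in the length. -/
theorem InRange.high_time (h : InRange n ε) (hA : Admissible (lam n) k ε)
    (hk : Real.log n / ε ^ 2 ≤ k) :
    sketchTime (lam n) k ε ≤ 2 ^ 44 * (k * Real.log k + Real.log n ^ 3 / ε ^ 2) := by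
  have hε := h.eps_pos
  have h4 := h.four_le_log
  have hg := (h.high_length hA hk).2
  have hD2 := h.dim_le_div hA
  have hlu := h.lam_le
  have hε2 : 0 < ε ^ 2 := by positivity
  have hk4 : 4 ≤ (k : ℝ) := h4.trans (h.log_le_div.trans hk)
  have hk1 : 1 ≤ k := hA.hk
  have hlogk : 1 ≤ Real.log k := by
    rw [Real.le_log_iff_exp_le (by linarith)]
    have e := Real.exp_one_lt_d9
    linarith
  set Q := Real.log n / ε ^ 2 with hQ
  have hQ0 : 0 < Q := by positivity
  have hQ3 : Real.log n ^ 3 / ε ^ 2 = Real.log n ^ 2 * Q := by rw [hQ]; ring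
  have hQ1 : Q ≤ Real.log n ^ 2 * Q := le_mul_of_one_le_left hQ0.le (by nlinarith)
  have hkk : (k : ℝ) ≤ k * Real.log k := le_mul_of_one_le_right (by linarith) hlogk
  have hp1 : (2 : ℝ) ^ log2ceil k ≤ 2 * k := by exact_mod_cast two_pow_log2ceil_le hk1
  have hp2 : (log2ceil k : ℝ) ≤ 3 * Real.log k := by
    have h1 := Real.log_le_log (by positivity) hp1
    rw [Real.log_pow, Real.log_mul (by norm_num) (by positivity)] at h1
    have h2 := Real.log_two_gt_d9
    have h3 := Real.log_two_lt_d9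
    have h5 : (0 : ℝ) ≤ log2ceil k := Nat.cast_nonneg _
    nlinarith
  have hproj : ((if rootDim (lam n) k ε * rootDim (lam n) k ε < k then
      2 ^ log2ceil k * (12 * log2ceil k + 8) +
        dim (lam n) k ε * (12 * (16 * lam n * (16 * lam n))) else 0 : ℕ) : ℝ) ≤
      88 * (k * Real.log k) + 2 ^ 27 * 12288 * (Real.log n ^ 2 * Q) := by
    split_ifs
    · push_cast
      have e1 : (2 : ℝ) ^ log2ceil k * (12 * log2ceil k + 8) ≤
          2 * k * (12 * (3 * Real.log k) + 8 * Real.log k) := by gcongr; linarith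
      have e2 : (dim (lam n) k ε : ℝ) * (12 * (16 * lam n * (16 * lam n))) ≤
          2 ^ 27 * Q * (12 * (16 * (2 * Real.log n) * (16 * (2 * Real.log n)))) := by gcongr
      nlinarith
    · push_cast
      positivity
  have : (sketchTime (lam n) k ε : ℝ) = 43 * sketchLength (lam n) k ε + 20 * k + 60 +
      ((if rootDim (lam n) k ε * rootDim (lam n) k ε < k then
      2 ^ log2ceil k * (12 * log2ceil k + 8) +
        dim (lam n) k ε * (12 * (16 * lam n * (16 * lam n))) else 0 : ℕ) : ℝ) := by
    unfold sketchTime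
    push_cast
    rfl
  rw [this, hQ3]
  linarith

end

end DistanceSketch

namespace DistanceSketch

/-! ## The lower bound for the length -/

open Finset

open scoped BigOperators RealInnerProductSpace

/-- Used for the differences of first coordinates: a perturbation smaller than `d` cannot make
different ones coincide. -/
theorem exists_pos_le_abs (F : Finset ℝ) : ∃ d > 0, ∀ x ∈ F, x ≠ 0 → d ≤ |x| := by
  induction F using Finset.induction_on with
  | empty => exact ⟨1, one_pos, by simp⟩
  | insert x F _ ih =>
    obtain ⟨d, hd, h⟩ := ih
    by_cases hx : x = 0
    · refine ⟨d, hd, fun y hy hy0 => ?_⟩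
      rcases mem_insert.1 hy with rfl | hy
      · exact absurd hx hy0
      · exact h y hy hy0
    · refine ⟨min d |x|, lt_min hd (abs_pos.2 hx), fun y hy hy0 => ?_⟩
      rcases mem_insert.1 hy with rfl | hy
      · exact min_le_right _ _
      · exact (min_le_left _ _).trans (h y hy hy0)

/-- Embeds the strings of length at most L into the words of length L over three letters, of which
there are 3^L. -/
theorem getElem?_injOn (L : ℕ) {a b : List Bool} (ha : a.length ≤ L) (hb : b.length ≤ L)
    (h : (fun j : Fin L => a[(j : ℕ)]?) = fun j : Fin L => b[(j : ℕ)]?) : a = b := by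
  refine List.ext_getElem? fun i => ?_
  rcases lt_or_ge i L with hi | hi
  · exact congrFun h ⟨i, hi⟩
  · rw [List.getElem?_eq_none (ha.trans hi), List.getElem?_eq_none (hb.trans hi)]

/-- If many words are mapped to points that can be told apart by their inner products with few
reference points, then sketches are long. -/
theorem SketchesExist.card_le {n k : ℕ} {ε : ℝ} {L : ℕ} (hS : SketchesExist n k ε L) (hk : 1 ≤ k)
    (hn : 0 < n) (hε : 0 < ε) (hε' : ε ≤ 1 / 10) {Q S : Type} [Fintype Q] [Fintype S]
    {φ : Q → EuclideanSpace ℝ (Fin k)} {ρ : S → EuclideanSpace ℝ (Fin k)} {neg : S → S}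
    (hneg : ∀ s, ρ (neg s) = -ρ s) (hφ : ∀ a, ‖φ a‖ ≤ 1) (hρ : ∀ s, ‖ρ s‖ ≤ 1)
    (hcard : 2 * Fintype.card S ≤ n) {M : ℕ} {close : Q → Finset Q}
    (hclose : ∀ a b, (∀ s, |⟪φ a - φ b, ρ s⟫| ≤ 1.05 * ε) → b ∈ close a)
    (hM : ∀ a, (close a).card ≤ M) :
    Fintype.card Q ≤ M * 9 ^ L := by
  classical
  obtain ⟨recf, hrec⟩ := hS
  set u : S ⊕ Q → EuclideanSpace ℝ (Fin k) := Sum.elim ρ φ with hu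
  have hu1 : ∀ v, ‖u v‖ ≤ 1 := by rintro (v | v); exacts [hρ v, hφ v]
  obtain ⟨d, hd, hdF⟩ := exists_pos_le_abs
    (univ.image fun p : (S ⊕ Q) × (S ⊕ Q) => u p.1 ⟨0, hk⟩ - u p.2 ⟨0, hk⟩)
  have hn0 : (0 : ℝ) < n := by exact_mod_cast hn
  -- The points have to be distinct, but words may repeat. A shift proportional to the index along
  -- the first axis separates points with equal first coordinates, and γ ≤ d/4 keeps the others
  -- apart. Shrinking by 1 - γ keeps all points in the ball.
  set γ := min (d / 4) (ε / 1000) with hγ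
  have hγ0 : 0 < γ := lt_min (by positivity) (by positivity)
  have hγd : γ ≤ d / 4 := min_le_left _ _
  have hγε : γ ≤ ε / 1000 := min_le_right _ _
  set e₀ : EuclideanSpace ℝ (Fin k) := EuclideanSpace.single ⟨0, hk⟩ 1 with he₀
  have he₀n : ‖e₀‖ = 1 := by simp [he₀]
  set τ : Fin n → EuclideanSpace ℝ (Fin k) := fun i => (γ / n * (i : ℝ)) • e₀ with hτ
  have hτn : ∀ i, ‖τ i‖ ≤ γ := by
    intro i
    have hi : (i : ℝ) ≤ n := by exact_mod_cast i.2.le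
    rw [hτ, norm_smul, he₀n, mul_one, Real.norm_eq_abs, abs_of_nonneg (by positivity)]
    calc γ / n * (i : ℝ) ≤ γ / n * n := by gcongr
      _ = γ := by field_simp
  set N := n - Fintype.card S with hN
  obtain ⟨e⟩ : Nonempty (Fin n ≃ S ⊕ Fin N) :=
    ⟨Fintype.equivOfCardEq (by rw [Fintype.card_sum, Fintype.card_fin, Fintype.card_fin]; omega)⟩
  set V : (Fin N → Q) → Fin n → EuclideanSpace ℝ (Fin k) := fun f i =>
    (1 - γ) • u ((e i).map id f) + τ i with hV
  have hVinj : ∀ f, Function.Injective (V f) := by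
    intro f i j hij
    have h0 := congrArg (fun x : EuclideanSpace ℝ (Fin k) => x ⟨0, hk⟩) hij
    simp only [hV, hτ, he₀, PiLp.add_apply, PiLp.smul_apply, smul_eq_mul,
      PiLp.single_apply, if_true, mul_one] at h0
    set p := u ((e i).map id f) ⟨0, hk⟩ with hp
    set p' := u ((e j).map id f) ⟨0, hk⟩ with hp'
    have h1 : (1 - γ) * (p - p') = γ / n * ((j : ℝ) - i) := by linarith
    have hij' : |((j : ℝ) - i)| ≤ n := by
      have hi : (i : ℝ) ≤ n := by exact_mod_cast i.2.le
      have hj : (j : ℝ) ≤ n := by exact_mod_cast j.2.le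
      have hi0 : (0 : ℝ) ≤ i := Nat.cast_nonneg _
      have hj0 : (0 : ℝ) ≤ j := Nat.cast_nonneg _
      rw [abs_le]; constructor <;> linarith
    have h2 : p - p' = 0 := by
      by_contra hne
      have h3 := hdF (p - p') (mem_image.2 ⟨(_, _), mem_univ _, rfl⟩) hne
      have h4 : |(1 - γ) * (p - p')| ≤ γ := by
        rw [h1, abs_mul, abs_of_nonneg (by positivity)]
        calc γ / n * |(j : ℝ) - i| ≤ γ / n * n := by gcongr
          _ = γ := by field_simp
      rw [abs_mul, abs_of_pos (by linarith)] at h4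
      nlinarith
    rw [h2, mul_zero] at h1
    have h5 : (j : ℝ) - i = 0 := by
      rcases mul_eq_zero.1 h1.symm with h | h
      · exact absurd h (by positivity)
      · exact h
    have h6 : (i : ℝ) = j := by linarith
    exact Fin.ext (by exact_mod_cast h6)
  have hVn : ∀ f i, ‖V f i‖ ≤ 1 := by
    intro f i
    calc ‖V f i‖ ≤ ‖(1 - γ) • u ((e i).map id f)‖ + ‖τ i‖ := norm_add_le _ _
      _ ≤ (1 - γ) * 1 + γ := by
          rw [norm_smul, Real.norm_eq_abs, abs_of_pos (by linarith)]
          have := hu1 ((e i).map id f)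
          have := hτn i
          gcongr
          linarith
      _ = 1 := by ring
  choose A hA1 hA2 using fun f => hrec (V f) (hVinj f) (hVn f)
  -- Equal sketches yield equal estimates, so the squared distances to every reference point differ
  -- by at most 2ε between the families f and g.
  have hfib : ∀ f g, A f = A g → ∀ i, g i ∈ close (f i) := by
    intro f g hfg i
    refine hclose _ _ fun s => ?_
    have key : ∀ s, |‖V f (e.symm (.inr i)) - V f (e.symm (.inl s))‖ ^ 2 -
        ‖V g (e.symm (.inr i)) - V g (e.symm (.inl s))‖ ^ 2| ≤ 2 * ε := by
      intro s
      have hne : e.symm (.inr i) ≠ e.symm (.inl s) := fun h => by simpa using e.symm.injective h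
      have h1 := abs_le.1 (hA2 f _ _ hne)
      have h2 := abs_le.1 (hA2 g _ _ hne)
      rw [hfg] at h1
      rw [abs_le]; constructor <;> linarith
    have expand : ∀ s, ‖V f (e.symm (.inr i)) - V f (e.symm (.inl s))‖ ^ 2 -
        ‖V g (e.symm (.inr i)) - V g (e.symm (.inl s))‖ ^ 2 =
        ‖(1 - γ) • φ (f i) + τ (e.symm (.inr i))‖ ^ 2 -
          ‖(1 - γ) • φ (g i) + τ (e.symm (.inr i))‖ ^ 2 -
        2 * ((1 - γ) ^ 2 * ⟪φ (f i) - φ (g i), ρ s⟫) -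
        2 * ((1 - γ) * ⟪φ (f i) - φ (g i), τ (e.symm (.inl s))⟫) := by
      intro s
      simp only [hV, hu, Equiv.apply_symm_apply, Sum.map_inr, Sum.map_inl, Sum.elim_inr,
        Sum.elim_inl, id]
      rw [norm_sub_sq_real, norm_sub_sq_real]
      simp only [inner_add_left, inner_add_right, inner_sub_left, real_inner_smul_left,
        real_inner_smul_right]
      ring
    -- The unknown difference of the norms is the same for a reference point and its negative;
    -- subtracting the two inequalities isolates the inner product.
    have k1 := key s
    have k2 := key (neg s)
    rw [expand] at k1 k2
    rw [hneg, inner_neg_right] at k2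
    have hfg2 : ‖φ (f i) - φ (g i)‖ ≤ 2 := (norm_sub_le _ _).trans (by linarith [hφ (f i), hφ (g i)])
    have t1 : ∀ s, |(1 - γ) * ⟪φ (f i) - φ (g i), τ (e.symm (.inl s))⟫| ≤ 2 * γ := by
      intro s
      rw [abs_mul, abs_of_pos (by linarith : 0 < 1 - γ)]
      have h1 := abs_real_inner_le_norm (φ (f i) - φ (g i)) (τ (e.symm (.inl s)))
      have h2 : ‖φ (f i) - φ (g i)‖ * ‖τ (e.symm (.inl s))‖ ≤ 2 * γ := by
        have := hτn (e.symm (.inl s))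
        gcongr
      calc (1 - γ) * |⟪φ (f i) - φ (g i), τ (e.symm (.inl s))⟫| ≤ 1 * (2 * γ) := by
            gcongr
            · linarith
            · exact h1.trans h2
        _ = 2 * γ := one_mul _
    have t2 := abs_le.1 (t1 s)
    have t3 := abs_le.1 (t1 (neg s))
    have k1 := abs_le.1 k1
    have k2 := abs_le.1 k2
    set I := ⟪φ (f i) - φ (g i), ρ s⟫
    have hI : |(1 - γ) ^ 2 * I| ≤ ε + 2 * γ := by
      rw [abs_le]; constructor <;> linarith
    rw [abs_mul, abs_of_nonneg (sq_nonneg _)] at hI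
    have h2 : 0.999 ≤ (1 - γ) ^ 2 := by norm_num; nlinarith
    have h3 : 0.999 * |I| ≤ (1 - γ) ^ 2 * |I| := by gcongr
    norm_num at h3 ⊢
    linarith
  set code : (Fin N → Q) → Fin n → Fin L → Option Bool := fun f i j => (A f i)[(j : ℕ)]? with hcode
  have hcodeA : ∀ f g, code f = code g → A f = A g := fun f g h =>
    funext fun i => getElem?_injOn L (hA1 f i) (hA1 g i) (congrFun h i)
  have hcount : (univ : Finset (Fin N → Q)).card ≤
      M ^ N * ((univ : Finset (Fin N → Q)).image code).card := by
    refine card_le_mul_card_image _ _ fun c hc => ?_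
    obtain ⟨f, -, rfl⟩ := mem_image.1 hc
    calc _ ≤ (Fintype.piFinset fun i => close (f i)).card := by
          refine card_le_card fun g hg => Fintype.mem_piFinset.2 ?_
          exact hfib f g (hcodeA f g (mem_filter.1 hg).2.symm)
      _ = ∏ i, (close (f i)).card := Fintype.card_piFinset _
      _ ≤ ∏ _i : Fin N, M := prod_le_prod' fun i _ => hM _
      _ = M ^ N := by simp
  -- At most half of the points are references, so n ≤ 2N. This turns the alphabet size 3 into the
  -- base 9 per free point.
  have himage : ((univ : Finset (Fin N → Q)).image code).card ≤ (9 ^ L) ^ N := by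
    calc _ ≤ Fintype.card (Fin n → Fin L → Option Bool) := card_le_univ _
      _ = (3 ^ L) ^ n := by simp
      _ ≤ (3 ^ L) ^ (2 * N) := Nat.pow_le_pow_right (by positivity) (by omega)
      _ = (9 ^ L) ^ N := by
          rw [pow_mul, ← pow_mul 3 L 2, mul_comm L 2, pow_mul 3 2 L]
          norm_num
  rw [card_univ, Fintype.card_fun, Fintype.card_fin] at hcount
  have : Fintype.card Q ^ N ≤ (M * 9 ^ L) ^ N := by
    rw [mul_pow]
    exact hcount.trans (Nat.mul_le_mul_left _ himage)
  exact (Nat.pow_le_pow_iff_left (by omega)).1 this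

/-- The size of a Hamming ball. -/
theorem card_hamming_le {I : Type} [Fintype I] [DecidableEq I] {q : ℕ} (hq : 0 < q) (a : I → Fin q)
    (h : ℕ) :
    (univ.filter fun b : I → Fin q => hammingDist a b ≤ h).card ≤ 2 ^ Fintype.card I * q ^ h := by
  have hq' : (1 : ℝ) ≤ q := by exact_mod_cast hq
  -- Weighting b by q^(-dist(a, b)) gives a sum that factors over the coordinates, each factor being
  -- at most 1 + q·(1/q). Every word of the ball has weight at least q^(-h).
  have h1 : ∑ b : I → Fin q, ∏ i, (if a i ≠ b i then (1 / q : ℝ) else 1) ≤ 2 ^ Fintype.card I := by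
    have := prod_univ_sum (fun _ : I => (univ : Finset (Fin q)))
      fun i c => if a i ≠ c then (1 / q : ℝ) else 1
    rw [Fintype.piFinset_univ] at this
    rw [← this]
    calc ∏ i : I, ∑ c : Fin q, (if a i ≠ c then (1 / q : ℝ) else 1) ≤ ∏ _i : I, (2 : ℝ) := by
          refine prod_le_prod (fun i _ => sum_nonneg fun c _ => by positivity) fun i _ => ?_
          calc ∑ c : Fin q, (if a i ≠ c then (1 / q : ℝ) else 1)
              ≤ ∑ c : Fin q, (1 / q + if a i = c then (1 : ℝ) else 0) := by
                refine sum_le_sum fun c _ => ?_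
                by_cases hc : a i = c
                · simp [hc]
                · simp [hc]
            _ = 2 := by
                rw [sum_add_distrib, sum_ite_eq]
                simp
                field_simp
                norm_num
      _ = _ := by simp
  have h2 : ((univ.filter fun b : I → Fin q => hammingDist a b ≤ h).card : ℝ) * (1 / q) ^ h ≤
      ∑ b : I → Fin q, ∏ i, (if a i ≠ b i then (1 / q : ℝ) else 1) := by
    rw [← nsmul_eq_mul, ← sum_const]
    refine (sum_le_sum fun b hb => ?_).trans
      (sum_le_sum_of_subset_of_nonneg (filter_subset _ _) fun b _ _ => by positivity)
    rw [prod_ite, prod_const_one, mul_one, prod_const]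
    exact pow_le_pow_of_le_one (by positivity) (by rw [div_le_one (by linarith)]; exact hq')
      (mem_filter.1 hb).2
  have h3 := h2.trans h1
  rw [one_div_pow, mul_one_div, div_le_iff₀ (by positivity)] at h3
  exact_mod_cast h3

end DistanceSketch

namespace DistanceSketch

/-! ### Grid points and block sign vectors. -/

open Finset

open scoped BigOperators RealInnerProductSpace

/-- Vectors with the coordinates in `I`, as vectors with more coordinates. -/
noncomputable def embed {I : Type} {k : ℕ} (ι : I → Fin k) (v : I → ℝ) : EuclideanSpace ℝ (Fin k) :=
  WithLp.toLp 2 (Function.extend ι v 0)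

section

variable {I : Type} [Fintype I] {k : ℕ} {ι : I → Fin k}

theorem inner_embed (hι : Function.Injective ι) (v w : I → ℝ) :
    ⟪embed ι v, embed ι w⟫ = ∑ p, v p * w p := by
  rw [PiLp.inner_apply]
  refine (Fintype.sum_of_injective ι hι _ _ (fun i hi => ?_) fun p => ?_).symm
  · have : ¬ ∃ a, ι a = i := hi
    simp [embed, Function.extend_apply' _ _ _ this]
  · simp [embed, hι.extend_apply, mul_comm]

theorem norm_embed_le (hι : Function.Injective ι) {v : I → ℝ} (hv : ∑ p, v p ^ 2 ≤ 1) :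
    ‖embed ι v‖ ≤ 1 := by
  have h : ‖embed ι v‖ ^ 2 ≤ 1 := by
    rw [← real_inner_self_eq_norm_sq, inner_embed hι]
    simpa only [pow_two] using hv
  exact (sq_le_one_iff₀ (norm_nonneg _)).1 h

theorem embed_sub (hι : Function.Injective ι) (v w : I → ℝ) :
    embed ι v - embed ι w = embed ι (v - w) := by
  ext i
  by_cases hi : ∃ a, ι a = i
  · obtain ⟨a, rfl⟩ := hi
    simp [embed, hι.extend_apply]
  · simp [embed, Function.extend_apply' _ _ _ hi]

theorem embed_neg (hι : Function.Injective ι) (v : I → ℝ) : embed ι (-v) = -embed ι v := by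
  ext i
  by_cases hi : ∃ a, ι a = i
  · obtain ⟨a, rfl⟩ := hi
    simp [embed, hι.extend_apply]
  · simp [embed, Function.extend_apply' _ _ _ hi]

end

section

variable {B m q : ℕ}

/-- A vector with entries in a grid. -/
noncomputable def gridVec (B m q : ℕ) (a : Fin B × Fin m → Fin q) (p : Fin B × Fin m) : ℝ :=
  (2 * (a p : ℕ) / (q - 1) - 1) / √(B * m)

/-- The sign vectors that are supported in one block. -/
noncomputable def blockVec (B m : ℕ) (s : Fin B × (Fin m → Bool)) (p : Fin B × Fin m) : ℝ :=
  if p.1 = s.1 then sgn (s.2 p.2) / √m else 0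

theorem sum_gridVec_sq_le (hB : 1 ≤ B) (hm : 1 ≤ m) (hq : 2 ≤ q) (a : Fin B × Fin m → Fin q) :
    ∑ p, gridVec B m q a p ^ 2 ≤ 1 := by
  have hB' : (1 : ℝ) ≤ B := by exact_mod_cast hB
  have hm' : (1 : ℝ) ≤ m := by exact_mod_cast hm
  have hq' : (2 : ℝ) ≤ q := by exact_mod_cast hq
  calc ∑ p, gridVec B m q a p ^ 2 ≤ ∑ _p : Fin B × Fin m, 1 / (B * m : ℝ) := by
        refine sum_le_sum fun p _ => ?_
        unfold gridVec
        rw [div_pow, Real.sq_sqrt (by positivity)]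
        have h1 : ((a p : ℕ) : ℝ) + 1 ≤ q := by exact_mod_cast (a p).2
        have h2 : 2 * ((a p : ℕ) : ℝ) / (q - 1) ≤ 2 := by
          rw [div_le_iff₀ (by linarith)]; linarith
        have h3 : 0 ≤ 2 * ((a p : ℕ) : ℝ) / (q - 1) := div_nonneg (by positivity) (by linarith)
        gcongr
        rw [sq_le_one_iff_abs_le_one, abs_le]
        constructor <;> linarith
    _ = 1 := by
        rw [sum_const, card_univ, Fintype.card_prod, Fintype.card_fin, Fintype.card_fin,
          nsmul_eq_mul]
        push_cast
        field_simp

theorem sum_mul_blockVec (v : Fin B × Fin m → ℝ) (s : Fin B × (Fin m → Bool)) :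
    ∑ p, v p * blockVec B m s p = ∑ i, v (s.1, i) * (sgn (s.2 i) / √m) := by
  rw [Fintype.sum_prod_type]
  simp only [blockVec, mul_ite, mul_zero]
  rw [sum_eq_single s.1]
  · simp
  · intro b _ hb
    simp [hb]
  · simp

theorem sum_blockVec_sq (hm : 1 ≤ m) (s : Fin B × (Fin m → Bool)) :
    ∑ p, blockVec B m s p ^ 2 = 1 := by
  have hm' : (1 : ℝ) ≤ m := by exact_mod_cast hm
  simp only [pow_two]
  rw [sum_mul_blockVec]
  have : ∀ i, blockVec B m s (s.1, i) * (sgn (s.2 i) / √m) = 1 / m := by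
    intro i
    have h1 : sgn (s.2 i) * sgn (s.2 i) = 1 := by cases s.2 i <;> simp [sgn]
    simp only [blockVec, if_true]
    rw [div_mul_div_comm, h1, Real.mul_self_sqrt (by positivity)]
  simp only [this, sum_const, card_univ, Fintype.card_fin, nsmul_eq_mul]
  field_simp

/-- Words whose points have almost the same inner products with all block vectors are close. -/
theorem hammingDist_le_of_inner {ε : ℝ} (hB : 1 ≤ B) (hm : 1 ≤ m) (hq : 2 ≤ q)
    (hqε : (q - 1) * (2.1 * ε * √B) ≤ 1) {a b : Fin B × Fin m → Fin q}
    (h : ∀ s, |∑ p, (gridVec B m q a p - gridVec B m q b p) * blockVec B m s p| ≤ 1.05 * ε) :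
    hammingDist a b ≤ B * m / 4 := by
  have hB' : (1 : ℝ) ≤ B := by exact_mod_cast hB
  have hm' : (1 : ℝ) ≤ m := by exact_mod_cast hm
  have hq' : (2 : ℝ) ≤ q := by exact_mod_cast hq
  have hsB : 0 < √(B : ℝ) := by positivity
  have hsm : 0 < √(m : ℝ) := by positivity
  have hsBm : √((B : ℝ) * m) = √B * √m := Real.sqrt_mul (by linarith) _
  have hblock : ∀ β : Fin B, ∑ i, |gridVec B m q a (β, i) - gridVec B m q b (β, i)| ≤
      1.05 * ε * √m := by
    intro β
    -- The sign vector is chosen to match the signs of the difference, so its inner product is the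
    -- ℓ¹ norm of the difference on the block, up to √m.
    have h1 := h (β, fun i => decide (0 ≤ gridVec B m q a (β, i) - gridVec B m q b (β, i)))
    rw [sum_mul_blockVec (fun p => gridVec B m q a p - gridVec B m q b p)] at h1
    have h2 : ∀ i, (gridVec B m q a (β, i) - gridVec B m q b (β, i)) *
        (sgn (decide (0 ≤ gridVec B m q a (β, i) - gridVec B m q b (β, i))) / √m) =
        |gridVec B m q a (β, i) - gridVec B m q b (β, i)| / √m := by
      intro i
      by_cases h0 : 0 ≤ gridVec B m q a (β, i) - gridVec B m q b (β, i)
      · simp only [h0, decide_true, sgn, if_true, abs_of_nonneg h0]; ring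
      · simp only [h0, decide_false, sgn, abs_of_neg (not_le.1 h0)]
        simp
        ring
    simp only [h2, ← sum_div] at h1
    rw [abs_of_nonneg (by positivity), div_le_iff₀ hsm] at h1
    exact h1
  -- Two different letters are at least one grid step 2/(q - 1) apart, scaled by 1/√(Bm). Summing
  -- over the entries turns the ℓ¹ bound into a bound for the Hamming distance.
  have hentry : ∀ p, (if a p ≠ b p then 2 / ((q - 1) * (√B * √m)) else 0) ≤
      |gridVec B m q a p - gridVec B m q b p| := by
    intro p
    split_ifs with hp
    · have e1 : gridVec B m q a p - gridVec B m q b p =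
          (2 / ((q - 1) * (√B * √m))) * (((a p : ℕ) : ℝ) - (b p : ℕ)) := by
        unfold gridVec
        rw [hsBm]
        have : (q - 1 : ℝ) ≠ 0 := by linarith
        field_simp
        ring
      have e2 : 1 ≤ |((a p : ℕ) : ℝ) - (b p : ℕ)| := by
        have hne : ((a p : ℕ) : ℤ) - (b p : ℕ) ≠ 0 := by
          intro h0
          exact hp (Fin.ext (by omega))
        have := Int.one_le_abs hne
        exact_mod_cast this
      have hpos : 0 < 2 / ((q - 1 : ℝ) * (√B * √m)) := by
        have : (0 : ℝ) < q - 1 := by linarith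
        positivity
      rw [e1, abs_mul, abs_of_pos hpos]
      nlinarith
    · exact abs_nonneg _
  have hsum : (hammingDist a b : ℝ) * (2 / ((q - 1) * (√B * √m))) ≤ B * (1.05 * ε * √m) := by
    calc (hammingDist a b : ℝ) * (2 / ((q - 1) * (√B * √m)))
        = ∑ p, (if a p ≠ b p then 2 / ((q - 1) * (√B * √m)) else 0) := by
          rw [← sum_filter, sum_const, nsmul_eq_mul]
          rfl
      _ ≤ ∑ p, |gridVec B m q a p - gridVec B m q b p| := sum_le_sum fun p _ => hentry p
      _ = ∑ β, ∑ i, |gridVec B m q a (β, i) - gridVec B m q b (β, i)| :=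
          Fintype.sum_prod_type _
      _ ≤ ∑ _β : Fin B, 1.05 * ε * √m := sum_le_sum fun β _ => hblock β
      _ = _ := by simp
  have hq1 : (0 : ℝ) < q - 1 := by linarith
  rw [← mul_div_assoc, div_le_iff₀ (by positivity)] at hsum
  have hfin : 4 * (hammingDist a b : ℝ) ≤ B * m := by
    calc 4 * (hammingDist a b : ℝ) = 2 * (hammingDist a b * 2) := by ring
      _ ≤ 2 * (B * (1.05 * ε * √m) * ((q - 1) * (√B * √m))) := by gcongr
      _ = B * ((q - 1) * (2.1 * ε * √B)) * (√m * √m) := by ring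
      _ ≤ B * 1 * (√m * √m) := by gcongr
      _ = B * m := by rw [Real.mul_self_sqrt (by linarith), mul_one]
  have : 4 * hammingDist a b ≤ B * m := by exact_mod_cast hfin
  omega

/-- The lower bound for the length of sketches. -/
theorem SketchesExist.le {n k : ℕ} {ε : ℝ} {L : ℕ} (hS : SketchesExist n k ε L) (hn : 0 < n)
    (hε : 0 < ε) (hε' : ε ≤ 1 / 10) (hB : 1 ≤ B) (hm : 1 ≤ m) (hBm : B * m ≤ k)
    (hBn : 2 * (B * 2 ^ m) ≤ n) (hq : 5 ≤ q) (hqε : (q - 1) * (2.1 * ε * √B) ≤ 1) :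
    (B * m : ℕ) * Real.log q ≤ 10 * L := by
  have hk : 1 ≤ k := le_trans (Nat.mul_le_mul hB hm) hBm
  set ι : Fin B × Fin m → Fin k := fun p => Fin.castLE hBm (finProdFinEquiv p) with hι
  have hinj : Function.Injective ι :=
    (Fin.castLE_injective hBm).comp finProdFinEquiv.injective
  have hcount := hS.card_le hk hn hε hε' (Q := Fin B × Fin m → Fin q)
    (S := Fin B × (Fin m → Bool)) (φ := fun a => embed ι (gridVec B m q a))
    (ρ := fun s => embed ι (blockVec B m s)) (neg := fun s => (s.1, fun i => !s.2 i))
    (close := fun a => univ.filter fun b => hammingDist a b ≤ B * m / 4)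
    (M := 2 ^ (B * m) * q ^ (B * m / 4)) (fun s => ?_)
    (fun a => norm_embed_le hinj (sum_gridVec_sq_le hB hm (by omega) a))
    (fun s => norm_embed_le hinj (sum_blockVec_sq hm s).le) (by simpa using hBn)
    (fun a b hab => ?_) fun a => ?_
  · rw [Fintype.card_fun, Fintype.card_prod, Fintype.card_fin, Fintype.card_fin,
      Fintype.card_fin] at hcount
    set D := B * m
    have hq' : (5 : ℝ) ≤ q := by exact_mod_cast hq
    -- In logarithms, D log q ≤ D log 2 + (D/4) log q + L log 9. As q ≥ 4, the first term is at most
    -- half of the left-hand side, which leaves (D/4) log q ≤ 2.2 L.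
    have h1 : (q : ℝ) ^ D ≤ 2 ^ D * q ^ (D / 4) * 9 ^ L := by exact_mod_cast hcount
    have h2 := Real.log_le_log (by positivity) h1
    rw [Real.log_mul (by positivity) (by positivity), Real.log_mul (by positivity) (by positivity),
      Real.log_pow, Real.log_pow, Real.log_pow, Real.log_pow] at h2
    have h3 : ((D / 4 : ℕ) : ℝ) ≤ D / 4 := Nat.cast_div_le
    have h4 : 2 * Real.log 2 ≤ Real.log q := by
      rw [← Real.log_rpow (by norm_num)]
      exact Real.log_le_log (by positivity) (by norm_num; linarith)
    have h5 : Real.log 9 ≤ 2.2 := by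
      rw [show (9 : ℝ) = 3 ^ 2 by norm_num, Real.log_pow]
      have h6 : Real.log 3 ≤ 1.1 := by
        rw [Real.log_le_iff_le_exp (by norm_num)]
        have e := Real.exp_one_gt_d9
        have h7 : Real.exp 1.1 = Real.exp 1 * Real.exp 0.1 := by
          rw [← Real.exp_add]; norm_num
        have h8 := Real.quadratic_le_exp_of_nonneg (x := 0.1) (by norm_num)
        rw [h7]
        norm_num at h8 ⊢
        nlinarith
      push_cast
      norm_num at h6 ⊢
      linarith
    have h6 : 0 ≤ Real.log q := Real.log_nonneg (by linarith)
    have hD0 : (0 : ℝ) ≤ D := Nat.cast_nonneg _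
    have hL0 : (0 : ℝ) ≤ L := Nat.cast_nonneg _
    have h7 : (D : ℝ) * Real.log 2 ≤ D * (Real.log q / 2) := by gcongr; linarith
    have h8 : ((D / 4 : ℕ) : ℝ) * Real.log q ≤ D / 4 * Real.log q := by gcongr
    have h9 : (L : ℝ) * Real.log 9 ≤ L * 2.2 := by gcongr
    norm_num at h9
    linarith
  · rw [← embed_neg hinj]
    congr 1
    ext p
    simp only [blockVec, Pi.neg_apply]
    split_ifs
    · cases s.2 p.2 <;> simp [sgn, neg_div]
    · simp
  · refine mem_filter.2 ⟨mem_univ _, hammingDist_le_of_inner hB hm (by omega) hqε fun s => ?_⟩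
    have := hab s
    rw [embed_sub hinj, inner_embed hinj] at this
    exact this
  · have := card_hamming_le (I := Fin B × Fin m) (by omega) a (B * m / 4)
    rwa [Fintype.card_prod, Fintype.card_fin, Fintype.card_fin] at this

end

end DistanceSketch

namespace DistanceSketch

/-! ### The choice of blocks and levels in the three ranges. -/

section

variable {n k L : ℕ} {ε : ℝ}

/-- The number of levels of the grid. -/
theorem exists_levels {B : ℕ} (hε : 0 < ε) (hB : 1 ≤ B) (hBε : B * ε ^ 2 ≤ 1 / 100) :
    ∃ q : ℕ, 5 ≤ q ∧ ((q : ℝ) - 1) * (2.1 * ε * √B) ≤ 1 ∧ 1 ≤ (q : ℝ) ^ 2 * (5 * (B * ε ^ 2)) := by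
  have hB' : (1 : ℝ) ≤ B := by exact_mod_cast hB
  have hsB : 0 < √(B : ℝ) := by positivity
  have hsq : (ε * √B) ^ 2 = B * ε ^ 2 := by
    rw [mul_pow, Real.sq_sqrt (by linarith), mul_comm]
  have hle : ε * √B ≤ 1 / 10 := by
    refine le_of_sq_le_sq ?_ (by norm_num)
    rw [hsq]
    norm_num at hBε ⊢
    exact hBε
  have ht : 0 < 2.1 * ε * √B := by positivity
  -- Since ε√B ≤ 1/10, the quotient is at least 1/0.21, which exceeds 4.
  have h1 : 4 ≤ ⌊1 / (2.1 * ε * √B)⌋₊ := by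
    refine Nat.le_floor ?_
    rw [le_div_iff₀ ht]
    push_cast
    norm_num
    linarith
  have h2 := Nat.floor_le (by positivity : 0 ≤ 1 / (2.1 * ε * √B))
  have h3 := Nat.lt_floor_add_one (1 / (2.1 * ε * √B))
  rw [le_div_iff₀ ht] at h2
  rw [div_lt_iff₀ ht] at h3
  refine ⟨⌊1 / (2.1 * ε * √B)⌋₊ + 1, by omega, ?_, ?_⟩
  · push_cast
    rw [add_sub_cancel_right]
    exact h2
  · push_cast
    rw [← hsq]
    set q : ℝ := (⌊1 / (2.1 * ε * √B)⌋₊ : ℝ) + 1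
    set y := ε * √B with hy
    have h4 : 1 < q * (2.1 * y) := by rw [hy, ← mul_assoc 2.1]; exact h3
    have h5 : 0 < q * y := by norm_num at h4; linarith
    norm_num at h4
    nlinarith

/-- The length of the blocks. -/
def blockLength (n : ℕ) : ℕ := 1 + Nat.log 2 n / 100

theorem lam_le_blockLength (n : ℕ) : lam n ≤ 100 * blockLength n := by
  unfold lam blockLength
  omega

theorem InRange.log_le_blockLength (h : InRange n ε) : Real.log n ≤ 100 * blockLength n :=
  h.log_le_lam.trans (by exact_mod_cast lam_le_blockLength n)

theorem InRange.blockLength_le (h : InRange n ε) : (blockLength n : ℝ) ≤ Real.log n := by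
  have h1 := h.lam_le
  have h2 := h.four_le_log
  have h3 : 50 * blockLength n ≤ 50 + lam n := by unfold lam blockLength; omega
  have h4 : (50 : ℝ) * blockLength n ≤ 50 + lam n := by exact_mod_cast h3
  linarith

/-- From ε ≥ n^(-0.49) follows B ≤ n^0.98/100, while 2^m ≤ 2n^0.01. The exponents add up to less
than 1; an exponent 1/2 in the assumption would leave no room for the 2^m sign vectors. -/
theorem InRange.blocks_le (h : InRange n ε) {B m : ℕ} (hBε : B * ε ^ 2 ≤ 1 / 100)
    (hm : m ≤ blockLength n) : 2 * (B * 2 ^ m) ≤ n := by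
  have hn : (1 : ℝ) ≤ n := by exact_mod_cast h.pos
  have hn0 : (0 : ℝ) < n := by linarith
  have hε := h.eps_pos
  have h1 : 1 ≤ ε ^ 2 * (n : ℝ) ^ (0.98 : ℝ) := by
    have h3 := h.le
    rw [div_le_iff₀ (by positivity)] at h3
    have h4 : (n : ℝ) ^ (0.98 : ℝ) = ((n : ℝ) ^ (0.49 : ℝ)) ^ 2 := by
      rw [← Real.rpow_natCast, ← Real.rpow_mul hn0.le]
      norm_num
    rw [h4, ← mul_pow]
    exact one_le_pow₀ h3
  have h2 : (2 : ℝ) ^ (Nat.log 2 n / 100) ≤ (n : ℝ) ^ (0.01 : ℝ) := by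
    have h3 : ((2 : ℝ) ^ (Nat.log 2 n / 100)) ^ 100 ≤ n := by
      rw [← pow_mul]
      calc (2 : ℝ) ^ (Nat.log 2 n / 100 * 100) ≤ 2 ^ Nat.log 2 n :=
            pow_le_pow_right₀ (by norm_num) (Nat.div_mul_le_self _ _)
        _ ≤ n := by exact_mod_cast Nat.pow_log_le_self 2 h.pos.ne'
    have h4 := Real.rpow_le_rpow (by positivity) h3 (by norm_num : (0 : ℝ) ≤ 0.01)
    rw [← Real.rpow_natCast (_ ^ _) 100, ← Real.rpow_mul (by positivity)] at h4
    norm_num at h4 ⊢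
    exact h4
  have h3 : (2 : ℝ) ^ m ≤ 2 * (n : ℝ) ^ (0.01 : ℝ) := by
    calc (2 : ℝ) ^ m ≤ 2 ^ blockLength n := pow_le_pow_right₀ (by norm_num) hm
      _ = 2 * 2 ^ (Nat.log 2 n / 100) := by rw [blockLength, pow_add, pow_one]
      _ ≤ _ := by gcongr
  have h4 : (B : ℝ) ≤ (n : ℝ) ^ (0.98 : ℝ) / 100 := by
    have h5 : 0 < (n : ℝ) ^ (0.98 : ℝ) := by positivity
    have hB0 : (0 : ℝ) ≤ B := Nat.cast_nonneg _
    calc (B : ℝ) = B * 1 := by ring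
      _ ≤ B * (ε ^ 2 * (n : ℝ) ^ (0.98 : ℝ)) := by gcongr
      _ = B * ε ^ 2 * (n : ℝ) ^ (0.98 : ℝ) := by ring
      _ ≤ 1 / 100 * (n : ℝ) ^ (0.98 : ℝ) := by gcongr
      _ = _ := by ring
  have h5 : (n : ℝ) ^ (0.98 : ℝ) * (n : ℝ) ^ (0.01 : ℝ) ≤ n := by
    rw [← Real.rpow_add hn0]
    calc (n : ℝ) ^ (0.98 + 0.01 : ℝ) ≤ (n : ℝ) ^ (1 : ℝ) :=
          Real.rpow_le_rpow_of_exponent_le hn (by norm_num)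
      _ = n := Real.rpow_one _
  have h6 : (2 : ℝ) * (B * 2 ^ m) ≤ n := by
    calc (2 : ℝ) * (B * 2 ^ m) ≤
          2 * ((n : ℝ) ^ (0.98 : ℝ) / 100 * (2 * (n : ℝ) ^ (0.01 : ℝ))) := by gcongr
      _ = 4 / 100 * ((n : ℝ) ^ (0.98 : ℝ) * (n : ℝ) ^ (0.01 : ℝ)) := by ring
      _ ≤ 4 / 100 * n := by gcongr
      _ ≤ n := by linarith
  exact_mod_cast h6

/-- The largest number of blocks. -/
noncomputable def maxBlocks (ε : ℝ) : ℕ := ⌊1 / (100 * ε ^ 2)⌋₊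

theorem InRange.maxBlocks_spec (h : InRange n ε) : 1 ≤ maxBlocks ε ∧
    maxBlocks ε * ε ^ 2 ≤ 1 / 100 ∧ 1 ≤ 200 * (maxBlocks ε * ε ^ 2) := by
  have hε := h.eps_pos
  have hε2 : 0 < ε ^ 2 := by positivity
  have h1 := h.sq_le
  have h2 : 1 ≤ 1 / (100 * ε ^ 2) := by
    rw [le_div_iff₀ (by positivity)]
    linarith
  have h3 : 1 ≤ maxBlocks ε := Nat.le_floor (by exact_mod_cast h2)
  have h4 : (maxBlocks ε : ℝ) ≤ 1 / (100 * ε ^ 2) := Nat.floor_le (by positivity)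
  have h5 : 1 / (100 * ε ^ 2) < maxBlocks ε + 1 := Nat.lt_floor_add_one _
  have h6 : (1 : ℝ) ≤ maxBlocks ε := by exact_mod_cast h3
  rw [le_div_iff₀ (by positivity)] at h4
  rw [div_lt_iff₀ (by positivity)] at h5
  refine ⟨h3, by linarith, by nlinarith⟩

theorem InRange.le_of_sketchesExist (h : InRange n ε) (hS : SketchesExist n k ε L) {B m : ℕ}
    (hB : 1 ≤ B) (hm : 1 ≤ m) (hBm : B * m ≤ k) (hBε : B * ε ^ 2 ≤ 1 / 100)
    (hmn : m ≤ blockLength n) :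
    ∃ q : ℝ, 5 ≤ q ∧ 1 ≤ q ^ 2 * (5 * (B * ε ^ 2)) ∧ B * m * Real.log q ≤ 10 * L := by
  obtain ⟨q, hq, h1, h2⟩ := exists_levels h.eps_pos hB hBε
  refine ⟨q, by exact_mod_cast hq, h2, ?_⟩
  have hε' := h.le'
  have := hS.le h.pos h.eps_pos (by norm_num at hε' ⊢; exact hε') hB hm hBm (h.blocks_le hBε hmn)
    hq h1
  push_cast at this
  exact this

/-- A single block, covering a fixed fraction of the coordinates; the number of levels is then of
order 1/ε. -/
theorem InRange.low_optimal (h : InRange n ε) (hk : 1 ≤ k) (hk' : (k : ℝ) ≤ Real.log n)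
    (hS : SketchesExist n k ε L) : k * Real.log (1 / ε) ≤ 2000 * L := by
  have hε := h.eps_pos
  have hε2 := h.sq_le
  have hb1 : 1 ≤ blockLength n := by unfold blockLength; omega
  have hb2 := h.log_le_blockLength
  obtain ⟨q, hq, h1, h2⟩ := h.le_of_sketchesExist hS (B := 1) (m := min k (blockLength n)) le_rfl
    (le_min hk hb1) (by rw [one_mul]; exact min_le_left _ _) (by simpa using hε2) (min_le_right _ _)
  have hkm : k ≤ 100 * min k (blockLength n) := by
    have : k ≤ 100 * blockLength n := by exact_mod_cast hk'.trans hb2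
    rcases min_choice k (blockLength n) with h3 | h3 <;> rw [h3] <;> omega
  have hkm' : (k : ℝ) ≤ 100 * (min k (blockLength n) : ℕ) := by exact_mod_cast hkm
  have hlog : Real.log (1 / ε) ≤ 2 * Real.log q := by
    rw [← Real.log_rpow (by linarith)]
    refine Real.log_le_log (by positivity) ?_
    rw [div_le_iff₀ hε]
    norm_num at h1 ⊢
    nlinarith
  have hlog0 : 0 ≤ Real.log q := Real.log_nonneg (by linarith)
  rw [Nat.cast_one, one_mul] at h2
  calc (k : ℝ) * Real.log (1 / ε) ≤ 100 * (min k (blockLength n) : ℕ) * (2 * Real.log q) := by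
        have := h.one_le_log_inv
        gcongr
    _ = 200 * ((min k (blockLength n) : ℕ) * Real.log q) := by ring
    _ ≤ 200 * (10 * L) := by gcongr
    _ = _ := by ring

/-- As many blocks of length about log n/100 as fit into k coordinates and below 1/(100ε²). They
cover a fixed fraction of the coordinates, and q² is at least of order 1/(Bε²), hence of order log
n/(ε²k). -/
theorem InRange.mid_optimal (h : InRange n ε) (hk : Real.log n ≤ k)
    (hk' : (k : ℝ) ≤ Real.log n / ε ^ 2) (hS : SketchesExist n k ε L) :
    k * Real.log (2 + Real.log n / (ε ^ 2 * k)) ≤ 2 ^ 22 * L := by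
  have hε := h.eps_pos
  have hε2 : 0 < ε ^ 2 := by positivity
  have h4 := h.four_le_log
  have hk0 : (0 : ℝ) < k := by linarith
  have hb1 : 1 ≤ blockLength n := by unfold blockLength; omega
  have hb2 := h.log_le_blockLength
  have hb3 := h.blockLength_le
  obtain ⟨hB1, hB2, hB3⟩ := h.maxBlocks_spec
  have hmk : blockLength n ≤ k := by exact_mod_cast hb3.trans hk
  set m := blockLength n
  set B := min (maxBlocks ε) (k / m) with hB
  have hkm1 : 1 ≤ k / m := (Nat.one_le_div_iff (by omega)).2 hmk
  have hBm : B * m ≤ k := (Nat.mul_le_mul_right m (min_le_right _ _)).trans (Nat.div_mul_le_self k m)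
  have hBle : (B : ℝ) ≤ maxBlocks ε := by exact_mod_cast min_le_left _ _
  obtain ⟨q, hq, h1, h2⟩ := h.le_of_sketchesExist hS (B := B) (m := m) (le_min hB1 hkm1)
    hb1 hBm (le_trans (by gcongr) hB2) le_rfl
  have hBm' : (B : ℝ) * m ≤ k := by exact_mod_cast hBm
  have hkD : (k : ℝ) ≤ 20000 * (B * m) := by
    rcases min_choice (maxBlocks ε) (k / m) with h3 | h3
    · rw [hB, h3]
      rw [le_div_iff₀ hε2] at hk'
      refine le_of_mul_le_mul_right ?_ hε2
      calc (k : ℝ) * ε ^ 2 ≤ 100 * m * 1 := by linarith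
        _ ≤ 100 * m * (200 * (maxBlocks ε * ε ^ 2)) := by gcongr
        _ = _ := by ring
    · have h5 : k ≤ 2 * (k / m * m) := by
        have h6 := Nat.div_add_mod k m
        have h7 := Nat.mod_lt k (show 0 < m by omega)
        have h8 : m ≤ m * (k / m) := Nat.le_mul_of_pos_right _ hkm1
        rw [mul_comm (k / m)]
        omega
      have h6 : (k : ℝ) ≤ 2 * ((k / m : ℕ) * m) := by exact_mod_cast h5
      rw [hB, h3]
      have h7 : (0 : ℝ) ≤ (k / m : ℕ) * m := by positivity
      linarith
  set A := Real.log n / (ε ^ 2 * k) with hA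
  have hA1 : 1 ≤ A := by
    rw [hA, le_div_iff₀ (by positivity)]
    rw [le_div_iff₀ hε2] at hk'
    linarith
  have hqA : A ≤ 500 * q ^ 2 := by
    rw [hA, div_le_iff₀ (by positivity)]
    calc Real.log n = Real.log n * 1 := by ring
      _ ≤ 100 * m * (q ^ 2 * (5 * (B * ε ^ 2))) := by gcongr
      _ = 500 * q ^ 2 * (ε ^ 2 * (B * m)) := by ring
      _ ≤ 500 * q ^ 2 * (ε ^ 2 * k) := by gcongr
  have hlog : Real.log (2 + A) ≤ 8 * Real.log q := by
    rw [← Real.log_rpow (by linarith)]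
    refine Real.log_le_log (by linarith) ?_
    have h6 : (5 : ℝ) ^ 6 ≤ q ^ 6 := pow_le_pow_left₀ (by norm_num) hq 6
    have h7 : q ^ (8 : ℝ) = q ^ 6 * q ^ 2 := by
      rw [← pow_add]
      exact_mod_cast Real.rpow_natCast q 8
    rw [h7]
    have h8 : 0 < q ^ 2 := by positivity
    nlinarith
  have hlog0 : 0 ≤ Real.log q := Real.log_nonneg (by linarith)
  have hL0 : (0 : ℝ) ≤ L := Nat.cast_nonneg _
  calc (k : ℝ) * Real.log (2 + A) ≤ 20000 * (B * m) * (8 * Real.log q) := by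
        have : 0 ≤ Real.log (2 + A) := Real.log_nonneg (by linarith)
        gcongr
    _ = 160000 * (B * m * Real.log q) := by ring
    _ ≤ 160000 * (10 * L) := by gcongr
    _ ≤ _ := by linarith

/-- The largest admissible number of blocks already uses log n/ε² coordinates up to a constant, with
at least five levels; further coordinates are not needed. -/
theorem InRange.high_optimal (h : InRange n ε) (hk : Real.log n / ε ^ 2 ≤ k)
    (hS : SketchesExist n k ε L) : Real.log n / ε ^ 2 ≤ 2 ^ 22 * L := by
  have hε := h.eps_pos
  have hε2 : 0 < ε ^ 2 := by positivity
  have h4 := h.four_le_log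
  have hb1 : 1 ≤ blockLength n := by unfold blockLength; omega
  have hb2 := h.log_le_blockLength
  have hb3 := h.blockLength_le
  obtain ⟨hB1, hB2, hB3⟩ := h.maxBlocks_spec
  set m := blockLength n
  have hBm : maxBlocks ε * m ≤ k := by
    have h5 : (maxBlocks ε * m : ℝ) ≤ k := by
      refine le_trans ?_ hk
      rw [le_div_iff₀ hε2]
      calc (maxBlocks ε * m : ℝ) * ε ^ 2 = maxBlocks ε * ε ^ 2 * m := by ring
        _ ≤ 1 / 100 * Real.log n := by gcongr
        _ ≤ _ := by linarith
    exact_mod_cast h5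
  obtain ⟨q, hq, h1, h2⟩ := h.le_of_sketchesExist hS hB1 hb1 hBm hB2 le_rfl
  have hlog : 1 ≤ Real.log q := by
    rw [Real.le_log_iff_exp_le (by linarith)]
    have e := Real.exp_one_lt_d9
    linarith
  have hL0 : (0 : ℝ) ≤ L := Nat.cast_nonneg _
  have h5 : (maxBlocks ε : ℝ) * m ≤ maxBlocks ε * m * Real.log q :=
    le_mul_of_one_le_right (by positivity) hlog
  have h6 : Real.log n / ε ^ 2 ≤ 20000 * (maxBlocks ε * m) := by
    rw [div_le_iff₀ hε2]
    calc Real.log n ≤ 100 * m * 1 := by linarith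
      _ ≤ 100 * m * (200 * (maxBlocks ε * ε ^ 2)) := by gcongr
      _ = _ := by ring
  linarith

end

end DistanceSketch

/-! ### The main theorem. -/

theorem theorem4p1 :
    ∃ (κ : ℕ) (enc dec : DistanceSketch.Prog) (g : ℕ → ℕ → ℝ → ℕ) (c C : ℝ), 0 < c ∧ 0 < C ∧
      ∀ (n k : ℕ) (ε : ℝ), 0 < n → 1 / (n : ℝ) ^ (0.49 : ℝ) ≤ ε → ε ≤ 0.1 →
        -- high dimension
        (Real.log n / ε ^ 2 ≤ k → k ≤ n →
          c * (Real.log n / ε ^ 2) ≤ g n k ε ∧ g n k ε ≤ C * (Real.log n / ε ^ 2) ∧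
          DistanceSketch.IsSketchAlgorithm κ enc dec n k ε (g n k ε)
            (C * (k * Real.log k + Real.log n ^ 3 / ε ^ 2)) (C * (Real.log n / ε ^ 2))) ∧
        -- intermediate dimension
        (Real.log n ≤ k → k ≤ Real.log n / ε ^ 2 →
          c * (k * Real.log (2 + Real.log n / (ε ^ 2 * k))) ≤ g n k ε ∧
          g n k ε ≤ C * (k * Real.log (2 + Real.log n / (ε ^ 2 * k))) ∧
          DistanceSketch.IsSketchAlgorithm κ enc dec n k ε (g n k ε)
            (C * g n k ε) (C * k)) ∧
        -- low dimension
        (1 ≤ k → k ≤ Real.log n →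
          c * (k * Real.log (1 / ε)) ≤ g n k ε ∧ g n k ε ≤ C * (k * Real.log (1 / ε)) ∧
          DistanceSketch.IsSketchAlgorithm κ enc dec n k ε (g n k ε)
            (C * g n k ε) (C * k)) ∧
        -- optimality of the length, in all three ranges
        (1 ≤ k → (k ≤ n ∨ k ≤ Real.log n / ε ^ 2) →
          ∀ L : ℕ, DistanceSketch.SketchesExist n k ε L → c * g n k ε ≤ L) := by
  -- The constant 2^60 is crude: it covers the time factor 2^44 and, for optimality, the product of
  -- 2^34 from the length and 2^22 from the lower bound.
  refine ⟨16, DistanceSketch.sketchProg, DistanceSketch.recoverProg, fun n k ε => DistanceSketch.sketchLength (DistanceSketch.lam n) k ε, 1 / 2 ^ 60, 2 ^ 60,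
    by positivity, by positivity, fun n k ε hn h1 h2 => ?_⟩
  have h : DistanceSketch.InRange n ε := ⟨hn, h1, h2⟩
  have hε := h.eps_pos
  have h4 := h.four_le_log
  have hQ : 0 < Real.log n / ε ^ 2 := by positivity
  have hg0 : (0 : ℝ) ≤ DistanceSketch.sketchLength (DistanceSketch.lam n) k ε := Nat.cast_nonneg _
  have hk0 : (0 : ℝ) ≤ k := Nat.cast_nonneg _
  refine ⟨fun hk hkn => ?_, fun hk hk' => ?_, fun hk hk' => ?_, fun hk hkn L hS => ?_⟩
  · have hk1 : 1 ≤ k := by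
      have : (0 : ℝ) < k := hQ.trans_le hk
      exact_mod_cast this
    have hA := h.admissible hk1 (Or.inl hkn)
    obtain ⟨h5, h6⟩ := h.high_length hA hk
    have h7 := h.high_time hA hk
    have h8 := h.dim_le_div hA
    have h9 : 0 ≤ k * Real.log k + Real.log n ^ 3 / ε ^ 2 := by
      have : 0 ≤ Real.log k := Real.log_natCast_nonneg k
      positivity
    refine ⟨by linarith, by linarith, DistanceSketch.isSketchAlgorithm hA (by linarith) ?_⟩
    push_cast
    linarith
  · have hk1 : 1 ≤ k := by
      have : (0 : ℝ) < k := by linarith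
      exact_mod_cast this
    have hA := h.admissible hk1 (Or.inr hk')
    obtain ⟨h5, h6⟩ := h.mid_length hk hk'
    have h7 := DistanceSketch.sketchTime_of_not_project (h.not_project hk')
    have h8 := h.dim_eq hk'
    have h9 : 0 ≤ k * Real.log (2 + Real.log n / (ε ^ 2 * k)) := by linarith
    refine ⟨by linarith, by linarith, DistanceSketch.isSketchAlgorithm hA (by linarith) ?_⟩
    rw [h8]
    push_cast
    linarith
  · have hk2 := hk'.trans h.log_le_div
    have hA := h.admissible hk (Or.inr hk2)
    obtain ⟨h5, h6⟩ := h.low_length hk hk'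
    have h7 := DistanceSketch.sketchTime_of_not_project (h.not_project hk2)
    have h8 := h.dim_eq hk2
    have h9 : 0 ≤ k * Real.log (1 / ε) := by linarith
    refine ⟨by linarith, by linarith, DistanceSketch.isSketchAlgorithm hA (by linarith) ?_⟩
    rw [h8]
    push_cast
    linarith
  · rw [div_mul_eq_mul_div, one_mul, div_le_iff₀ (by positivity)]
    have hL0 : (0 : ℝ) ≤ L := Nat.cast_nonneg _
    -- The assumption on k only bounds it from above, so the applicable range is found by comparing
    -- k with log n and log n/ε²; in each, the upper bound for the length meets the lower bound for
    -- L.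
    rcases le_total (k : ℝ) (Real.log n) with hkl | hkl
    · have h5 := (h.low_length hk hkl).2
      have h6 := h.low_optimal hk hkl hS
      linarith
    · rcases le_total (k : ℝ) (Real.log n / ε ^ 2) with hkQ | hkQ
      · have h5 := (h.mid_length hkl hkQ).2
        have h6 := h.mid_optimal hkl hkQ hS
        linarith
      · have h5 := (h.high_length (h.admissible hk hkn) hkQ).2
        have h6 := h.high_optimal hkQ hS
        linarith
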